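/- Let $\Sigma$ be an orientable hyperbolic punctured surface of finite type, i.e. a space homeomorphic to the closed orientable surface of genus $g\ge 0$ with $n\ge 1$ points removed, where $2g-2+n>0$. Let $I=[0,1]$, and let $\mathcal C$ be the group of $C^\infty$ diffeomorphisms of $I$ that are infinitely tangent to the identity at both endpoints of $I$. A representation $\rho:\pi_1(\Sigma)\to\mathcal C$ is called *well-tapered* if for every nontrivial $\alpha\in\pi_1(\Sigma)$ the fixed points of $\rho(\alpha)$ in $\mathrm{int}(I)$ are isolated. For every continuous function $\eta:(0,1)\to(0,\infty)$ there is a well-tapered representation $\rho:\pi_1(\Sigma)\to\mathcal C$ such that, for every $\gamma\in\pi_1(\Sigma)$ represented by a small loop around a puncture of $\Sigma$ (joined to the base point by any path), * $\rho(\gamma)$ has no fixed point in $\mathrm{int}(I)$, and * $\rho(\gamma)-\mathrm{id}$ tapers off at $\partial I$ as fast as prescribed by $\eta$: for every $k\ge 0$ there is $\varepsilon>0$ such that $\left|\frac{d^k}{dx^k}\bigl(\rho(\gamma)(x)-x\bigr)\right|\le\eta(x)$ for all $x\in(0,\varepsilon)\cup(1-\varepsilon,1)$. -/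

import Mathlib

/-! ### Diffeomorphisms of the interval -/

noncomputable section

/-- A self-homeomorphism of `I = [0,1]` read as a real-valued function of a real variable.
Only its values on `[0,1]` are meaningful (outside it is extended by constants). -/
def realMap (f : unitInterval ≃ₜ unitInterval) (x : ℝ) : ℝ :=
  (f (Set.projIcc 0 1 zero_le_one x) : ℝ)

/-- The function `f - id` on `I`. -/
def displacement (f : unitInterval ≃ₜ unitInterval) (x : ℝ) : ℝ :=
  realMap f x - x

/-- The `k`-th derivative of `f - id` on the interval `I` (one-sided at the endpoints). -/
def displacementDeriv (k : ℕ) (f : unitInterval ≃ₜ unitInterval) (x : ℝ) : ℝ :=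
  iteratedDerivWithin k (displacement f) (Set.Icc 0 1) x

/-- `𝒞`: the `C^∞` diffeomorphisms of `I = [0,1]` which are infinitely tangent to the identity
at both endpoints (all derivatives of `f - id`, of order `0, 1, 2, …`, vanish there). -/
structure IsTaperedDiffeo (f : unitInterval ≃ₜ unitInterval) : Prop where
  smooth : ContDiffOn ℝ (⊤ : ℕ∞) (realMap f) (Set.Icc 0 1)
  smooth_symm : ContDiffOn ℝ (⊤ : ℕ∞) (realMap f.symm) (Set.Icc 0 1)
  tangent_zero : ∀ k : ℕ, displacementDeriv k f 0 = 0
  tangent_one : ∀ k : ℕ, displacementDeriv k f 1 = 0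

/-- A representation in `Homeo(I)` is generic if for every nontrivial element the fixed points in
the interior of `I` are isolated (in the set of all fixed points). -/
def IsGenericRep {G : Type*} [Group G] (ρ : G →* (unitInterval ≃ₜ unitInterval)) : Prop :=
  ∀ α : G, α ≠ 1 → ∀ p : unitInterval, 0 < p → p < 1 → ρ α p = p →
    ∀ᶠ x in nhdsWithin p {p}ᶜ, ρ α x ≠ x

/-- A generic representation is well-tapered if its image lies in `𝒞`. -/
structure IsWellTapered {G : Type*} [Group G]
    (ρ : G →* (unitInterval ≃ₜ unitInterval)) : Prop where
  generic : IsGenericRep ρ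
  tapered : ∀ α : G, IsTaperedDiffeo (ρ α)

/-- `f - id` tapers at `∂I` at least as fast as `η`: every derivative of `f - id` (of order
`0, 1, 2, …`) is bounded by `η` on some neighbourhood of `∂I` in `int(I)`. -/
def TapersWithin (η : ℝ → ℝ) (f : unitInterval ≃ₜ unitInterval) : Prop :=
  ∀ k : ℕ,
    (∀ᶠ x in nhdsWithin (0 : ℝ) (Set.Ioi 0), |displacementDeriv k f x| ≤ η x) ∧
    (∀ᶠ x in nhdsWithin (1 : ℝ) (Set.Iio 1), |displacementDeriv k f x| ≤ η x)

/-! ### Punctured surfaces of finite type -/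

/-- Number of sides of the polygon with boundary word
`∏_{i < g} a_i b_i a_i⁻¹ b_i⁻¹ · ∏_{j < n - 1} d_j d_j⁻¹`. -/
def sideCount (g n : ℕ) : ℕ := 4 * g + 2 * (n - 1)

/-- The side with which side `k` is glued, according to that word. -/
def partnerSide (g k : ℕ) : ℕ :=
  if k < 4 * g then (if k % 4 < 2 then k + 2 else k - 2)
  else (if k % 2 = 0 then k + 1 else k - 1)

/-- The point at parameter `s ∈ [0,1]` of side `k` of the `m`-gon, realised as the closed unit disc
with vertices at the `m`-th roots of unity; sides are traversed counterclockwise. -/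
def sidePoint (m k : ℕ) (s : ℝ) : ℂ :=
  Complex.exp (2 * Real.pi * Complex.I * ((k + s) / m))

/-- Points of the disc identified by gluing: side `k` is glued to its partner, reversing the
boundary orientation (so that the quotient is orientable). -/
def sideGluing (g n : ℕ) (z w : Metric.closedBall (0 : ℂ) 1) : Prop :=
  ∃ k < sideCount g n, ∃ s ∈ Set.Icc (0 : ℝ) 1,
    (z : ℂ) = sidePoint (sideCount g n) k s ∧
    (w : ℂ) = sidePoint (sideCount g n) (partnerSide g k) (1 - s)

/-- For `n ≥ 1` and `2g + n ≥ 2`: the closed orientable surface of genus `g`, obtained from the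
polygon by gluing the sides as in the word above.  The word has `2g + n - 1` letters, and the
vertices of the polygon give `n` points: the free endpoint of each `d_j` is one, and all other
vertices form one more. The Euler characteristic is `n - (2g + n - 1) + 1 = 2 - 2g`.
(`Quot` divides by the equivalence relation that the gluing generates.) -/
abbrev ClosedSurface (g n : ℕ) : Type := Quot (sideGluing g n)

/-- The `n` points of the closed surface that come from the vertices of the polygon. -/
def marking (g n : ℕ) : Set (ClosedSurface g n) :=
  {x | ∃ z : Metric.closedBall (0 : ℂ) 1, (z : ℂ) ^ sideCount g n = 1 ∧ Quot.mk _ z = x}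

/-- `X` is a surface of finite type: orientable of genus `g` with `n ≥ 1` punctures, that is,
homeomorphic to the closed orientable surface of genus `g` with `n` points removed. -/
def IsPuncturedSurface (g n : ℕ) (X : Type*) [TopologicalSpace X] : Prop :=
  1 ≤ n ∧ Nonempty (X ≃ₜ ((marking g n)ᶜ : Set (ClosedSurface g n)))

/-- The open unit disc in `ℂ` without its centre. -/
abbrev PuncturedDisc : Type := {z : ℂ // 0 < ‖z‖ ∧ ‖z‖ < 1}

/-- The point `e^{2πit} / 2` of the circle of radius `1/2`. -/
def circlePoint (t : ℝ) : PuncturedDisc :=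
  ⟨(1 / 2 : ℝ) * Complex.exp ((2 * Real.pi * t : ℝ) * Complex.I), by
    rw [norm_mul, Complex.norm_exp_ofReal_mul_I, Complex.norm_real]; norm_num⟩

/-- `e` is a coordinate around a puncture of `X`: it identifies the punctured unit disc with an
open subset of `X`, and `e z` leaves every compact set (does not accumulate in `X`) as `z → 0`. -/
structure IsPunctureCoordinate {X : Type*} [TopologicalSpace X] (e : PuncturedDisc → X) :
    Prop where
  isOpenEmbedding : Topology.IsOpenEmbedding e
  isClosed_image : IsClosed (e '' {z | ‖(z : ℂ)‖ ≤ 1 / 2})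

/-- `γ ∈ π₁(X, x₀)` is represented by a small loop around a puncture: run along a path `δ` from the
base point to a small circle about the puncture, once around the circle, and back along `δ`. -/
def IsLoopAroundPuncture {X : Type*} [TopologicalSpace X] {x₀ : X}
    (γ : FundamentalGroup X x₀) : Prop :=
  ∃ (e : PuncturedDisc → X) (y : X) (δ : Path x₀ y) (c : Path y y),
    IsPunctureCoordinate e ∧ (∀ t : unitInterval, c t = e (circlePoint t)) ∧
    γ = FundamentalGroup.fromPath
      (Path.Homotopic.Quotient.mk ((δ.trans c).trans δ.symm))

end

/-! The fundamental group of a punctured surface is free, so a representation amounts to a choice of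
one diffeomorphism per generator. The choice has to be generic, flat at the endpoints and controlled
on the peripheral loops.

Flatness. All maps are built on the line. Tame maps are analytic, with `f - id` and all its
derivatives rapidly decaying; they form a group (`tameGroup`). A chart `H` from the line onto
`(0,1)` is chosen so slow that `1/(1+t²) ≤ η (H t)` near infinity and `H'` is at least a multiple of
`1/(1+t²)` (`exists_isSlowChart`). Passing to the coordinate `x = H t` then costs only polynomial
factors, which rapid decay absorbs. Hence every tame map, not only the peripheral ones, becomes an
element of `𝒞` that tapers as prescribed by `η` (`IsSlowChart.tapersWithin_conjHom`).

Isolated fixed points. By analyticity the fixed points of a nontrivial tame map are isolated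
(`IsTame.eventually_ne`), so only faithfulness is needed. This is a Baire category argument: the
generators depend on a parameter in a ball of a Banach space, and nontriviality of a given reduced
word is an open condition. It is dense because one generator can be altered at one point of a
trajectory while being kept at the others (`dense_paramRep_ne_one`).

Peripheral loops. There are two kinds of generators: a map `p` with tiny positive displacement and
an expanding map `q` with fixed point near which it dominates, such that `p q < q p` pointwise
(`genIso_tiny_odd_lt`). In the boundary word `∏ a b a⁻¹ b⁻¹ · ∏ d d⁻¹` the letters `a` and `d` are
tiny and the `b` are expanding. The commutators and the `d` then all move points in a compatible
direction, so that neither a `d` nor the total product has a fixed point.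

No peripheral word is actually computed. The group is embedded in the free group by the holonomy of
a cocycle on the glued polygon (`HandleCover.hol_injective`). A fixed point of a peripheral holonomy
spreads out to a horizontal section over a punctured disc (`Cocycle.exists_isDev_of_fixed`). Its
values in those corners of the polygon that lie in the disc are related by the side letters
(`IsPolygonChart.exists_corner_values`). Once round the polygon these values strictly decrease, yet
they must return to the initial value (`false_of_corner_values`). -/

open Set Filter Topology

noncomputable section

/-! ### Functions of polynomial growth and of rapid decay -/

/-- `u` is bounded by a polynomial. -/
def PolyBounded (u : ℝ → ℝ) : Prop := ∃ (N : ℕ) (C : ℝ), ∀ t, |u t| ≤ C * (1 + t ^ 2) ^ N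

/-- `u` decays faster than any power of `t`. -/
def RapidlyDecaying (u : ℝ → ℝ) : Prop := ∀ N : ℕ, ∃ C : ℝ, ∀ t, |u t| * (1 + t ^ 2) ^ N ≤ C

/-- `u` and its derivatives up to order `n` are bounded by polynomials. -/
def Temp : ℕ → (ℝ → ℝ) → Prop
  | 0, u => PolyBounded u
  | n + 1, u => PolyBounded u ∧ Differentiable ℝ u ∧ Temp n (deriv u)

/-- `u` and its derivatives up to order `n` decay rapidly. -/
def Dec : ℕ → (ℝ → ℝ) → Prop
  | 0, u => RapidlyDecaying u
  | n + 1, u => RapidlyDecaying u ∧ Differentiable ℝ u ∧ Dec n (deriv u)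

lemma one_le_one_add_sq (t : ℝ) : 1 ≤ 1 + t ^ 2 := by nlinarith [sq_nonneg t]

lemma one_add_sq_pow_pos (t : ℝ) (N : ℕ) : 0 < (1 + t ^ 2) ^ N := by positivity

lemma PolyBounded.exists_nonneg {u : ℝ → ℝ} (h : PolyBounded u) :
    ∃ (N : ℕ) (C : ℝ), 0 ≤ C ∧ ∀ t, |u t| ≤ C * (1 + t ^ 2) ^ N := by
  obtain ⟨N, C, h⟩ := h
  refine ⟨N, |C|, abs_nonneg _, fun t => (h t).trans ?_⟩
  gcongr
  exact le_abs_self C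

lemma RapidlyDecaying.polyBounded {u : ℝ → ℝ} (h : RapidlyDecaying u) : PolyBounded u := by
  obtain ⟨C, h⟩ := h 0
  exact ⟨0, C, fun t => by simpa using h t⟩

lemma PolyBounded.add {u v : ℝ → ℝ} (hu : PolyBounded u) (hv : PolyBounded v) :
    PolyBounded (fun t => u t + v t) := by
  obtain ⟨N, C, hC, hu⟩ := hu.exists_nonneg
  obtain ⟨M, D, hD, hv⟩ := hv.exists_nonneg
  refine ⟨N + M, C + D, fun t => (abs_add_le _ _).trans ?_⟩
  have h1 : (1 + t ^ 2) ^ N ≤ (1 + t ^ 2) ^ (N + M) :=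
    pow_le_pow_right₀ (one_le_one_add_sq t) (by omega)
  have h2 : (1 + t ^ 2) ^ M ≤ (1 + t ^ 2) ^ (N + M) :=
    pow_le_pow_right₀ (one_le_one_add_sq t) (by omega)
  nlinarith [hu t, hv t, mul_le_mul_of_nonneg_left h1 hC, mul_le_mul_of_nonneg_left h2 hD]

lemma PolyBounded.mul {u v : ℝ → ℝ} (hu : PolyBounded u) (hv : PolyBounded v) :
    PolyBounded (fun t => u t * v t) := by
  obtain ⟨N, C, hC, hu⟩ := hu.exists_nonneg
  obtain ⟨M, D, hD, hv⟩ := hv.exists_nonneg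
  refine ⟨N + M, C * D, fun t => ?_⟩
  rw [abs_mul, pow_add]
  calc |u t| * |v t| ≤ (C * (1 + t ^ 2) ^ N) * (D * (1 + t ^ 2) ^ M) := by
        gcongr
        exacts [hu t, hv t]
    _ = _ := by ring

lemma RapidlyDecaying.add {u v : ℝ → ℝ} (hu : RapidlyDecaying u) (hv : RapidlyDecaying v) :
    RapidlyDecaying (fun t => u t + v t) := by
  intro N
  obtain ⟨C, hu⟩ := hu N
  obtain ⟨D, hv⟩ := hv N
  refine ⟨C + D, fun t => ?_⟩
  have := mul_le_mul_of_nonneg_right (abs_add_le (u t) (v t)) (one_add_sq_pow_pos t N).le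
  nlinarith [hu t, hv t]

lemma RapidlyDecaying.mul_polyBounded {u v : ℝ → ℝ} (hu : RapidlyDecaying u)
    (hv : PolyBounded v) : RapidlyDecaying (fun t => u t * v t) := by
  intro N
  obtain ⟨M, D, hD, hv⟩ := hv.exists_nonneg
  obtain ⟨C, hu⟩ := hu (N + M)
  refine ⟨C * D, fun t => ?_⟩
  rw [abs_mul]
  calc |u t| * |v t| * (1 + t ^ 2) ^ N
      ≤ |u t| * (D * (1 + t ^ 2) ^ M) * (1 + t ^ 2) ^ N := by gcongr; exact hv t
    _ = |u t| * (1 + t ^ 2) ^ (N + M) * D := by rw [pow_add]; ring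
    _ ≤ C * D := by gcongr; exact hu t

lemma RapidlyDecaying.of_le {u v : ℝ → ℝ} (hu : RapidlyDecaying u) (h : ∀ t, |v t| ≤ |u t|) :
    RapidlyDecaying v := by
  intro N
  obtain ⟨C, hu⟩ := hu N
  exact ⟨C, fun t => (mul_le_mul_of_nonneg_right (h t) (one_add_sq_pow_pos t N).le).trans (hu t)⟩

lemma Dec.rapidlyDecaying {n : ℕ} {u : ℝ → ℝ} (h : Dec n u) : RapidlyDecaying u := by
  cases n with
  | zero => exact h
  | succ n => exact h.1

lemma Temp.of_hasDerivAt {n : ℕ} {u u' : ℝ → ℝ} (h : ∀ t, HasDerivAt u (u' t) t)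
    (h0 : PolyBounded u) (h1 : Temp n u') : Temp (n + 1) u := by
  have : deriv u = u' := funext fun t => (h t).deriv
  exact ⟨h0, fun t => (h t).differentiableAt, this ▸ h1⟩

lemma Dec.of_hasDerivAt {n : ℕ} {u u' : ℝ → ℝ} (h : ∀ t, HasDerivAt u (u' t) t)
    (h0 : RapidlyDecaying u) (h1 : Dec n u') : Dec (n + 1) u := by
  have : deriv u = u' := funext fun t => (h t).deriv
  exact ⟨h0, fun t => (h t).differentiableAt, this ▸ h1⟩

lemma Temp.pred {n : ℕ} : ∀ {u : ℝ → ℝ}, Temp (n + 1) u → Temp n u := by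
  induction n with
  | zero => exact fun h => h.1
  | succ n ih => exact fun h => ⟨h.1, h.2.1, ih h.2.2⟩

lemma Dec.pred {n : ℕ} : ∀ {u : ℝ → ℝ}, Dec (n + 1) u → Dec n u := by
  induction n with
  | zero => exact fun h => h.1
  | succ n ih => exact fun h => ⟨h.1, h.2.1, ih h.2.2⟩

lemma Temp.hasDerivAt {n : ℕ} {u : ℝ → ℝ} (h : Temp (n + 1) u) (t : ℝ) :
    HasDerivAt u (deriv u t) t := (h.2.1 t).hasDerivAt

lemma Dec.hasDerivAt {n : ℕ} {u : ℝ → ℝ} (h : Dec (n + 1) u) (t : ℝ) :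
    HasDerivAt u (deriv u t) t := (h.2.1 t).hasDerivAt

lemma Dec.temp {n : ℕ} : ∀ {u : ℝ → ℝ}, Dec n u → Temp n u := by
  induction n with
  | zero => exact fun h => h.polyBounded
  | succ n ih => exact fun h => ⟨h.1.polyBounded, h.2.1, ih h.2.2⟩

lemma Temp.add {n : ℕ} : ∀ {u v : ℝ → ℝ}, Temp n u → Temp n v → Temp n (fun t => u t + v t) := by
  induction n with
  | zero => exact fun hu hv => PolyBounded.add hu hv
  | succ n ih =>
    exact fun hu hv => Temp.of_hasDerivAt (fun t => (hu.hasDerivAt t).add (hv.hasDerivAt t))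
      (hu.1.add hv.1) (ih hu.2.2 hv.2.2)

lemma Temp.mul {n : ℕ} : ∀ {u v : ℝ → ℝ}, Temp n u → Temp n v → Temp n (fun t => u t * v t) := by
  induction n with
  | zero => exact fun hu hv => PolyBounded.mul hu hv
  | succ n ih =>
    exact fun hu hv => Temp.of_hasDerivAt (fun t => (hu.hasDerivAt t).mul (hv.hasDerivAt t))
      (hu.1.mul hv.1) ((ih hu.2.2 hv.pred).add (ih hu.pred hv.2.2))

lemma Dec.add {n : ℕ} : ∀ {u v : ℝ → ℝ}, Dec n u → Dec n v → Dec n (fun t => u t + v t) := by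
  induction n with
  | zero => exact fun hu hv => RapidlyDecaying.add hu hv
  | succ n ih =>
    exact fun hu hv => Dec.of_hasDerivAt (fun t => (hu.hasDerivAt t).add (hv.hasDerivAt t))
      (hu.1.add hv.1) (ih hu.2.2 hv.2.2)

lemma Dec.mul_temp {n : ℕ} :
    ∀ {u v : ℝ → ℝ}, Dec n u → Temp n v → Dec n (fun t => u t * v t) := by
  induction n with
  | zero => exact fun hu hv => RapidlyDecaying.mul_polyBounded hu hv
  | succ n ih =>
    exact fun hu hv => Dec.of_hasDerivAt (fun t => (hu.hasDerivAt t).mul (hv.hasDerivAt t))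
      (hu.1.mul_polyBounded hv.1) ((ih hu.2.2 hv.pred).add (ih hu.pred hv.2.2))

lemma temp_const (n : ℕ) : ∀ c : ℝ, Temp n (fun _ => c) := by
  have h : ∀ c : ℝ, PolyBounded (fun _ => c) := fun c => ⟨0, |c|, fun t => by simp⟩
  induction n with
  | zero => exact h
  | succ n ih => exact fun c => Temp.of_hasDerivAt (fun t => hasDerivAt_const t c) (h c) (ih 0)

lemma temp_id (n : ℕ) : Temp n (fun t => t) := by
  have h : PolyBounded (fun t => t) := ⟨1, 1, fun t => by
    rw [abs_le]
    constructor <;> nlinarith [sq_nonneg (t - 1), sq_nonneg (t + 1)]⟩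
  cases n with
  | zero => exact h
  | succ n => exact Temp.of_hasDerivAt (fun t => hasDerivAt_id t) h (temp_const n 1)

lemma Dec.const_mul {n : ℕ} {u : ℝ → ℝ} (h : Dec n u) (c : ℝ) : Dec n (fun t => c * u t) := by
  simpa only [mul_comm] using h.mul_temp (temp_const n c)

lemma Dec.neg {n : ℕ} {u : ℝ → ℝ} (h : Dec n u) : Dec n (fun t => -u t) := by
  simpa using h.const_mul (-1)

lemma Temp.comp {n : ℕ} : ∀ {φ f : ℝ → ℝ}, Temp n φ → Temp n f → Temp n (fun t => φ (f t)) := by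
  have key : ∀ {φ f : ℝ → ℝ}, PolyBounded φ → PolyBounded f → PolyBounded (fun t => φ (f t)) := by
    intro φ f hφ hf
    obtain ⟨N, C, hC, hφ⟩ := hφ.exists_nonneg
    obtain ⟨M, D, hD, hf⟩ := hf.exists_nonneg
    refine ⟨2 * M * N, C * (1 + D ^ 2) ^ N, fun t => (hφ (f t)).trans ?_⟩
    rw [mul_assoc, pow_mul, ← mul_pow]
    gcongr
    have h1 : f t ^ 2 ≤ (D * (1 + t ^ 2) ^ M) ^ 2 := by
      simpa using pow_le_pow_left₀ (abs_nonneg _) (hf t) 2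
    have h2 : 1 ≤ (1 + t ^ 2) ^ (2 * M) := one_le_pow₀ (one_le_one_add_sq t)
    rw [mul_pow, ← pow_mul, mul_comm M 2] at h1
    nlinarith
  induction n with
  | zero => exact fun hφ hf => key hφ hf
  | succ n ih =>
    exact fun hφ hf => Temp.of_hasDerivAt
      (fun t => (hφ.hasDerivAt _).comp t (hf.hasDerivAt t)) (key hφ.1 hf.1)
      ((ih hφ.2.2 hf.pred).mul hf.2.2)

/-- `f` goes to infinity at least linearly. -/
def LinearlyProper (f : ℝ → ℝ) : Prop := ∃ C : ℝ, ∀ t, 1 + t ^ 2 ≤ C * (1 + f t ^ 2)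

/-- Linear properness trades powers of `1 + t²` for powers of `1 + f(t)²`, which the decay of `u`
controls. The derivative `u'(f) f'` is again a decaying factor times one of moderate growth. -/
lemma Dec.comp {n : ℕ} : ∀ {u f : ℝ → ℝ}, Dec n u → Temp n f → LinearlyProper f →
    Dec n (fun t => u (f t)) := by
  have key : ∀ {u f : ℝ → ℝ}, RapidlyDecaying u → LinearlyProper f →
      RapidlyDecaying (fun t => u (f t)) := by
    intro u f hu ⟨D, hf⟩ N
    obtain ⟨C, hu⟩ := hu N
    have hD : 0 ≤ D := by nlinarith [hf 0, sq_nonneg (f 0)]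
    refine ⟨C * D ^ N, fun t => ?_⟩
    calc |u (f t)| * (1 + t ^ 2) ^ N ≤ |u (f t)| * (D * (1 + f t ^ 2)) ^ N := by
          gcongr; exact hf t
      _ = |u (f t)| * (1 + f t ^ 2) ^ N * D ^ N := by rw [mul_pow]; ring
      _ ≤ _ := by gcongr; exact hu _
  induction n with
  | zero => exact fun hφ _ hf => key hφ hf
  | succ n ih =>
    exact fun hφ hf hf' => Dec.of_hasDerivAt
      (fun t => (hφ.hasDerivAt _).comp t (hf.hasDerivAt t)) (key hφ.1 hf')
      ((ih hφ.2.2 hf.pred hf').mul_temp hf.2.2)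

/-- Since `(1/v)' = -v'/v²`, a polynomial bound on `1/v` alone suffices; the bounds for its
derivatives follow by induction. -/
lemma Temp.inv {n : ℕ} : ∀ {v : ℝ → ℝ}, Temp n v → (∀ t, v t ≠ 0) →
    PolyBounded (fun t => (v t)⁻¹) → Temp n (fun t => (v t)⁻¹) := by
  induction n with
  | zero => exact fun _ _ h => h
  | succ n ih =>
    intro v hv h0 hb
    have h1 := ih hv.pred h0 hb
    refine Temp.of_hasDerivAt (u' := fun t => (-1) * deriv v t * ((v t)⁻¹ * (v t)⁻¹))
      (fun t => ?_) hb (((temp_const n (-1)).mul hv.2.2).mul (h1.mul h1))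
    refine ((hv.hasDerivAt t).fun_inv (h0 t)).congr_deriv ?_
    have := h0 t
    field_simp

lemma RapidlyDecaying.exists_bound {u : ℝ → ℝ} (hu : RapidlyDecaying u) :
    ∃ C, 0 ≤ C ∧ ∀ t, |u t| ≤ C := by
  obtain ⟨C, h⟩ := hu 0
  have h' : ∀ t, |u t| ≤ C := fun t => by simpa using h t
  exact ⟨C, (abs_nonneg _).trans (h' 0), h'⟩

lemma linearlyProper_of_bounded {f : ℝ → ℝ} {C : ℝ} (h : ∀ t, |f t - t| ≤ C) :
    LinearlyProper f := by
  refine ⟨2 + 2 * C ^ 2, fun t => ?_⟩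
  have h1 : (f t - t) ^ 2 ≤ C ^ 2 := by
    simpa using pow_le_pow_left₀ (abs_nonneg _) (h t) 2
  nlinarith [sq_nonneg (t - 2 * (f t)), sq_nonneg (f t), mul_nonneg (sq_nonneg C) (sq_nonneg (f t))]

lemma Temp.of_sub_id {n : ℕ} {f : ℝ → ℝ} (h : Dec n (fun t => f t - t)) : Temp n f := by
  simpa using h.temp.add (temp_id n)

lemma Dec.linearlyProper {n : ℕ} {f : ℝ → ℝ} (h : Dec n (fun t => f t - t)) :
    LinearlyProper f := by
  obtain ⟨C, -, hC⟩ := h.rapidlyDecaying.exists_bound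
  exact linearlyProper_of_bounded hC

/-- A function of moderate growth changes by a rapidly decaying amount under precomposition with a
rapidly decaying perturbation of the identity. -/
lemma Dec.comp_sub {n : ℕ} : ∀ {φ f : ℝ → ℝ}, Temp (n + 1) φ → Dec n (fun t => f t - t) →
    Dec n (fun t => φ (f t) - φ t) := by
  have key : ∀ {φ f : ℝ → ℝ}, Temp 1 φ → RapidlyDecaying (fun t => f t - t) →
      RapidlyDecaying (fun t => φ (f t) - φ t) := by
    intro φ f hφ hf
    obtain ⟨N, C, hC, hφ'⟩ := PolyBounded.exists_nonneg (hφ.2.2 : PolyBounded (deriv φ))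
    obtain ⟨D, hD, hfD⟩ := hf.exists_bound
    have hb : PolyBounded (fun t => C * (2 * (1 + t ^ 2) + 2 * D ^ 2) ^ N) := by
      refine ⟨N, C * (2 + 2 * D ^ 2) ^ N, fun t => ?_⟩
      rw [abs_of_nonneg (by positivity), mul_assoc, ← mul_pow]
      refine mul_le_mul_of_nonneg_left (pow_le_pow_left₀ (by positivity) ?_ N) hC
      nlinarith [sq_nonneg t, mul_nonneg (sq_nonneg D) (sq_nonneg t)]
    refine (hf.mul_polyBounded hb).of_le fun t => ?_
    rw [abs_mul, abs_of_nonneg (a := C * _) (by positivity), mul_comm]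
    -- Mean value inequality between `t` and `f t`: there `|x - t| ≤ D`, hence `1 + x² ≤ 2(1 + t²) +
    -- 2D²`, and `φ'` is bounded by a polynomial in `t`.
    have := Convex.norm_image_sub_le_of_norm_deriv_le (𝕜 := ℝ) (f := φ) (s := uIcc t (f t))
      (C := C * (2 * (1 + t ^ 2) + 2 * D ^ 2) ^ N) (x := t) (y := f t)
      (fun x _ => hφ.2.1 x) (fun x hx => ?_) (convex_uIcc _ _) left_mem_uIcc right_mem_uIcc
    · simpa [Real.norm_eq_abs] using this
    · refine (hφ' x).trans ?_
      refine mul_le_mul_of_nonneg_left (pow_le_pow_left₀ (by positivity) ?_ N) hC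
      have h1 : |x - t| ≤ D := (abs_sub_left_of_mem_uIcc hx).trans (hfD t)
      have h2 : (x - t) ^ 2 ≤ D ^ 2 := by simpa using pow_le_pow_left₀ (abs_nonneg _) h1 2
      nlinarith [sq_nonneg (x - 2 * t)]
  induction n with
  | zero => exact fun hφ hf => key hφ hf
  | succ n ih =>
    intro φ f hφ hf
    have hft : Temp (n + 1) f := .of_sub_id hf
    have hd : Dec n (fun t => deriv f t - 1) := by
      have : (fun t => deriv f t - 1) = deriv (fun t => f t - t) := by
        funext t
        exact (((hft.hasDerivAt t).fun_sub (hasDerivAt_id t)).deriv).symm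
      rw [this]; exact hf.2.2
    -- The derivative is split as `(φ'(f) - φ') + (f' - 1) φ'(f)`. The first term is the inductive
    -- case for `φ'`; in the second the decay comes from `f' - 1`. The mean value inequality spends
    -- one derivative of `φ`, hence the order `n + 1` in the hypothesis.
    refine Dec.of_hasDerivAt
      (u' := fun t => (deriv φ (f t) - deriv φ t) + (deriv f t - 1) * deriv φ (f t))
      (fun t => ?_) (key (by
        have : Temp (n + 1 + 1) φ := hφ
        clear * - this
        induction n with
        | zero => exact this.pred
        | succ n ih => exact ih this.pred) hf.1) ?_
    · refine (((hφ.hasDerivAt (f t)).comp t (hft.hasDerivAt t)).fun_sub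
        (hφ.hasDerivAt t)).congr_deriv ?_
      ring
    · exact (ih hφ.2.2 hf.pred).add (hd.mul_temp (hφ.2.2.pred.comp hft.pred))

end


open Set Filter Topology

noncomputable section

open scoped ContDiff

/-! ### Analytic diffeomorphisms of the line that are rapidly asymptotic to the identity -/

/-- An increasing analytic diffeomorphism `f` of the line such that all derivatives of `f - id`
decay rapidly. -/
structure IsTame (f : ℝ ≃o ℝ) : Prop where
  analytic : ContDiff ℝ ω f
  deriv_lower : ∃ c > 0, ∀ t, c ≤ deriv f t
  dec : ∀ n, Dec n (fun t => f t - t)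

lemma dec_zero (n : ℕ) : Dec n (fun _ => 0) := by
  induction n with
  | zero => exact fun N => ⟨0, fun t => by simp⟩
  | succ n ih =>
    exact Dec.of_hasDerivAt (fun t => hasDerivAt_const t (0 : ℝ)) (fun N => ⟨0, fun t => by simp⟩) ih

lemma IsTame.one : IsTame 1 where
  analytic := contDiff_id
  deriv_lower := ⟨1, one_pos, fun t => (deriv_id t).ge⟩
  dec n := by simpa using dec_zero n

lemma IsTame.hasDerivAt {f : ℝ ≃o ℝ} (hf : IsTame f) (t : ℝ) : HasDerivAt f (deriv f t) t :=
  ((hf.analytic.differentiable (by simp)) t).hasDerivAt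

lemma IsTame.temp {f : ℝ ≃o ℝ} (hf : IsTame f) (n : ℕ) : Temp n f := .of_sub_id (hf.dec n)

lemma IsTame.mul {f g : ℝ ≃o ℝ} (hf : IsTame f) (hg : IsTame g) : IsTame (f * g) where
  analytic := hf.analytic.comp hg.analytic
  deriv_lower := by
    obtain ⟨c, hc, hfc⟩ := hf.deriv_lower
    obtain ⟨d, hd, hgd⟩ := hg.deriv_lower
    refine ⟨c * d, by positivity, fun t => ?_⟩
    rw [show (⇑(f * g) : ℝ → ℝ) = f ∘ g from rfl,
      ((hf.hasDerivAt (g t)).comp t (hg.hasDerivAt t)).deriv]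
    exact mul_le_mul (hfc _) (hgd _) hd.le (hc.le.trans (hfc _))
  dec n := by
    have h := ((hf.dec n).comp (hg.temp n) (hg.dec n).linearlyProper).add (hg.dec n)
    simpa using h

/-- The derivative of `f⁻¹` is `1/f'` evaluated at `f⁻¹`. The lower bound for `f'` gives `1/f'`
moderate growth, and then induction does the same for `f⁻¹`. Decay follows from `f⁻¹ - id = -(f -
id) ∘ f⁻¹`, and boundedness of `f'` from above gives the lower bound for the derivative of the
inverse. -/
lemma IsTame.inv {f : ℝ ≃o ℝ} (hf : IsTame f) : IsTame f⁻¹ := by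
  obtain ⟨c, hc, hfc⟩ := hf.deriv_lower
  have hne : ∀ t, deriv f t ≠ 0 := fun t => (hc.trans_le (hfc t)).ne'
  have han : ContDiff ℝ ω f.symm :=
    f.toHomeomorph.contDiff_symm_deriv (f' := deriv f) hne hf.hasDerivAt hf.analytic
  have hder : ∀ t, HasDerivAt f.symm (deriv f (f.symm t))⁻¹ t := fun t =>
    HasDerivAt.of_local_left_inverse f.symm.continuous.continuousAt (hf.hasDerivAt _) (hne _)
      (Eventually.of_forall f.apply_symm_apply)
  obtain ⟨D, hD, hfD⟩ := (hf.dec 0).rapidlyDecaying.exists_bound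
  have hbd : ∀ t, |f.symm t - t| ≤ D := fun t => by
    have := hfD (f.symm t)
    rwa [f.apply_symm_apply, abs_sub_comm] at this
  have hpb : PolyBounded f.symm := by
    obtain ⟨N, C, h⟩ : PolyBounded (fun t => |t| + D) := by
      refine ⟨1, 1 + D, fun t => ?_⟩
      rw [abs_of_nonneg (by positivity), pow_one]
      have : |t| ≤ 1 + t ^ 2 := by rw [← sq_abs]; nlinarith [sq_nonneg (|t| - 1), abs_nonneg t]
      nlinarith [mul_nonneg hD (sq_nonneg t)]
    exact ⟨N, C, fun t => by
      refine le_trans ?_ (h t)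
      rw [abs_of_nonneg (a := |t| + D) (by positivity)]
      have := abs_add_le t (f.symm t - t)
      rw [add_sub_cancel] at this
      linarith [hbd t]⟩
  have hinv : ∀ n, Temp n (fun t => (deriv f t)⁻¹) := fun n =>
    ((hf.temp (n + 1)).2.2).inv hne ⟨0, c⁻¹, fun t => by
      rw [abs_of_nonneg (inv_nonneg.2 (hc.le.trans (hfc t)))]
      simpa using inv_anti₀ hc (hfc t)⟩
  have htemp : ∀ n, Temp n f.symm := by
    intro n
    induction n with
    | zero => exact hpb
    | succ n ih => exact Temp.of_hasDerivAt hder hpb ((hinv n).comp ih)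
  obtain ⟨C, hC⟩ : ∃ C, ∀ t, deriv f t ≤ C := by
    obtain ⟨C, -, h⟩ := (hf.dec 1).2.2.rapidlyDecaying.exists_bound
    refine ⟨1 + C, fun t => ?_⟩
    have h1 := h t
    rw [((hf.hasDerivAt t).fun_sub (hasDerivAt_id' t)).deriv] at h1
    linarith [le_abs_self (deriv f t - 1)]
  refine ⟨han, ⟨C⁻¹, inv_pos.2 (hc.trans_le ((hfc 0).trans (hC 0))), fun t => ?_⟩, fun n => ?_⟩
  · rw [show (⇑f⁻¹ : ℝ → ℝ) = f.symm from rfl, (hder t).deriv]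
    exact inv_anti₀ (hc.trans_le (hfc _)) (hC _)
  · have h := ((hf.dec n).comp (htemp n) (linearlyProper_of_bounded hbd)).neg
    simpa [show (⇑f⁻¹ : ℝ → ℝ) = f.symm from rfl] using h

/-- The group of tame diffeomorphisms of the line. -/
def tameGroup : Subgroup (ℝ ≃o ℝ) where
  carrier := {f | IsTame f}
  mul_mem' := IsTame.mul
  one_mem' := IsTame.one
  inv_mem' := IsTame.inv

/-- The fixed points of a nontrivial tame diffeomorphism are isolated. -/
lemma IsTame.eventually_ne {f : ℝ ≃o ℝ} (hf : IsTame f) (h1 : f ≠ 1) (t : ℝ) :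
    ∀ᶠ x in 𝓝[≠] t, f x ≠ x := by
  have han : AnalyticOnNhd ℝ (fun x => f x - x) univ := fun x _ =>
    (hf.analytic.contDiffAt.analyticAt).sub analyticAt_id
  rcases (han t (mem_univ t)).eventually_eq_zero_or_eventually_ne_zero with h | h
  · refine absurd ?_ h1
    have := han.eqOn_zero_of_preconnected_of_eventuallyEq_zero isPreconnected_univ (mem_univ t) h
    ext x
    simpa [sub_eq_zero] using this (mem_univ x)
  · exact h.mono fun x hx => sub_ne_zero.1 hx

end


open Set Filter Topology

noncomputable section

open scoped ContDiff

/-! ### Slow charts of the open interval -/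

/-- An increasing smooth chart `ℝ → (0, 1)` of moderate growth whose derivative decays no faster
than `1 / (1 + t²)`. -/
structure IsSlowChart (H : ℝ → ℝ) : Prop where
  temp : ∀ n, Temp n H
  deriv_lower : ∃ c > 0, ∀ t, c ≤ deriv H t * (1 + t ^ 2)
  tendsto_atBot : Tendsto H atBot (𝓝 0)
  tendsto_atTop : Tendsto H atTop (𝓝 1)

/-- `u` and its derivatives up to order `n` are bounded. -/
def BddDerivs : ℕ → (ℝ → ℝ) → Prop
  | 0, u => ∃ C, ∀ t, |u t| ≤ C
  | n + 1, u => (∃ C, ∀ t, |u t| ≤ C) ∧ Differentiable ℝ u ∧ BddDerivs n (deriv u)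

lemma BddDerivs.bdd {n : ℕ} {u : ℝ → ℝ} (h : BddDerivs n u) : ∃ C, ∀ t, |u t| ≤ C := by
  cases n with
  | zero => exact h
  | succ n => exact h.1

lemma BddDerivs.pred {n : ℕ} : ∀ {u : ℝ → ℝ}, BddDerivs (n + 1) u → BddDerivs n u := by
  induction n with
  | zero => exact fun h => h.1
  | succ n ih => exact fun h => ⟨h.1, h.2.1, ih h.2.2⟩

lemma BddDerivs.of_hasDerivAt {n : ℕ} {u u' : ℝ → ℝ} (h : ∀ t, HasDerivAt u (u' t) t)
    (h0 : ∃ C, ∀ t, |u t| ≤ C) (h1 : BddDerivs n u') : BddDerivs (n + 1) u := by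
  have : deriv u = u' := funext fun t => (h t).deriv
  exact ⟨h0, fun t => (h t).differentiableAt, this ▸ h1⟩

lemma BddDerivs.add {n : ℕ} :
    ∀ {u v : ℝ → ℝ}, BddDerivs n u → BddDerivs n v → BddDerivs n (fun t => u t + v t) := by
  have key : ∀ {u v : ℝ → ℝ}, (∃ C, ∀ t, |u t| ≤ C) → (∃ C, ∀ t, |v t| ≤ C) →
      ∃ C, ∀ t, |u t + v t| ≤ C := by
    rintro u v ⟨C, hC⟩ ⟨D, hD⟩
    exact ⟨C + D, fun t => (abs_add_le _ _).trans (add_le_add (hC t) (hD t))⟩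
  induction n with
  | zero => exact fun hu hv => key hu hv
  | succ n ih =>
    exact fun hu hv => .of_hasDerivAt
      (fun t => (hu.2.1 t).hasDerivAt.add (hv.2.1 t).hasDerivAt) (key hu.1 hv.1)
      (ih hu.2.2 hv.2.2)

lemma BddDerivs.mul {n : ℕ} :
    ∀ {u v : ℝ → ℝ}, BddDerivs n u → BddDerivs n v → BddDerivs n (fun t => u t * v t) := by
  have key : ∀ {u v : ℝ → ℝ}, (∃ C, ∀ t, |u t| ≤ C) → (∃ C, ∀ t, |v t| ≤ C) →
      ∃ C, ∀ t, |u t * v t| ≤ C := by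
    rintro u v ⟨C, hC⟩ ⟨D, hD⟩
    refine ⟨C * D, fun t => ?_⟩
    rw [abs_mul]
    exact mul_le_mul (hC t) (hD t) (abs_nonneg _) ((abs_nonneg _).trans (hC t))
  induction n with
  | zero => exact fun hu hv => key hu hv
  | succ n ih =>
    exact fun hu hv => .of_hasDerivAt
      (fun t => (hu.2.1 t).hasDerivAt.mul (hv.2.1 t).hasDerivAt) (key hu.1 hv.1)
      ((ih hu.2.2 hv.pred).add (ih hu.pred hv.2.2))

lemma bddDerivs_const (n : ℕ) : ∀ c : ℝ, BddDerivs n (fun _ => c) := by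
  induction n with
  | zero => exact fun c => ⟨|c|, fun _ => le_rfl⟩
  | succ n ih => exact fun c => .of_hasDerivAt (fun t => hasDerivAt_const t c) ⟨|c|, fun _ => le_rfl⟩ (ih 0)

lemma hasDerivAt_inv_one_add_sq (t : ℝ) :
    HasDerivAt (fun t : ℝ => (1 + t ^ 2)⁻¹) (-2 * (t * (1 + t ^ 2)⁻¹ * (1 + t ^ 2)⁻¹)) t := by
  have h : (1 + t ^ 2) ≠ 0 := by positivity
  refine (((hasDerivAt_pow 2 t).const_add 1).fun_inv h).congr_deriv ?_
  field_simp
  norm_num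
  ring

/-- The derivative of each of the two functions is a polynomial in both of them, so the induction
has to carry them together. -/
lemma bddDerivs_inv_one_add_sq (n : ℕ) :
    BddDerivs n (fun t => (1 + t ^ 2)⁻¹) ∧ BddDerivs n (fun t => t * (1 + t ^ 2)⁻¹) := by
  have h1 : ∀ t : ℝ, |(1 + t ^ 2)⁻¹| ≤ 1 := fun t => by
    rw [abs_of_nonneg (by positivity)]
    exact inv_le_one_of_one_le₀ (one_le_one_add_sq t)
  have h2 : ∀ t : ℝ, |t * (1 + t ^ 2)⁻¹| ≤ 1 := fun t => by
    rw [abs_mul, abs_of_nonneg (a := (1 + t ^ 2)⁻¹) (by positivity), ← div_eq_mul_inv,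
      div_le_one (by positivity), ← sq_abs]
    nlinarith [sq_nonneg (|t| - 1), abs_nonneg t]
  induction n with
  | zero => exact ⟨⟨1, h1⟩, ⟨1, h2⟩⟩
  | succ n ih =>
    constructor
    · exact .of_hasDerivAt hasDerivAt_inv_one_add_sq ⟨1, h1⟩
        ((bddDerivs_const n (-2)).mul (ih.2.mul ih.1))
    · refine .of_hasDerivAt (u' := fun t => (1 + t ^ 2)⁻¹ +
        (-2) * ((t * (1 + t ^ 2)⁻¹) * (t * (1 + t ^ 2)⁻¹))) (fun t => ?_) ⟨1, h2⟩
        (ih.1.add ((bddDerivs_const n (-2)).mul (ih.2.mul ih.2)))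
      refine ((hasDerivAt_id' t).mul (hasDerivAt_inv_one_add_sq t)).congr_deriv ?_
      ring

/-- A smooth increasing sigmoid function. -/
def sigmoidArctan (t : ℝ) : ℝ := 1 / 2 + Real.pi⁻¹ * Real.arctan t

lemma hasDerivAt_sigmoidArctan (t : ℝ) :
    HasDerivAt sigmoidArctan (Real.pi⁻¹ * (1 + t ^ 2)⁻¹) t := by
  exact (((Real.hasDerivAt_arctan t).const_mul Real.pi⁻¹).const_add (1 / 2)).congr_deriv
    (by simp [one_div])

lemma sigmoidArctan_pos (t : ℝ) : 0 < sigmoidArctan t := by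
  have := Real.neg_pi_div_two_lt_arctan t
  have hp := Real.pi_pos
  have : Real.pi⁻¹ * (-(Real.pi / 2)) < Real.pi⁻¹ * Real.arctan t := by gcongr
  rw [show Real.pi⁻¹ * (-(Real.pi / 2)) = -(1 / 2) by field_simp] at this
  unfold sigmoidArctan; linarith

lemma sigmoidArctan_neg (t : ℝ) : sigmoidArctan (-t) = 1 - sigmoidArctan t := by
  simp only [sigmoidArctan, Real.arctan_neg]; ring

lemma sigmoidArctan_lt_one (t : ℝ) : sigmoidArctan t < 1 := by
  have := sigmoidArctan_pos (-t)
  rw [sigmoidArctan_neg] at this; linarith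

lemma tendsto_sigmoidArctan_atTop : Tendsto sigmoidArctan atTop (𝓝 1) := by
  have h := ((tendsto_nhds_of_tendsto_nhdsWithin Real.tendsto_arctan_atTop).const_mul
    Real.pi⁻¹).const_add (1 / 2)
  rwa [show (1 / 2 : ℝ) + Real.pi⁻¹ * (Real.pi / 2) = 1 by
    have := Real.pi_pos; field_simp; norm_num] at h

lemma bddDerivs_sigmoidArctan (n : ℕ) : BddDerivs n sigmoidArctan := by
  have h0 : ∃ C, ∀ t, |sigmoidArctan t| ≤ C := ⟨1, fun t => by
    rw [abs_of_pos (sigmoidArctan_pos t)]; exact (sigmoidArctan_lt_one t).le⟩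
  cases n with
  | zero => exact h0
  | succ n =>
    exact .of_hasDerivAt hasDerivAt_sigmoidArctan h0 ((bddDerivs_const n _).mul (bddDerivs_inv_one_add_sq n).1)

/-- A weighted average of translates of `φ` by `± τ k`. -/
def spreadOut (τ : ℕ → ℝ) (φ : ℝ → ℝ) (t : ℝ) : ℝ :=
  ∑' k : ℕ, (1 / 2 : ℝ) ^ (k + 2) * (φ (t + τ k) + φ (t - τ k))

lemma summable_half_pow : Summable fun k : ℕ => (1 / 2 : ℝ) ^ (k + 2) :=
  (summable_nat_add_iff 2).2 (summable_geometric_of_lt_one (by norm_num) (by norm_num))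

/-- Each weight serves two translates, so the weights in `spreadOut` have total mass 1. -/
lemma tsum_half_pow : ∑' k : ℕ, (1 / 2 : ℝ) ^ (k + 2) = 1 / 2 := by
  simp_rw [pow_add]
  rw [tsum_mul_right, tsum_geometric_of_lt_one (by norm_num) (by norm_num)]
  norm_num

lemma spreadOut_term_bound {τ : ℕ → ℝ} {φ : ℝ → ℝ} {C : ℝ} (h : ∀ t, |φ t| ≤ C) (k : ℕ) (t : ℝ) :
    ‖(1 / 2 : ℝ) ^ (k + 2) * (φ (t + τ k) + φ (t - τ k))‖ ≤ (1 / 2 : ℝ) ^ (k + 2) * (2 * C) := by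
  rw [norm_mul, Real.norm_of_nonneg (by positivity), Real.norm_eq_abs]
  gcongr
  linarith [abs_add_le (φ (t + τ k)) (φ (t - τ k)), h (t + τ k), h (t - τ k)]

lemma summable_spreadOut {τ : ℕ → ℝ} {φ : ℝ → ℝ} (h : ∃ C, ∀ t, |φ t| ≤ C) (t : ℝ) :
    Summable fun k : ℕ => (1 / 2 : ℝ) ^ (k + 2) * (φ (t + τ k) + φ (t - τ k)) := by
  obtain ⟨C, h⟩ := h
  exact .of_norm_bounded (summable_half_pow.mul_right (2 * C)) fun k => spreadOut_term_bound h k t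

lemma spreadOut_bdd {τ : ℕ → ℝ} {φ : ℝ → ℝ} (h : ∃ C, ∀ t, |φ t| ≤ C) :
    ∃ C, ∀ t, |spreadOut τ φ t| ≤ C := by
  obtain ⟨C, h⟩ := h
  exact ⟨∑' k : ℕ, (1 / 2 : ℝ) ^ (k + 2) * (2 * C), fun t => tsum_of_norm_bounded
    (summable_half_pow.mul_right (2 * C)).hasSum fun k => spreadOut_term_bound h k t⟩

/-- Uniform bounds are invariant under translation. This is why bounded derivatives, rather than
moderate growth, are required for differentiating the series of translates term by term: nothing is
known about the size of `τ`. -/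
lemma hasDerivAt_spreadOut {τ : ℕ → ℝ} {φ : ℝ → ℝ} (h : BddDerivs 1 φ) (t : ℝ) :
    HasDerivAt (spreadOut τ φ) (spreadOut τ (deriv φ) t) t := by
  obtain ⟨C, hC⟩ := h.2.2.bdd
  refine hasDerivAt_tsum
    (g := fun k t => (1 / 2 : ℝ) ^ (k + 2) * (φ (t + τ k) + φ (t - τ k)))
    (g' := fun k t => (1 / 2 : ℝ) ^ (k + 2) * (deriv φ (t + τ k) + deriv φ (t - τ k)))
    (summable_half_pow.mul_right (2 * C)) (fun k y => ?_)
    (fun k y => spreadOut_term_bound hC k y) (summable_spreadOut h.1 t) t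
  exact (((h.2.1 _).hasDerivAt.comp_add_const y (τ k)).add
    ((h.2.1 _).hasDerivAt.comp_sub_const y (τ k))).const_mul _

lemma BddDerivs.spreadOut {τ : ℕ → ℝ} {n : ℕ} :
    ∀ {φ : ℝ → ℝ}, BddDerivs n φ → BddDerivs n (spreadOut τ φ) := by
  induction n with
  | zero => exact fun h => spreadOut_bdd h
  | succ n ih =>
    intro φ h
    refine .of_hasDerivAt (hasDerivAt_spreadOut ⟨h.1, h.2.1, h.2.2.bdd⟩) (spreadOut_bdd h.1)
      (ih h.2.2)

lemma BddDerivs.temp {n : ℕ} : ∀ {u : ℝ → ℝ}, BddDerivs n u → Temp n u := by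
  have key : ∀ {u : ℝ → ℝ}, (∃ C, ∀ t, |u t| ≤ C) → PolyBounded u :=
    fun ⟨C, h⟩ => ⟨0, C, fun t => by simpa using h t⟩
  induction n with
  | zero => exact fun h => key h
  | succ n ih => exact fun h => ⟨key h.1, h.2.1, ih h.2.2⟩

/-- Because `τ 0 = 0`, the term with `k = 0` is half of the untranslated sigmoid. The other terms
have nonnegative derivative, so this half alone bounds the derivative below by a multiple of
`1/(1+t²)`. -/
lemma isSlowChart_spreadOut {τ : ℕ → ℝ} (h0 : τ 0 = 0) :
    IsSlowChart (spreadOut τ sigmoidArctan) := by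
  have hb : ∀ n, BddDerivs n sigmoidArctan := bddDerivs_sigmoidArctan
  have hbd : ∀ t, |sigmoidArctan t| ≤ 1 := fun t => by
    rw [abs_of_pos (sigmoidArctan_pos t)]; exact (sigmoidArctan_lt_one t).le
  have hdS : deriv sigmoidArctan = fun t => Real.pi⁻¹ * (1 + t ^ 2)⁻¹ :=
    funext fun t => (hasDerivAt_sigmoidArctan t).deriv
  have hp := Real.pi_pos
  refine ⟨fun n => (hb n).spreadOut.temp, ⟨1 / 2 * Real.pi⁻¹, by positivity, fun t => ?_⟩, ?_, ?_⟩
  · rw [(hasDerivAt_spreadOut (hb 1) t).deriv]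
    have hs := summable_spreadOut (τ := τ) (hb 1).2.2.bdd t
    have h1 : 1 / 2 * (Real.pi⁻¹ * (1 + t ^ 2)⁻¹) ≤ spreadOut τ (deriv sigmoidArctan) t := by
      refine le_trans (le_of_eq ?_) (hs.le_tsum 0 fun k _ => by rw [hdS]; positivity)
      simp only [h0, hdS, add_zero, sub_zero]
      ring
    calc 1 / 2 * Real.pi⁻¹ = 1 / 2 * (Real.pi⁻¹ * (1 + t ^ 2)⁻¹) * (1 + t ^ 2) := by
          field_simp
      _ ≤ _ := by gcongr
  · have h2 : Tendsto sigmoidArctan atBot (𝓝 0) := by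
      have := (tendsto_sigmoidArctan_atTop.comp tendsto_neg_atBot_atTop).const_sub 1
      simpa [Function.comp_def, sigmoidArctan_neg] using this
    have := tendsto_tsum_of_dominated_convergence (𝓕 := atBot)
      (f := fun t (k : ℕ) => (1 / 2 : ℝ) ^ (k + 2) * (sigmoidArctan (t + τ k) + sigmoidArctan (t - τ k)))
      (g := fun k => (1 / 2 : ℝ) ^ (k + 2) * (0 + 0)) (summable_half_pow.mul_right (2 * 1))
      (fun k => ((h2.comp (tendsto_atBot_add_const_right _ (τ k) tendsto_id)).add
        (h2.comp (tendsto_atBot_add_const_right _ (-τ k) tendsto_id))).const_mul _)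
      (Eventually.of_forall fun t k => spreadOut_term_bound hbd k t)
    simp only [add_zero, mul_zero, tsum_zero] at this
    exact this
  · have h2 := tendsto_sigmoidArctan_atTop
    have := tendsto_tsum_of_dominated_convergence (𝓕 := atTop)
      (f := fun t (k : ℕ) => (1 / 2 : ℝ) ^ (k + 2) * (sigmoidArctan (t + τ k) + sigmoidArctan (t - τ k)))
      (g := fun k => (1 / 2 : ℝ) ^ (k + 2) * (1 + 1)) (summable_half_pow.mul_right (2 * 1))
      (fun k => ((h2.comp (tendsto_atTop_add_const_right _ (τ k) tendsto_id)).add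
        (h2.comp (tendsto_atTop_add_const_right _ (-τ k) tendsto_id))).const_mul _)
      (Eventually.of_forall fun t k => spreadOut_term_bound hbd k t)
    rw [tsum_mul_right, tsum_half_pow] at this
    norm_num at this
    exact this

/-- This symmetry reduces estimates near the endpoint 1 to those near 0. -/
lemma spreadOut_sigmoidArctan_neg (τ : ℕ → ℝ) (t : ℝ) :
    spreadOut τ sigmoidArctan (-t) = 1 - spreadOut τ sigmoidArctan t := by
  have hb := (bddDerivs_sigmoidArctan 0).bdd
  rw [eq_sub_iff_add_eq, spreadOut, spreadOut,
    ← (summable_spreadOut hb _).tsum_add (summable_spreadOut hb _)]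
  have : ∀ k : ℕ, (1 / 2 : ℝ) ^ (k + 2) * (sigmoidArctan (-t + τ k) + sigmoidArctan (-t - τ k)) +
      (1 / 2 : ℝ) ^ (k + 2) * (sigmoidArctan (t + τ k) + sigmoidArctan (t - τ k))
      = (1 / 2 : ℝ) ^ (k + 2) * 2 := fun k => by
    rw [show -t + τ k = -(t - τ k) by ring, show -t - τ k = -(t + τ k) by ring, sigmoidArctan_neg,
      sigmoidArctan_neg]
    ring
  simp_rw [this, tsum_mul_right, tsum_half_pow]
  norm_num

/-- There are slow charts which approach the endpoints as slowly as we like. -/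
theorem exists_isSlowChart {η : ℝ → ℝ} (hη : ContinuousOn η (Ioo 0 1))
    (hpos : ∀ x ∈ Ioo (0 : ℝ) 1, 0 < η x) :
    ∃ H, IsSlowChart H ∧ (∀ᶠ t in atBot, (1 + t ^ 2)⁻¹ ≤ η (H t)) ∧
      ∀ᶠ t in atTop, (1 + t ^ 2)⁻¹ ≤ η (H t) := by
  have hδ : ∀ n : ℕ, ∃ δ > 0, ∀ x ∈ Icc ((1 / 2 : ℝ) ^ (n + 3)) (1 - (1 / 2 : ℝ) ^ (n + 3)),
      δ ≤ η x := by
    intro n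
    have hsub : Icc ((1 / 2 : ℝ) ^ (n + 3)) (1 - (1 / 2 : ℝ) ^ (n + 3)) ⊆ Ioo 0 1 := fun x hx => by
      have : (0 : ℝ) < (1 / 2 : ℝ) ^ (n + 3) := by positivity
      exact ⟨this.trans_le hx.1, by linarith [hx.2]⟩
    have hne : (Icc ((1 / 2 : ℝ) ^ (n + 3)) (1 - (1 / 2 : ℝ) ^ (n + 3))).Nonempty := by
      refine ⟨1 / 2, ?_⟩
      have : (1 / 2 : ℝ) ^ (n + 3) ≤ (1 / 2) ^ 1 :=
        pow_le_pow_of_le_one (by norm_num) (by norm_num) (by omega)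
      constructor <;> norm_num at this ⊢ <;> linarith
    obtain ⟨x, hx, hmin⟩ := isCompact_Icc.exists_isMinOn hne (hη.mono hsub)
    exact ⟨η x, hpos x (hsub hx), fun y hy => hmin hy⟩
  choose δ hδ0 hδ using hδ
  -- The entry `n` makes the translations unbounded. The entry `1/δ(n+1)` ensures that `1/(1+T²)` is
  -- below `δ(n+1)` as soon as `T > τ n` and `T > 1`. The value at 0 is the one required by
  -- `isSlowChart_spreadOut`.
  let τ : ℕ → ℝ := fun n => if n = 0 then 0 else max n (δ (n + 1))⁻¹
  have hchart : IsSlowChart (spreadOut τ sigmoidArctan) := isSlowChart_spreadOut (by simp [τ])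
  have hb := (bddDerivs_sigmoidArctan 0).bdd
  have key : ∀ T : ℝ, max (τ 1) 1 < T → (1 + T ^ 2)⁻¹ ≤ η (spreadOut τ sigmoidArctan (-T)) ∧
      (1 + T ^ 2)⁻¹ ≤ η (spreadOut τ sigmoidArctan T) := by
    intro T hT
    have hT1 : 1 < T := (le_max_right _ _).trans_lt hT
    have hex : ∃ n, T ≤ τ n := by
      obtain ⟨n, hn⟩ := exists_nat_ge T
      refine ⟨n, ?_⟩
      have : n ≠ 0 := by rintro rfl; norm_num at hn; linarith
      simp only [τ, this, if_false]
      exact hn.trans (le_max_left _ _)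
    -- The first index with `T ≤ τ n` is at least 2, since `T` exceeds `τ 0` and `τ 1`. The
    -- preceding index `m + 1` is then nonzero, so the exceptional value `τ 0` does not interfere.
    obtain ⟨m, hm⟩ : ∃ m, Nat.find hex = m + 2 := by
      have h0 : Nat.find hex ≠ 0 := fun h => by
        have := Nat.find_spec hex; rw [h] at this; simp [τ] at this; linarith
      have h1 : Nat.find hex ≠ 1 := fun h => by
        have := Nat.find_spec hex; rw [h] at this
        linarith [(le_max_left (τ 1) 1).trans_lt hT]
      exact ⟨Nat.find hex - 2, by omega⟩
    have hle : T ≤ τ (m + 2) := hm ▸ Nat.find_spec hex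
    have hlt : τ (m + 1) < T := not_le.1 (Nat.find_min hex (by omega))
    -- As `T ≤ τ (m+2)`, the translate by `τ (m+2)` is still at least `1/2` at `-T`. Its weight
    -- `2^{-(m+4)}` keeps `H(-T)` above `2^{-(m+5)}`, that is, in the interval on which `δ (m+2)` is
    -- a lower bound for `η`.
    have hlow : (1 / 2 : ℝ) ^ (m + 2 + 3) ≤ spreadOut τ sigmoidArctan (-T) := by
      have := (summable_spreadOut (τ := τ) hb (-T)).le_tsum (m + 2) fun k _ => by
        have := sigmoidArctan_pos (-T + τ k); have := sigmoidArctan_pos (-T - τ k); positivity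
      refine le_trans ?_ this
      have h1 : 1 / 2 ≤ sigmoidArctan (-T + τ (m + 2)) := by
        have : 0 ≤ Real.arctan (-T + τ (m + 2)) := Real.arctan_nonneg.2 (by linarith)
        have hp := Real.pi_pos
        unfold sigmoidArctan
        have : 0 ≤ Real.pi⁻¹ * Real.arctan (-T + τ (m + 2)) := by positivity
        linarith
      have h2 := sigmoidArctan_pos (-T - τ (m + 2))
      rw [show (1 / 2 : ℝ) ^ (m + 2 + 3) = (1 / 2) ^ (m + 2 + 2) * (1 / 2) by ring]
      gcongr
      linarith
    have hmono : StrictMono (spreadOut τ sigmoidArctan) := by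
      obtain ⟨c, hc, hcl⟩ := hchart.deriv_lower
      refine strictMono_of_deriv_pos fun t => ?_
      have := hc.trans_le (hcl t)
      exact pos_of_mul_pos_left this (by positivity)
    have hhi : spreadOut τ sigmoidArctan (-T) ≤ 1 / 2 := by
      have h1 := spreadOut_sigmoidArctan_neg τ 0
      rw [neg_zero] at h1
      have := hmono.monotone (show -T ≤ 0 by linarith)
      linarith
    have h8 : (1 / 2 : ℝ) ^ (m + 2 + 3) ≤ 1 / 2 := by
      have := pow_le_pow_of_le_one (a := (1 / 2 : ℝ)) (by norm_num) (by norm_num)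
        (show 1 ≤ m + 2 + 3 by omega)
      simpa using this
    have hδT : (1 + T ^ 2)⁻¹ ≤ δ (m + 2) := by
      rw [inv_le_comm₀ (by positivity) (hδ0 _)]
      have : (δ (m + 1 + 1))⁻¹ ≤ τ (m + 1) := by simp [τ]
      nlinarith [this]
    refine ⟨hδT.trans (hδ _ _ ⟨hlow, by linarith⟩), hδT.trans (hδ _ _ ⟨?_, ?_⟩)⟩
    · have := spreadOut_sigmoidArctan_neg τ T
      linarith
    · have := spreadOut_sigmoidArctan_neg τ T
      linarith
  refine ⟨_, hchart, ?_, ?_⟩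
  · filter_upwards [eventually_lt_atBot (-(max (τ 1) 1))] with t ht
    simpa using (key (-t) (by linarith)).1
  · filter_upwards [eventually_gt_atTop (max (τ 1) 1)] with t ht
    exact (key t ht).2

end


open Set Filter Topology

noncomputable section

open scoped ContDiff

/-! ### Transport of rapidly decaying functions to the interval -/

namespace IsSlowChart

variable {H : ℝ → ℝ}

lemma hasDerivAt (hH : IsSlowChart H) (t : ℝ) : HasDerivAt H (deriv H t) t := (hH.temp 1).hasDerivAt t

lemma deriv_pos (hH : IsSlowChart H) (t : ℝ) : 0 < deriv H t := by
  obtain ⟨c, hc, h⟩ := hH.deriv_lower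
  exact pos_of_mul_pos_left (hc.trans_le (h t)) (by positivity)

lemma strictMono (hH : IsSlowChart H) : StrictMono H := strictMono_of_deriv_pos hH.deriv_pos

lemma continuous (hH : IsSlowChart H) : Continuous H := (hH.temp 1).2.1.continuous

lemma mem_Ioo (hH : IsSlowChart H) (t : ℝ) : H t ∈ Ioo (0 : ℝ) 1 := by
  have h0 : ∀ t, 0 ≤ H t := fun t => hH.strictMono.monotone.le_of_tendsto hH.tendsto_atBot t
  have h1 : ∀ t, H t ≤ 1 := fun t => hH.strictMono.monotone.ge_of_tendsto hH.tendsto_atTop t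
  exact ⟨(h0 (t - 1)).trans_lt (hH.strictMono (by linarith)),
    (hH.strictMono (show t < t + 1 by linarith)).trans_le (h1 _)⟩

lemma exists_eq (hH : IsSlowChart H) {x : ℝ} (hx : x ∈ Ioo (0 : ℝ) 1) : ∃ t, H t = x := by
  obtain ⟨a, ha⟩ := (hH.tendsto_atBot.eventually_lt_const hx.1).exists
  obtain ⟨b, hb⟩ := (hH.tendsto_atTop.eventually_const_lt hx.2).exists
  exact mem_range_of_exists_le_of_exists_ge hH.continuous ⟨a, ha.le⟩ ⟨b, hb.le⟩

lemma invFun_apply (hH : IsSlowChart H) (t : ℝ) : Function.invFun H (H t) = t :=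
  Function.leftInverse_invFun hH.strictMono.injective t

lemma apply_invFun (hH : IsSlowChart H) {x : ℝ} (hx : x ∈ Ioo (0 : ℝ) 1) : H (Function.invFun H x) = x :=
  Function.invFun_eq (hH.exists_eq hx)

lemma invFun_lt_iff (hH : IsSlowChart H) {x t : ℝ} (hx : x ∈ Ioo (0 : ℝ) 1) : Function.invFun H x < t ↔ x < H t := by
  rw [← hH.strictMono.lt_iff_lt, hH.apply_invFun hx]

lemma lt_invFun_iff (hH : IsSlowChart H) {x t : ℝ} (hx : x ∈ Ioo (0 : ℝ) 1) : t < Function.invFun H x ↔ H t < x := by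
  rw [← hH.strictMono.lt_iff_lt, hH.apply_invFun hx]

lemma continuousAt_invFun (hH : IsSlowChart H) {x : ℝ} (hx : x ∈ Ioo (0 : ℝ) 1) :
    ContinuousAt (Function.invFun H) x := by
  have hI := isOpen_Ioo.mem_nhds hx
  rw [ContinuousAt, tendsto_order]
  constructor
  · intro a ha
    filter_upwards [hI, lt_mem_nhds ((hH.lt_invFun_iff hx).1 ha)] with y hy h
    exact (hH.lt_invFun_iff hy).2 h
  · intro a ha
    filter_upwards [hI, gt_mem_nhds ((hH.invFun_lt_iff hx).1 ha)] with y hy h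
    exact (hH.invFun_lt_iff hy).2 h

lemma hasDerivAt_invFun (hH : IsSlowChart H) {x : ℝ} (hx : x ∈ Ioo (0 : ℝ) 1) :
    HasDerivAt (Function.invFun H) (deriv H (Function.invFun H x))⁻¹ x := by
  refine HasDerivAt.of_local_left_inverse (hH.continuousAt_invFun hx) (hH.hasDerivAt _)
    (hH.deriv_pos _).ne' ?_
  filter_upwards [isOpen_Ioo.mem_nhds hx] with y hy using hH.apply_invFun hy

/-- In the coordinate `x = H t` differentiation is `(1/H') d/dt`. Moderate growth of `1/H'` is what
keeps the rapidly decaying functions stable under it. -/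
lemma temp_inv_deriv (hH : IsSlowChart H) (n : ℕ) : Temp n (fun t => (deriv H t)⁻¹) := by
  refine (hH.temp (n + 1)).2.2.inv (fun t => (hH.deriv_pos t).ne') ?_
  obtain ⟨c, hc, h⟩ := hH.deriv_lower
  refine ⟨1, c⁻¹, fun t => ?_⟩
  have := hH.deriv_pos t
  rw [abs_of_pos (inv_pos.2 this), pow_one, inv_le_iff_one_le_mul₀ this, mul_assoc,
    ← div_eq_inv_mul, one_le_div hc, mul_comm]
  exact h t

/-- Over a unit step next to `t` the chart moves by at least `c/(1+ξ²)`, with `1+ξ² ≤ 3(1+t²)`, and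
it still has not reached the endpoint. This converts decay in `t` into order of vanishing at the
endpoints. -/
lemma exists_dist_bound (hH : IsSlowChart H) : ∃ c > 0, ∀ t, c ≤ H t * (1 + t ^ 2) ∧ c ≤ (1 - H t) * (1 + t ^ 2) := by
  obtain ⟨c, hc, h⟩ := hH.deriv_lower
  have key : ∀ s, c / 3 ≤ (H s - H (s - 1)) * (1 + s ^ 2) ∧
      c / 3 ≤ (H s - H (s - 1)) * (1 + (s - 1) ^ 2) := by
    intro s
    obtain ⟨ξ, hξ, hd⟩ := exists_deriv_eq_slope H (show s - 1 < s by linarith)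
      hH.continuous.continuousOn (hH.temp 1).2.1.differentiableOn
    have h1 := h ξ
    have hp := hH.deriv_pos ξ
    rw [sub_sub_cancel, div_one] at hd
    rw [← hd]
    constructor
    · have : 1 + ξ ^ 2 ≤ 3 * (1 + s ^ 2) := by nlinarith [hξ.1, hξ.2, sq_nonneg (ξ - 2 * s)]
      nlinarith
    · have : 1 + ξ ^ 2 ≤ 3 * (1 + (s - 1) ^ 2) := by
        nlinarith [hξ.1, hξ.2, sq_nonneg (ξ - 2 * (s - 1))]
      nlinarith
  refine ⟨c / 3, by positivity, fun t => ⟨?_, ?_⟩⟩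
  · nlinarith [(key t).1, (hH.mem_Ioo (t - 1)).1, sq_nonneg t]
  · have := (key (t + 1)).2
    rw [add_sub_cancel_right] at this
    nlinarith [(hH.mem_Ioo (t + 1)).2, sq_nonneg t]

end IsSlowChart

/-- The function on the interval given by `u` in the chart `H`, extended by zero. -/
def chartExt (H u : ℝ → ℝ) (x : ℝ) : ℝ := if x ∈ Ioo (0 : ℝ) 1 then u (Function.invFun H x) else 0

namespace IsSlowChart

variable {H : ℝ → ℝ}

lemma chartExt_apply (hH : IsSlowChart H) (u : ℝ → ℝ) (t : ℝ) : chartExt H u (H t) = u t := by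
  rw [chartExt, if_pos (hH.mem_Ioo t), hH.invFun_apply]

/-- Inside the interval this is the chain rule. At any other `x` the distance from `H t` to `x` is
at least a multiple of `1/(1+t²)`, so decay of order `(1+t²)⁻²` bounds the extension by a multiple
of the squared distance to `x`, and the derivative is 0. -/
lemma hasDerivAt_chartExt (hH : IsSlowChart H) {u : ℝ → ℝ} (hu : Dec 1 u) (x : ℝ) :
    HasDerivAt (chartExt H u) (chartExt H (fun t => deriv u t * (deriv H t)⁻¹) x) x := by
  by_cases hx : x ∈ Ioo (0 : ℝ) 1
  · have h := (hu.hasDerivAt (Function.invFun H x)).comp x (hH.hasDerivAt_invFun hx)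
    rw [chartExt, if_pos hx]
    refine h.congr_of_eventuallyEq ?_
    filter_upwards [isOpen_Ioo.mem_nhds hx] with y hy
    exact if_pos hy
  · obtain ⟨c, hc, hd⟩ := hH.exists_dist_bound
    obtain ⟨C, hC⟩ := hu.rapidlyDecaying 2
    have hb : ∀ y, ‖chartExt H u y‖ ≤ C * (c ^ 2)⁻¹ * ‖‖y - x‖ ^ 2‖ := by
      intro y
      have hC0 : 0 ≤ C := le_trans (by positivity) (hC 0)
      by_cases hy : y ∈ Ioo (0 : ℝ) 1
      · obtain ⟨t, rfl⟩ := hH.exists_eq hy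
        rw [hH.chartExt_apply]
        have h1 : c ≤ |H t - x| * (1 + t ^ 2) := by
          rw [Set.mem_Ioo, not_and_or, not_lt, not_lt] at hx
          rcases hx with hx | hx
          · refine (hd t).1.trans ?_
            gcongr
            exact le_trans (by linarith) (le_abs_self _)
          · refine (hd t).2.trans ?_
            gcongr
            exact le_trans (by linarith) (neg_le_abs _)
        have h2 : c ^ 2 ≤ |H t - x| ^ 2 * (1 + t ^ 2) ^ 2 := by
          rw [← mul_pow]; gcongr
        rw [Real.norm_of_nonneg (by positivity : 0 ≤ ‖H t - x‖ ^ 2), Real.norm_eq_abs,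
          Real.norm_eq_abs, mul_assoc, ← div_eq_inv_mul]
        have h3 := hC t
        have h4 : 1 ≤ |H t - x| ^ 2 / c ^ 2 * (1 + t ^ 2) ^ 2 := by
          rw [div_mul_eq_mul_div, one_le_div (by positivity)]; exact h2
        calc |u t| ≤ |u t| * (|H t - x| ^ 2 / c ^ 2 * (1 + t ^ 2) ^ 2) :=
              le_mul_of_one_le_right (abs_nonneg _) h4
          _ = |u t| * (1 + t ^ 2) ^ 2 * (|H t - x| ^ 2 / c ^ 2) := by ring
          _ ≤ _ := by gcongr
      · rw [chartExt, if_neg hy, norm_zero]; positivity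
    have h0 : chartExt H u x = 0 := if_neg hx
    rw [show chartExt H (fun t => deriv u t * (deriv H t)⁻¹) x = 0 from if_neg hx]
    have := (Asymptotics.IsBigO.of_bound' (f := fun y => chartExt H u y)
      (g := fun y => (C * (c ^ 2)⁻¹) * ‖y - x‖ ^ 2) (l := 𝓝 x) (Eventually.of_forall fun y => by
        refine (hb y).trans ?_
        rw [norm_mul]
        gcongr
        exact Real.le_norm_self _)).trans
      ((Asymptotics.isBigO_refl (fun y => ‖y - x‖ ^ 2) (𝓝 x)).const_mul_left _)
    have h : HasFDerivAt (chartExt H u) (0 : ℝ →L[ℝ] ℝ) x := this.hasFDerivAt (by norm_num)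
    simpa using h.hasDerivAt

lemma dec_chartDeriv (hH : IsSlowChart H) {u : ℝ → ℝ} (hu : ∀ n, Dec n u) (n : ℕ) :
    Dec n (fun t => deriv u t * (deriv H t)⁻¹) :=
  (hu (n + 1)).2.2.mul_temp (hH.temp_inv_deriv n)

lemma deriv_chartExt (hH : IsSlowChart H) {u : ℝ → ℝ} (hu : ∀ n, Dec n u) :
    deriv (chartExt H u) = chartExt H (fun t => deriv u t * (deriv H t)⁻¹) :=
  funext fun x => (hH.hasDerivAt_chartExt (hu 1) x).deriv

lemma contDiff_chartExt (hH : IsSlowChart H) {u : ℝ → ℝ} (hu : ∀ n, Dec n u) : ContDiff ℝ ∞ (chartExt H u) := by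
  refine contDiff_infty.2 fun n => ?_
  induction n generalizing u with
  | zero => exact contDiff_zero.2 (continuous_iff_continuousAt.2 fun x =>
      (hH.hasDerivAt_chartExt (hu 1) x).continuousAt)
  | succ n ih =>
    push_cast
    refine contDiff_succ_iff_deriv.2 ⟨fun x => (hH.hasDerivAt_chartExt (hu 1) x).differentiableAt,
      by simp, ?_⟩
    rw [hH.deriv_chartExt hu]
    exact ih (hH.dec_chartDeriv hu)

/-- Both infinite tangency and tapering are read off from this form: an extension vanishes at the
endpoints, and its size near them is governed by the decay of `v`. -/
lemma exists_iteratedDeriv_chartExt (hH : IsSlowChart H) (k : ℕ) : ∀ {u : ℝ → ℝ}, (∀ n, Dec n u) →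
    ∃ v : ℝ → ℝ, (∀ n, Dec n v) ∧ iteratedDeriv k (chartExt H u) = chartExt H v := by
  induction k with
  | zero => exact fun {u} hu => ⟨u, hu, iteratedDeriv_zero⟩
  | succ k ih =>
    intro u hu
    obtain ⟨v, hv, h⟩ := ih (hH.dec_chartDeriv hu)
    exact ⟨v, hv, by rw [iteratedDeriv_succ', hH.deriv_chartExt hu, h]⟩

lemma tendsto_invFun_zero (hH : IsSlowChart H) : Tendsto (Function.invFun H) (𝓝[>] 0) atBot := by
  refine Filter.tendsto_atBot.2 fun b => ?_
  filter_upwards [Ioo_mem_nhdsGT (lt_min one_pos (hH.mem_Ioo b).1)] with x hx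
  exact ((hH.invFun_lt_iff ⟨hx.1, hx.2.trans_le (min_le_left _ _)⟩).2
    (hx.2.trans_le (min_le_right _ _))).le

lemma tendsto_invFun_one (hH : IsSlowChart H) : Tendsto (Function.invFun H) (𝓝[<] 1) atTop := by
  refine Filter.tendsto_atTop.2 fun b => ?_
  filter_upwards [Ioo_mem_nhdsLT (max_lt one_pos (hH.mem_Ioo b).2)] with x hx
  exact ((hH.lt_invFun_iff ⟨(le_max_left _ _).trans_lt hx.1, hx.2⟩).2
    ((le_max_right _ _).trans_lt hx.1)).le

/-- Decay of order `(1+t²)⁻²` is used: one power matches the lower bound for `η`, the other absorbs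
the constant `C` once `|t| ≥ C`. -/
lemma eventually_abs_chartExt_le (hH : IsSlowChart H) {η u : ℝ → ℝ} (hu : RapidlyDecaying u)
    (h0 : ∀ᶠ t in atBot, (1 + t ^ 2)⁻¹ ≤ η (H t)) (h1 : ∀ᶠ t in atTop, (1 + t ^ 2)⁻¹ ≤ η (H t)) :
    (∀ᶠ x in 𝓝[>] 0, |chartExt H u x| ≤ η x) ∧ ∀ᶠ x in 𝓝[<] 1, |chartExt H u x| ≤ η x := by
  obtain ⟨C, hC⟩ := hu 2
  have key : ∀ x ∈ Ioo (0 : ℝ) 1, (1 + (Function.invFun H x) ^ 2)⁻¹ ≤ η (H (Function.invFun H x)) →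
      C ≤ |Function.invFun H x| → |chartExt H u x| ≤ η x := by
    intro x hx h hC'
    obtain ⟨t, rfl⟩ := hH.exists_eq hx
    rw [hH.invFun_apply] at h hC'
    rw [hH.chartExt_apply]
    refine le_trans ?_ h
    rw [← one_div, le_div_iff₀ (by positivity)]
    have h3 := hC t
    have h4 : |t| ≤ 1 + t ^ 2 := by rw [← sq_abs]; nlinarith [sq_nonneg (|t| - 1), abs_nonneg t]
    have h5 : |u t| * (1 + t ^ 2) * (1 + t ^ 2) ≤ 1 * (1 + t ^ 2) := by nlinarith
    exact le_of_mul_le_mul_right h5 (by positivity)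
  constructor
  · filter_upwards [Ioo_mem_nhdsGT one_pos, hH.tendsto_invFun_zero.eventually h0,
      hH.tendsto_invFun_zero.eventually (eventually_le_atBot (-C))] with x hx h h'
    exact key x hx h (le_trans (by linarith) (neg_le_abs _))
  · filter_upwards [Ioo_mem_nhdsLT one_pos, hH.tendsto_invFun_one.eventually h1,
      hH.tendsto_invFun_one.eventually (eventually_ge_atTop C)] with x hx h h'
    exact key x hx h (le_trans h' (le_abs_self _))

end IsSlowChart

end


open Set Filter Topology

noncomputable section

open scoped ContDiff

/-! ### Conjugation of homeomorphisms of the line to homeomorphisms of the interval -/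

/-- The map `f` of the line, read in the chart `H` of `(0, 1)` and extended by the identity. -/
def chartConj (H f : ℝ → ℝ) (x : ℝ) : ℝ :=
  if x ∈ Ioo (0 : ℝ) 1 then H (f (Function.invFun H x)) else x

namespace IsSlowChart

variable {H : ℝ → ℝ}

lemma chartConj_apply (hH : IsSlowChart H) (f : ℝ → ℝ) (t : ℝ) : chartConj H f (H t) = H (f t) := by
  rw [chartConj, if_pos (hH.mem_Ioo t), hH.invFun_apply]

lemma chartConj_comp (hH : IsSlowChart H) (f g : ℝ → ℝ) (x : ℝ) :
    chartConj H f (chartConj H g x) = chartConj H (f ∘ g) x := by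
  by_cases hx : x ∈ Ioo (0 : ℝ) 1
  · obtain ⟨t, rfl⟩ := hH.exists_eq hx
    simp only [hH.chartConj_apply, Function.comp]
  · simp only [chartConj, if_neg hx]

lemma chartConj_id (hH : IsSlowChart H) (x : ℝ) : chartConj H id x = x := by
  by_cases hx : x ∈ Ioo (0 : ℝ) 1
  · obtain ⟨t, rfl⟩ := hH.exists_eq hx
    exact hH.chartConj_apply id t
  · simp only [chartConj, if_neg hx]

lemma chartConj_mem (hH : IsSlowChart H) (f : ℝ → ℝ) {x : ℝ} (hx : x ∈ Icc (0 : ℝ) 1) : chartConj H f x ∈ Icc (0 : ℝ) 1 := by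
  rw [chartConj]
  split_ifs
  · exact Ioo_subset_Icc_self (hH.mem_Ioo _)
  · exact hx

lemma chartConj_strictMonoOn (hH : IsSlowChart H) {f : ℝ → ℝ} (hf : StrictMono f) :
    StrictMonoOn (chartConj H f) (Icc 0 1) := by
  intro x hx y hy hxy
  by_cases hx' : x ∈ Ioo (0 : ℝ) 1 <;> by_cases hy' : y ∈ Ioo (0 : ℝ) 1
  · obtain ⟨s, rfl⟩ := hH.exists_eq hx'
    obtain ⟨t, rfl⟩ := hH.exists_eq hy'
    rw [hH.chartConj_apply, hH.chartConj_apply]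
    exact hH.strictMono (hf (hH.strictMono.lt_iff_lt.1 hxy))
  · obtain ⟨s, rfl⟩ := hH.exists_eq hx'
    have : y = 1 := le_antisymm hy.2 (not_lt.1 fun h => hy' ⟨hx'.1.trans hxy, h⟩)
    rw [hH.chartConj_apply, chartConj, if_neg hy', this]
    exact (hH.mem_Ioo _).2
  · obtain ⟨t, rfl⟩ := hH.exists_eq hy'
    have : x = 0 := le_antisymm (not_lt.1 fun h => hx' ⟨h, hxy.trans hy'.2⟩) hx.1
    rw [hH.chartConj_apply, chartConj, if_neg hx', this]
    exact (hH.mem_Ioo _).1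
  · rwa [chartConj, chartConj, if_neg hx', if_neg hy']

/-- The order automorphism of the interval given by an order automorphism of the line. -/
def conjOrderIso (hH : IsSlowChart H) (f : ℝ ≃o ℝ) : unitInterval ≃o unitInterval where
  toFun x := ⟨chartConj H f x, hH.chartConj_mem f x.2⟩
  invFun x := ⟨chartConj H f.symm x, hH.chartConj_mem f.symm x.2⟩
  left_inv x := Subtype.ext <| by
    simp only [hH.chartConj_comp]
    rw [show (⇑f.symm ∘ ⇑f) = id from funext f.symm_apply_apply, hH.chartConj_id]
  right_inv x := Subtype.ext <| by
    simp only [hH.chartConj_comp]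
    rw [show (⇑f ∘ ⇑f.symm) = id from funext f.apply_symm_apply, hH.chartConj_id]
  map_rel_iff' {x y} := (hH.chartConj_strictMonoOn f.strictMono).le_iff_le x.2 y.2

/-- Order automorphisms of the line act on the interval by homeomorphisms. -/
def conjHom (hH : IsSlowChart H) : (ℝ ≃o ℝ) →* (unitInterval ≃ₜ unitInterval) where
  toFun f := (hH.conjOrderIso f).toHomeomorph
  map_one' := Homeomorph.ext fun x => Subtype.ext (hH.chartConj_id x)
  map_mul' f g := Homeomorph.ext fun x => Subtype.ext (hH.chartConj_comp f g x).symm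

lemma coe_conjHom_apply (hH : IsSlowChart H) (f : ℝ ≃o ℝ) (x : unitInterval) :
    (hH.conjHom f x : ℝ) = chartConj H f x := rfl

lemma realMap_conjHom (hH : IsSlowChart H) (f : ℝ ≃o ℝ) {x : ℝ} (hx : x ∈ Icc (0 : ℝ) 1) :
    realMap (hH.conjHom f) x = chartConj H f x := by
  rw [realMap, hH.coe_conjHom_apply, projIcc_of_mem _ hx]

lemma chartConj_eq (hH : IsSlowChart H) (f : ℝ → ℝ) (x : ℝ) :
    chartConj H f x = x + chartExt H (fun t => H (f t) - H t) x := by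
  by_cases hx : x ∈ Ioo (0 : ℝ) 1
  · obtain ⟨t, rfl⟩ := hH.exists_eq hx
    rw [hH.chartConj_apply, hH.chartExt_apply]; ring
  · rw [chartConj, chartExt, if_neg hx, if_neg hx, add_zero]

lemma dec_conj (hH : IsSlowChart H) {f : ℝ ≃o ℝ} (hf : IsTame f) (n : ℕ) : Dec n (fun t => H (f t) - H t) :=
  Dec.comp_sub (hH.temp _) (hf.dec n)

lemma displacementDeriv_conjHom (hH : IsSlowChart H) {f : ℝ ≃o ℝ} (hf : IsTame f) (k : ℕ) {x : ℝ}
    (hx : x ∈ Icc (0 : ℝ) 1) : displacementDeriv k (hH.conjHom f) x =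
      iteratedDeriv k (chartExt H (fun t => H (f t) - H t)) x := by
  rw [displacementDeriv, iteratedDerivWithin_congr (g := chartExt H (fun t => H (f t) - H t))
    (fun y hy => by rw [displacement, hH.realMap_conjHom f hy, hH.chartConj_eq]; ring) hx]
  exact iteratedDerivWithin_eq_iteratedDeriv (uniqueDiffOn_Icc one_pos)
    (((hH.contDiff_chartExt (hH.dec_conj hf)).of_le (by exact_mod_cast le_top)).contDiffAt) hx

lemma contDiffOn_realMap_conjHom (hH : IsSlowChart H) {f : ℝ ≃o ℝ} (hf : IsTame f) :
    ContDiffOn ℝ ∞ (realMap (hH.conjHom f)) (Icc 0 1) :=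
  (contDiff_id.add (hH.contDiff_chartExt (hH.dec_conj hf))).contDiffOn.congr fun x hx => by
    rw [hH.realMap_conjHom f hx, hH.chartConj_eq]; rfl

lemma isTaperedDiffeo_conjHom (hH : IsSlowChart H) {f : ℝ ≃o ℝ} (hf : IsTame f) : IsTaperedDiffeo (hH.conjHom f) where
  smooth := hH.contDiffOn_realMap_conjHom hf
  smooth_symm := by
    have : (hH.conjHom f).symm = hH.conjHom f⁻¹ := (map_inv hH.conjHom f).symm
    rw [this]
    exact hH.contDiffOn_realMap_conjHom hf.inv
  tangent_zero k := by
    obtain ⟨v, -, hv⟩ := hH.exists_iteratedDeriv_chartExt k (hH.dec_conj hf)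
    rw [hH.displacementDeriv_conjHom hf k (by simp), hv, chartExt, if_neg (by simp)]
  tangent_one k := by
    obtain ⟨v, -, hv⟩ := hH.exists_iteratedDeriv_chartExt k (hH.dec_conj hf)
    rw [hH.displacementDeriv_conjHom hf k (by simp), hv, chartExt, if_neg (by simp)]

lemma tapersWithin_conjHom (hH : IsSlowChart H) {η : ℝ → ℝ} (h0 : ∀ᶠ t in atBot, (1 + t ^ 2)⁻¹ ≤ η (H t))
    (h1 : ∀ᶠ t in atTop, (1 + t ^ 2)⁻¹ ≤ η (H t)) {f : ℝ ≃o ℝ} (hf : IsTame f) :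
    TapersWithin η (hH.conjHom f) := by
  intro k
  obtain ⟨v, hv, hk⟩ := hH.exists_iteratedDeriv_chartExt k (hH.dec_conj hf)
  obtain ⟨h2, h3⟩ := hH.eventually_abs_chartExt_le (hv 0) h0 h1
  constructor
  · filter_upwards [h2, Ioo_mem_nhdsGT one_pos] with x hx hx'
    rwa [hH.displacementDeriv_conjHom hf k (Ioo_subset_Icc_self hx'), hk]
  · filter_upwards [h3, Ioo_mem_nhdsLT one_pos] with x hx hx'
    rwa [hH.displacementDeriv_conjHom hf k (Ioo_subset_Icc_self hx'), hk]

lemma conjHom_eq_iff (hH : IsSlowChart H) (f : ℝ ≃o ℝ) {p : unitInterval} {t : ℝ} (hp : (p : ℝ) = H t) :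
    hH.conjHom f p = p ↔ f t = t := by
  rw [Subtype.ext_iff, hH.coe_conjHom_apply, hp, hH.chartConj_apply, hH.strictMono.injective.eq_iff]

lemma eventually_conjHom_ne (hH : IsSlowChart H) {f : ℝ ≃o ℝ} (hf : IsTame f) (h1 : f ≠ 1) {p : unitInterval}
    (hp0 : 0 < p) (hp1 : p < 1) : ∀ᶠ x in 𝓝[≠] p, hH.conjHom f x ≠ x := by
  have hp : (p : ℝ) ∈ Ioo (0 : ℝ) 1 := ⟨hp0, hp1⟩
  have hψ : Tendsto (fun x : unitInterval => Function.invFun H x) (𝓝 p) (𝓝 (Function.invFun H p)) :=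
    (hH.continuousAt_invFun hp).tendsto.comp continuous_subtype_val.continuousAt
  have h2 := hψ.eventually (eventually_nhdsWithin_iff.1 (hf.eventually_ne h1 (Function.invFun H p)))
  have h3 : ∀ᶠ x : unitInterval in 𝓝 p, (x : ℝ) ∈ Ioo (0 : ℝ) 1 :=
    continuous_subtype_val.continuousAt.eventually (isOpen_Ioo.mem_nhds hp)
  rw [eventually_nhdsWithin_iff]
  filter_upwards [h2, h3] with x hx hx' hxp
  rw [Ne, hH.conjHom_eq_iff f (hH.apply_invFun hx').symm]
  refine hx fun h => hxp (Subtype.ext ?_)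
  rw [← hH.apply_invFun hx', ← hH.apply_invFun hp]
  exact congrArg H h

end IsSlowChart

end


open Set Filter Topology

noncomputable section

open scoped ContDiff BoundedContinuousFunction Nat

/-! ### Entire functions with bounded Taylor coefficients -/

/-- The function `∑ cₙ yⁿ / n!`. -/
def expGen (c : ℕ →ᵇ ℝ) (y : ℝ) : ℝ := ∑' n : ℕ, c n * (y ^ n / n !)

lemma norm_expGen_term_le (c : ℕ →ᵇ ℝ) (y : ℝ) (n : ℕ) :
    ‖c n * (y ^ n / n !)‖ ≤ ‖c‖ * (|y| ^ n / n !) := by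
  rw [norm_mul, norm_div, norm_pow, Real.norm_eq_abs y, Real.norm_natCast]
  gcongr
  exact c.norm_coe_le_norm n

lemma summable_expGen (c : ℕ →ᵇ ℝ) (y : ℝ) : Summable fun n : ℕ => c n * (y ^ n / n !) :=
  .of_norm_bounded ((Real.summable_pow_div_factorial |y|).mul_left ‖c‖) (norm_expGen_term_le c y)

/-- The parameters form a Banach space, as Baire category requires, and the norm controls the
function uniformly on bounded sets, in particular on the range of `arctan`. All polynomials are
included, so finite sets of zeros can be prescribed. -/
lemma abs_expGen_le (c : ℕ →ᵇ ℝ) (y : ℝ) : |expGen c y| ≤ ‖c‖ * Real.exp |y| := by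
  refine tsum_of_norm_bounded ?_ (norm_expGen_term_le c y)
  rw [Real.exp_eq_exp_ℝ]
  exact (NormedSpace.expSeries_div_hasSum_exp |y|).mul_left ‖c‖

lemma expGen_add (c d : ℕ →ᵇ ℝ) (y : ℝ) : expGen (c + d) y = expGen c y + expGen d y := by
  rw [expGen, expGen, expGen, ← (summable_expGen c y).tsum_add (summable_expGen d y)]
  simp [add_mul]

lemma expGen_smul (a : ℝ) (c : ℕ →ᵇ ℝ) (y : ℝ) : expGen (a • c) y = a * expGen c y := by
  rw [expGen, expGen, ← tsum_mul_left]
  simp [mul_assoc]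

lemma expGen_sub (c d : ℕ →ᵇ ℝ) (y : ℝ) : expGen (c - d) y = expGen c y - expGen d y := by
  have := expGen_add (c - d) d y
  rw [sub_add_cancel] at this
  linarith

/-- The shifted sequence. -/
def shiftSeq (c : ℕ →ᵇ ℝ) : ℕ →ᵇ ℝ :=
  .ofNormedAddCommGroupDiscrete (fun n => c (n + 1)) ‖c‖ fun _ => c.norm_coe_le_norm _

lemma norm_shiftSeq_le (c : ℕ →ᵇ ℝ) : ‖shiftSeq c‖ ≤ ‖c‖ :=
  (BoundedContinuousFunction.norm_le (norm_nonneg _)).2 fun _ => c.norm_coe_le_norm _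

/-- With the normalisation by `n!` differentiation becomes the shift of coefficients. The shift does
not increase the norm, so the derivatives satisfy the same bounds. -/
lemma hasDerivAt_expGen (c : ℕ →ᵇ ℝ) (y : ℝ) :
    HasDerivAt (expGen c) (expGen (shiftSeq c) y) y := by
  have hterm : ∀ (n : ℕ) (z : ℝ), HasDerivAt (fun z : ℝ => c n * (z ^ n / n !))
      (c n * (n * z ^ (n - 1) / n !)) z := fun n z =>
    ((hasDerivAt_pow n z).div_const _).const_mul _
  have hfac : ∀ (n : ℕ) (z : ℝ), ((n + 1 : ℕ) : ℝ) * z ^ n / (n + 1)! = z ^ n / n ! := fun n z => by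
    rw [Nat.factorial_succ, Nat.cast_mul, mul_div_mul_left]
    positivity
  have hbase : Summable fun n : ℕ => ‖c‖ * (n * (|y| + 1) ^ (n - 1) / n !) := by
    rw [← summable_nat_add_iff 1]
    simp only [Nat.add_sub_cancel, hfac]
    exact (Real.summable_pow_div_factorial _).mul_left _
  have h := hasDerivAt_tsum_of_isPreconnected (t := Metric.ball (0 : ℝ) (|y| + 1))
    (g := fun n z => c n * (z ^ n / n !)) (g' := fun n z => c n * (n * z ^ (n - 1) / n !))
    (y₀ := y) (y := y) hbase Metric.isOpen_ball (convex_ball _ _).isPreconnected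
    (fun n z _ => hterm n z) (fun n z hz => ?_) (by simp) (summable_expGen c y) (by simp)
  · refine h.congr_deriv ?_
    rw [Summable.tsum_eq_zero_add]
    · simp only [Nat.cast_zero, zero_mul, zero_div, mul_zero, zero_add, Nat.add_sub_cancel, hfac]
      rfl
    · rw [← summable_nat_add_iff 1]
      simp only [Nat.add_sub_cancel, hfac]
      exact summable_expGen (shiftSeq c) y
  · rw [norm_mul, norm_div, norm_mul, norm_pow, Real.norm_natCast, Real.norm_natCast]
    rw [mem_ball_zero_iff] at hz
    gcongr
    exact c.norm_coe_le_norm n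

lemma contDiff_expGen (c : ℕ →ᵇ ℝ) : ContDiff ℝ ω (expGen c) := by
  let p := FormalMultilinearSeries.ofScalars ℝ (fun n : ℕ => c n / n !)
  have hnorm : ∀ n, ‖p n‖ ≤ ‖c‖ / n ! := fun n => by
    simp only [p, FormalMultilinearSeries.ofScalars, norm_smul, norm_div, Real.norm_natCast,
      ContinuousMultilinearMap.norm_mkPiAlgebraFin, mul_one]
    gcongr
    exact c.norm_coe_le_norm n
  have hr : p.radius = ⊤ := by
    refine p.radius_eq_top_of_summable_norm fun r => ?_
    refine .of_nonneg_of_le (fun n => by positivity) (fun n => ?_)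
      ((Real.summable_pow_div_factorial r).mul_left ‖c‖)
    calc ‖p n‖ * (r : ℝ) ^ n ≤ ‖c‖ / n ! * r ^ n := by gcongr; exact hnorm n
      _ = _ := by ring
  have hp := p.hasFPowerSeriesOnBall (by rw [hr]; exact ENNReal.zero_lt_top)
  have hsum : p.sum = expGen c := by
    funext y
    rw [expGen, FormalMultilinearSeries.sum]
    refine tsum_congr fun n => ?_
    simp [p, FormalMultilinearSeries.ofScalars]
    ring
  rw [hsum, hr] at hp
  exact contDiff_iff_contDiffAt.2 fun y => (hp.analyticAt_of_mem (by simp)).contDiffAt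

/-- Polynomials have bounded coefficients. -/
lemma exists_expGen_eq_eval (P : Polynomial ℝ) : ∃ c : ℕ →ᵇ ℝ, ∀ y, expGen c y = P.eval y := by
  refine ⟨.ofNormedAddCommGroupDiscrete (fun n => P.coeff n * n !)
    (∑ k ∈ Finset.range (P.natDegree + 1), ‖P.coeff k * (k ! : ℝ)‖) fun n => ?_, fun y => ?_⟩
  · by_cases hn : n < P.natDegree + 1
    · exact Finset.single_le_sum (f := fun k => ‖P.coeff k * (k ! : ℝ)‖) (fun _ _ => norm_nonneg _)
        (Finset.mem_range.2 hn)
    · rw [Polynomial.coeff_eq_zero_of_natDegree_lt (by omega)]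
      simpa using Finset.sum_nonneg fun _ _ => by positivity
  · have : ∀ n, (P.coeff n * n !) * (y ^ n / n !) = P.coeff n * y ^ n := fun n => by
      field_simp
    rw [expGen, P.eval_eq_sum_range]
    simp only [BoundedContinuousFunction.coe_ofNormedAddCommGroupDiscrete, this]
    refine tsum_eq_sum fun n hn => ?_
    rw [Finset.mem_range, not_lt] at hn
    rw [Polynomial.coeff_eq_zero_of_natDegree_lt (by omega), zero_mul]

/-- A bounded sequence whose exponential generating function vanishes at finitely many given points
and nowhere else. -/
lemma exists_expGen_vanishing (Z : Finset ℝ) :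
    ∃ c : ℕ →ᵇ ℝ, ∀ y, expGen c y = 0 ↔ y ∈ Z := by
  obtain ⟨c, hc⟩ := exists_expGen_eq_eval (∏ z ∈ Z, (Polynomial.X - Polynomial.C z))
  refine ⟨c, fun y => ?_⟩
  rw [hc, Polynomial.eval_prod, Finset.prod_eq_zero_iff]
  simp only [Polynomial.eval_sub, Polynomial.eval_X, Polynomial.eval_C, sub_eq_zero]
  exact ⟨fun ⟨z, hz, h⟩ => h ▸ hz, fun h => ⟨y, h, rfl⟩⟩

/-- The modulating factor `1 + ∑ cₙ (arctan t)ⁿ / n!`. -/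
def modulation (c : ℕ →ᵇ ℝ) (t : ℝ) : ℝ := 1 + expGen c (Real.arctan t)

lemma exp_abs_arctan_le (t : ℝ) : Real.exp |Real.arctan t| ≤ 8 := by
  have h1 : |Real.arctan t| ≤ 2 := by
    have := Real.pi_lt_d2
    rw [abs_le]
    constructor <;> linarith [Real.neg_pi_div_two_lt_arctan t, Real.arctan_lt_pi_div_two t]
  have h2 := Real.exp_one_lt_d9
  calc Real.exp |Real.arctan t| ≤ Real.exp 2 := Real.exp_le_exp.2 h1
    _ = Real.exp 1 ^ 2 := by rw [← Real.exp_nat_mul]; norm_num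
    _ ≤ 8 := by nlinarith [Real.exp_pos 1]

lemma abs_modulation_sub_one_le (c : ℕ →ᵇ ℝ) (t : ℝ) : |modulation c t - 1| ≤ 8 * ‖c‖ := by
  rw [modulation, add_sub_cancel_left]
  refine (abs_expGen_le c _).trans ?_
  rw [mul_comm]
  gcongr
  exact exp_abs_arctan_le t

lemma hasDerivAt_modulation (c : ℕ →ᵇ ℝ) (t : ℝ) :
    HasDerivAt (modulation c) (expGen (shiftSeq c) (Real.arctan t) * (1 + t ^ 2)⁻¹) t := by
  refine (((hasDerivAt_expGen c _).comp t (Real.hasDerivAt_arctan t)).const_add 1).congr_deriv ?_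
  rw [one_div]

lemma abs_deriv_modulation_le (c : ℕ →ᵇ ℝ) (t : ℝ) : |deriv (modulation c) t| ≤ 8 * ‖c‖ := by
  rw [(hasDerivAt_modulation c t).deriv, abs_mul]
  calc _ ≤ (‖shiftSeq c‖ * 8) * 1 := by
        gcongr
        · exact (abs_expGen_le _ _).trans (by gcongr; exact exp_abs_arctan_le t)
        · rw [abs_of_nonneg (by positivity)]
          exact inv_le_one_of_one_le₀ (one_le_one_add_sq t)
    _ ≤ 8 * ‖c‖ := by nlinarith [norm_shiftSeq_le c]

lemma contDiff_modulation (c : ℕ →ᵇ ℝ) : ContDiff ℝ ω (modulation c) :=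
  contDiff_const.add ((contDiff_expGen c).comp Real.contDiff_arctan)

lemma temp_expGen_arctan (n : ℕ) : ∀ c, Temp n (fun t => expGen c (Real.arctan t)) := by
  have hb : ∀ c, PolyBounded (fun t => expGen c (Real.arctan t)) := fun c =>
    ⟨0, ‖c‖ * 8, fun t => by
      simpa using (abs_expGen_le c _).trans (by gcongr; exact exp_abs_arctan_le t)⟩
  induction n with
  | zero => exact hb
  | succ n ih =>
    intro c
    refine Temp.of_hasDerivAt (fun t => (hasDerivAt_expGen c _).comp t (Real.hasDerivAt_arctan t))
      (hb c) ((ih (shiftSeq c)).mul ?_)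
    simpa only [one_div] using (bddDerivs_inv_one_add_sq n).1.temp

lemma temp_modulation (n : ℕ) (c : ℕ →ᵇ ℝ) : Temp n (modulation c) :=
  (temp_const n 1).add (temp_expGen_arctan n c)

end


open Set Filter Topology

noncomputable section

open scoped ContDiff BoundedContinuousFunction

/-! ### The displacement functions -/

/-- The displacement of an expanding map with fixed point `0`. -/
def oddBump (t : ℝ) : ℝ := 1 / 8 * (t * Real.exp (-t ^ 2))

/-- A positive displacement that decays much faster than `oddBump`. -/
def tinyBump (t : ℝ) : ℝ := Real.exp (-200 * Real.exp (t ^ 2))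

lemma exp_neg_sq_mul_pow_le (N : ℕ) (t : ℝ) :
    Real.exp (-t ^ 2) * (1 + t ^ 2) ^ N ≤ Real.exp 1 * N.factorial := by
  have h := Real.pow_div_factorial_le_exp (1 + t ^ 2) (by positivity) N
  rw [div_le_iff₀ (by positivity), Real.exp_add] at h
  have h1 : Real.exp (-t ^ 2) * Real.exp (t ^ 2) = 1 := by rw [← Real.exp_add]; simp
  calc Real.exp (-t ^ 2) * (1 + t ^ 2) ^ N
      ≤ Real.exp (-t ^ 2) * (Real.exp 1 * Real.exp (t ^ 2) * N.factorial) := by gcongr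
    _ = Real.exp (-t ^ 2) * Real.exp (t ^ 2) * (Real.exp 1 * N.factorial) := by ring
    _ = _ := by rw [h1, one_mul]

lemma hasDerivAt_exp_neg_sq (t : ℝ) :
    HasDerivAt (fun t : ℝ => Real.exp (-t ^ 2)) (Real.exp (-t ^ 2) * (-2 * t)) t := by
  refine ((hasDerivAt_pow 2 t).fun_neg.exp).congr_deriv ?_
  norm_num

lemma dec_exp_neg_sq (n : ℕ) : Dec n (fun t => Real.exp (-t ^ 2)) := by
  have h0 : RapidlyDecaying (fun t => Real.exp (-t ^ 2)) := fun N =>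
    ⟨Real.exp 1 * N.factorial, fun t => by
      rw [abs_of_pos (Real.exp_pos _)]; exact exp_neg_sq_mul_pow_le N t⟩
  induction n with
  | zero => exact h0
  | succ n ih =>
    exact .of_hasDerivAt hasDerivAt_exp_neg_sq h0 (ih.mul_temp ((temp_const n (-2)).mul (temp_id n)))

lemma dec_oddBump (n : ℕ) : Dec n oddBump := by
  have := ((dec_exp_neg_sq n).mul_temp (temp_id n)).const_mul (1 / 8)
  have h : oddBump = fun t => 1 / 8 * (Real.exp (-t ^ 2) * t) := by
    funext t; rw [oddBump, mul_comm t]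
  rw [h]; exact this

lemma exp_neg_le (k : ℕ) {x : ℝ} (hx : 0 < x) : Real.exp (-x) ≤ k.factorial / x ^ k := by
  have h := Real.pow_div_factorial_le_exp x hx.le k
  rw [Real.exp_neg, inv_le_comm₀ (Real.exp_pos _) (by positivity), inv_div]
  exact h

/-- Write `E = exp(t²)`. The factor `exp(-200 E)` beats every power of `E`, and `1 + t² ≤ E`. -/
lemma rapidlyDecaying_exp_mul_tinyBump (j : ℕ) :
    RapidlyDecaying (fun t => Real.exp (t ^ 2) ^ j * tinyBump t) := by
  intro N
  refine ⟨(j + N).factorial, fun t => ?_⟩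
  have hE : 1 + t ^ 2 ≤ Real.exp (t ^ 2) := by linarith [Real.add_one_le_exp (t ^ 2)]
  have hpos := Real.exp_pos (t ^ 2)
  have h1 : tinyBump t ≤ (j + N).factorial / Real.exp (t ^ 2) ^ (j + N) := by
    refine le_trans ?_ (exp_neg_le (j + N) hpos)
    rw [tinyBump]
    exact Real.exp_le_exp.2 (by linarith)
  rw [abs_of_nonneg (by unfold tinyBump; positivity)]
  calc Real.exp (t ^ 2) ^ j * tinyBump t * (1 + t ^ 2) ^ N
      ≤ Real.exp (t ^ 2) ^ j * ((j + N).factorial / Real.exp (t ^ 2) ^ (j + N)) *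
        Real.exp (t ^ 2) ^ N := by gcongr
    _ = (j + N).factorial := by rw [pow_add]; field_simp

lemma hasDerivAt_exp_sq (t : ℝ) :
    HasDerivAt (fun t : ℝ => Real.exp (t ^ 2)) (Real.exp (t ^ 2) * (2 * t)) t := by
  refine ((hasDerivAt_pow 2 t).exp).congr_deriv ?_
  norm_num

lemma hasDerivAt_tinyBump (t : ℝ) :
    HasDerivAt tinyBump (tinyBump t * (-400 * t * Real.exp (t ^ 2))) t := by
  refine (((hasDerivAt_exp_sq t).const_mul (-200)).exp).congr_deriv ?_
  rw [tinyBump]; ring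

/-- Differentiating `tinyBump` produces another factor `exp(t²)`, so the induction on the order must
treat all powers `j` at once. -/
lemma dec_exp_mul_tinyBump (n : ℕ) : ∀ j : ℕ, Dec n (fun t => Real.exp (t ^ 2) ^ j * tinyBump t) := by
  induction n with
  | zero => exact rapidlyDecaying_exp_mul_tinyBump
  | succ n ih =>
    intro j
    refine .of_hasDerivAt (u' := fun t => (Real.exp (t ^ 2) ^ j * tinyBump t) * (2 * j * t) +
      (Real.exp (t ^ 2) ^ (j + 1) * tinyBump t) * (-400 * t)) (fun t => ?_)
      (rapidlyDecaying_exp_mul_tinyBump j)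
      (((ih j).mul_temp ((temp_const n _).mul (temp_id n))).add
        ((ih (j + 1)).mul_temp ((temp_const n _).mul (temp_id n))))
    refine (((hasDerivAt_exp_sq t).fun_pow j).mul (hasDerivAt_tinyBump t)).congr_deriv ?_
    rcases j with _ | j
    · simp; ring
    · simp only [Nat.add_sub_cancel, pow_succ]; push_cast; ring

lemma dec_tinyBump (n : ℕ) : Dec n tinyBump := by
  simpa using dec_exp_mul_tinyBump n 0

lemma contDiff_oddBump : ContDiff ℝ ω oddBump := by
  unfold oddBump; fun_prop

lemma contDiff_tinyBump : ContDiff ℝ ω tinyBump := by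
  unfold tinyBump; fun_prop

lemma tinyBump_pos (t : ℝ) : 0 < tinyBump t := Real.exp_pos _

lemma tinyBump_le (t : ℝ) : tinyBump t ≤ 1 / 200 := by
  have h1 : 1 ≤ Real.exp (t ^ 2) := Real.one_le_exp (sq_nonneg t)
  have h2 := exp_neg_le 1 (x := 200 * Real.exp (t ^ 2)) (by positivity)
  rw [tinyBump, neg_mul]
  refine h2.trans ?_
  simp only [Nat.factorial_one, Nat.cast_one, pow_one]
  gcongr
  linarith

lemma abs_deriv_tinyBump_le (t : ℝ) : |deriv tinyBump t| ≤ 1 / 8 := by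
  rw [(hasDerivAt_tinyBump t).deriv]
  have h1 : 1 + t ^ 2 ≤ Real.exp (t ^ 2) := by linarith [Real.add_one_le_exp (t ^ 2)]
  have h4 : |t| ≤ Real.exp (t ^ 2) := by
    refine le_trans ?_ h1
    rw [← sq_abs]; nlinarith [sq_nonneg (|t| - 1), abs_nonneg t]
  have h2 := exp_neg_le 3 (x := 200 * Real.exp (t ^ 2)) (by positivity)
  rw [abs_mul, abs_mul, abs_mul, abs_of_pos (tinyBump_pos t), abs_of_pos (Real.exp_pos _),
    show |(-400 : ℝ)| = 400 by norm_num]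
  have h3 : tinyBump t ≤ 6 / (200 * Real.exp (t ^ 2)) ^ 3 := by
    rw [tinyBump, neg_mul]; simpa [Nat.factorial] using h2
  have hE : 1 ≤ Real.exp (t ^ 2) := by nlinarith [sq_nonneg t]
  calc tinyBump t * (400 * |t| * Real.exp (t ^ 2))
      ≤ 6 / (200 * Real.exp (t ^ 2)) ^ 3 * (400 * Real.exp (t ^ 2) * Real.exp (t ^ 2)) := by gcongr
    _ = 3 / 10000 / Real.exp (t ^ 2) := by field_simp; norm_num
    _ ≤ 3 / 10000 / 1 := by gcongr
    _ ≤ 1 / 8 := by norm_num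

lemma hasDerivAt_oddBump (t : ℝ) :
    HasDerivAt oddBump (1 / 8 * ((1 - 2 * t ^ 2) * Real.exp (-t ^ 2))) t := by
  refine (((hasDerivAt_id' t).mul (hasDerivAt_exp_neg_sq t)).const_mul (1 / 8)).congr_deriv ?_
  ring

lemma exp_neg_sq_mul_le (t : ℝ) : Real.exp (-t ^ 2) * (1 + t ^ 2) ≤ 1 := by
  have h1 : Real.exp (-t ^ 2) * Real.exp (t ^ 2) = 1 := by rw [← Real.exp_add]; simp
  nlinarith [Real.add_one_le_exp (t ^ 2), Real.exp_pos (-t ^ 2)]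

lemma abs_deriv_oddBump_le (t : ℝ) : |deriv oddBump t| ≤ 1 / 4 := by
  rw [(hasDerivAt_oddBump t).deriv, abs_le]
  have h1 := exp_neg_sq_mul_le t
  have h2 := Real.exp_pos (-t ^ 2)
  have h3 := mul_nonneg h2.le (sq_nonneg t)
  constructor <;> nlinarith

lemma neg_le_deriv_oddBump (t : ℝ) : -(1 / 8) ≤ deriv oddBump t := by
  rw [(hasDerivAt_oddBump t).deriv]
  have h1 := exp_neg_sq_mul_le t
  -- The bound `1 + t² ≤ exp(t²)` is too weak for large `t`; the square of the bound for `exp(t²/2)`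
  -- supplies the needed quartic term.
  have h4 : Real.exp (-t ^ 2) * Real.exp (t ^ 2 / 2) * Real.exp (t ^ 2 / 2) = 1 := by
    rw [← Real.exp_add, ← Real.exp_add]
    rw [show -t ^ 2 + t ^ 2 / 2 + t ^ 2 / 2 = 0 by ring, Real.exp_zero]
  have h5 := Real.add_one_le_exp (t ^ 2 / 2)
  have h2 := Real.exp_pos (-t ^ 2)
  have h6 : Real.exp (-t ^ 2) * ((t ^ 2 / 2 + 1) * (t ^ 2 / 2 + 1)) ≤ 1 := by
    refine le_trans (mul_le_mul_of_nonneg_left (mul_le_mul h5 h5 (by positivity)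
      (Real.exp_pos _).le) h2.le) ?_
    rw [← mul_assoc]; exact h4.le
  nlinarith [sq_nonneg (t ^ 2 / 2 - 1), mul_nonneg h2.le (sq_nonneg (t ^ 2 / 2 - 1))]

lemma abs_oddBump_le (t : ℝ) : |oddBump t| ≤ 1 / 8 := by
  rw [oddBump, abs_mul, abs_mul, abs_of_pos (Real.exp_pos _), abs_of_pos (by norm_num : (0:ℝ) < 1 / 8)]
  have h4 : |t| ≤ 1 + t ^ 2 := by
    rw [← sq_abs]; nlinarith [sq_nonneg (|t| - 1), abs_nonneg t]
  nlinarith [exp_neg_sq_mul_le t, Real.exp_pos (-t ^ 2)]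

/-- The two types of generators. -/
inductive GenKind
  | tiny
  | odd

/-- The unperturbed displacement of a generator. -/
def GenKind.base : GenKind → ℝ → ℝ
  | tiny => tinyBump
  | odd => oddBump

lemma GenKind.contDiff_base (κ : GenKind) : ContDiff ℝ ω κ.base := by
  cases κ
  exacts [contDiff_tinyBump, contDiff_oddBump]

lemma GenKind.dec_base (κ : GenKind) (n : ℕ) : Dec n κ.base := by
  cases κ
  exacts [dec_tinyBump n, dec_oddBump n]

lemma GenKind.abs_base_le (κ : GenKind) (t : ℝ) : |κ.base t| ≤ 1 / 8 := by
  have h : |tinyBump t| ≤ 1 / 8 := by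
    rw [abs_of_pos (tinyBump_pos t)]; linarith [tinyBump_le t]
  cases κ
  exacts [h, abs_oddBump_le t]

lemma GenKind.abs_deriv_base_le (κ : GenKind) (t : ℝ) : |deriv κ.base t| ≤ 1 / 4 := by
  have h := (abs_deriv_tinyBump_le t).trans (by norm_num : (1 / 8 : ℝ) ≤ 1 / 4)
  cases κ
  exacts [h, abs_deriv_oddBump_le t]

lemma GenKind.base_ne_zero (κ : GenKind) {t : ℝ} (ht : t ≠ 0) : κ.base t ≠ 0 := by
  cases κ
  exacts [(tinyBump_pos t).ne', mul_ne_zero (by norm_num) (mul_ne_zero ht (Real.exp_pos _).ne')]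

/-! ### The generators -/

/-- The displacement of a generator with parameter `c`. -/
def genDisp (κ : GenKind) (c : ℕ →ᵇ ℝ) (t : ℝ) : ℝ := κ.base t * modulation c t

/-- The space of parameters. -/
abbrev GenParam (ι : Type*) [Fintype ι] : Type _ :=
  Metric.ball (0 : ι → (ℕ →ᵇ ℝ)) (1 / 1000)

lemma contDiff_genDisp (κ : GenKind) (c : ℕ →ᵇ ℝ) : ContDiff ℝ ω (genDisp κ c) :=
  κ.contDiff_base.mul (contDiff_modulation c)

lemma dec_genDisp (κ : GenKind) (c : ℕ →ᵇ ℝ) (n : ℕ) : Dec n (genDisp κ c) :=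
  (κ.dec_base n).mul_temp (temp_modulation n c)

lemma deriv_genDisp (κ : GenKind) (c : ℕ →ᵇ ℝ) (t : ℝ) : deriv (genDisp κ c) t =
    deriv κ.base t * modulation c t + κ.base t * deriv (modulation c) t :=
  ((((κ.dec_base 1).hasDerivAt t)).fun_mul ((temp_modulation 1 c).hasDerivAt t)).deriv

section Small

variable {c : ℕ →ᵇ ℝ}

/-- The constant is `8 · 1/1000`, with 8 from the bound for `exp |arctan|`. -/
lemma abs_modulation_sub_one_lt (hc : ‖c‖ < 1 / 1000) (t : ℝ) : |modulation c t - 1| ≤ 1 / 125 :=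
  (abs_modulation_sub_one_le c t).trans (by linarith)

lemma abs_deriv_modulation_lt (hc : ‖c‖ < 1 / 1000) (t : ℝ) : |deriv (modulation c) t| ≤ 1 / 125 :=
  (abs_deriv_modulation_le c t).trans (by linarith)

lemma modulation_bounds (hc : ‖c‖ < 1 / 1000) (t : ℝ) : 124 / 125 ≤ modulation c t ∧ modulation c t ≤ 126 / 125 := by
  have := abs_le.1 (abs_modulation_sub_one_lt hc t)
  constructor <;> linarith [this.1, this.2]

lemma abs_deriv_genDisp_le (hc : ‖c‖ < 1 / 1000) (κ : GenKind) (t : ℝ) : |deriv (genDisp κ c) t| ≤ 1 / 2 := by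
  rw [deriv_genDisp]
  have h1 := κ.abs_deriv_base_le t
  have h2 := κ.abs_base_le t
  have h3 := modulation_bounds hc t
  have h4 := abs_deriv_modulation_lt hc t
  calc _ ≤ |deriv κ.base t| * |modulation c t| + |κ.base t| * |deriv (modulation c) t| := by
        rw [← abs_mul, ← abs_mul]; exact abs_add_le _ _
    _ ≤ 1 / 4 * (126 / 125) + 1 / 8 * (1 / 125) := by
        gcongr
        rw [abs_of_pos (by linarith)]; exact h3.2
    _ ≤ 1 / 2 := by norm_num

lemma half_le_deriv_id_add (hc : ‖c‖ < 1 / 1000) (κ : GenKind) (t : ℝ) :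
    1 / 2 ≤ deriv (fun t => t + genDisp κ c t) t := by
  rw [((hasDerivAt_id' t).fun_add ((dec_genDisp κ c 1).hasDerivAt t)).deriv]
  linarith [(abs_le.1 (abs_deriv_genDisp_le hc κ t)).1]

lemma strictMono_id_add_genDisp (hc : ‖c‖ < 1 / 1000) (κ : GenKind) : StrictMono (fun t => t + genDisp κ c t) :=
  strictMono_of_deriv_pos fun t => by linarith [half_le_deriv_id_add hc κ t]

end Small

lemma surjective_id_add_genDisp (κ : GenKind) (c : ℕ →ᵇ ℝ) :
    Function.Surjective (fun t => t + genDisp κ c t) := by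
  obtain ⟨C, -, hC⟩ := (dec_genDisp κ c 0).rapidlyDecaying.exists_bound
  refine Continuous.surjective (continuous_id.add (contDiff_genDisp κ c).continuous) ?_ ?_
  · exact tendsto_atTop_mono (fun t => by simp; linarith [(abs_le.1 (hC t)).1])
      (tendsto_atTop_add_const_right _ (-C) tendsto_id)
  · exact tendsto_atBot_mono (fun t => by simp; linarith [(abs_le.1 (hC t)).2])
      (tendsto_atBot_add_const_right _ C tendsto_id)

/-- A generator, as an automorphism of the line. -/
def genIso (κ : GenKind) (c : ℕ →ᵇ ℝ) (hc : ‖c‖ < 1 / 1000) : ℝ ≃o ℝ :=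
  StrictMono.orderIsoOfSurjective _ (strictMono_id_add_genDisp hc κ) (surjective_id_add_genDisp κ c)

lemma genIso_apply (κ : GenKind) (c : ℕ →ᵇ ℝ) (hc : ‖c‖ < 1 / 1000) (t : ℝ) :
    genIso κ c hc t = t + genDisp κ c t := rfl

lemma isTame_genIso (κ : GenKind) (c : ℕ →ᵇ ℝ) (hc : ‖c‖ < 1 / 1000) : IsTame (genIso κ c hc) where
  analytic := contDiff_id.add (contDiff_genDisp κ c)
  deriv_lower := ⟨1 / 2, by norm_num, half_le_deriv_id_add hc κ⟩
  dec n := by simpa [genIso_apply] using dec_genDisp κ c n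

/-- The inverses of the generators are 2-Lipschitz uniformly in the parameter, which gives their
continuous dependence on it. -/
lemma abs_sub_le_genIso (κ : GenKind) (c : ℕ →ᵇ ℝ) (hc : ‖c‖ < 1 / 1000) (s t : ℝ) :
    |s - t| ≤ 2 * |genIso κ c hc s - genIso κ c hc t| := by
  wlog h : t ≤ s generalizing s t
  · rw [abs_sub_comm s, abs_sub_comm (genIso κ c hc s)]
    exact this t s (le_of_not_ge h)
  have h1 := (convex_univ (𝕜 := ℝ) (E := ℝ)).mul_sub_le_image_sub_of_le_deriv
    (f := fun t => t + genDisp κ c t) (C := 1 / 2)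
    (continuous_id.add (contDiff_genDisp κ c).continuous).continuousOn
    (differentiable_id.add (dec_genDisp κ c 1).2.1).differentiableOn
    (fun x _ => half_le_deriv_id_add hc κ x) t (mem_univ _) s (mem_univ _) h
  rw [abs_of_nonneg (sub_nonneg.2 h), genIso_apply, genIso_apply]
  have := le_abs_self (s + genDisp κ c s - (t + genDisp κ c t))
  linarith

lemma lt_genIso_tiny {c : ℕ →ᵇ ℝ} (hc : ‖c‖ < 1 / 1000) (t : ℝ) : t < genIso .tiny c hc t := by
  rw [genIso_apply]
  have : 0 < modulation c t := by linarith [(modulation_bounds hc t).1]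
  have : 0 < genDisp .tiny c t := mul_pos (tinyBump_pos t) this
  linarith

end


open Set Filter Topology

noncomputable section

open scoped ContDiff BoundedContinuousFunction

/-! ### The commutator of an odd and a tiny generator is positive -/

lemma mul_sub_le_genDisp_sub (κ : GenKind) (c : ℕ →ᵇ ℝ) {C s t : ℝ} (hst : s ≤ t)
    (h : ∀ x ∈ Icc s t, C ≤ deriv (genDisp κ c) x) :
    C * (t - s) ≤ genDisp κ c t - genDisp κ c s := by
  refine (convex_Icc s t).mul_sub_le_image_sub_of_le_deriv
    (contDiff_genDisp κ c).continuous.continuousOn (dec_genDisp κ c 1).2.1.differentiableOn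
    (fun x hx => h x (interior_subset hx)) s (left_mem_Icc.2 hst) t (right_mem_Icc.2 hst) hst

section Small

variable {c : ℕ →ᵇ ℝ}

lemma modulation_le_add (hc : ‖c‖ < 1 / 1000) (s t : ℝ) :
    modulation c t ≤ modulation c s + 1 / 125 * |t - s| := by
  have h := (convex_univ (𝕜 := ℝ) (E := ℝ)).norm_image_sub_le_of_norm_deriv_le
    (f := modulation c) (C := 1 / 125) (x := s) (y := t)
    (fun x _ => ((temp_modulation 1 c).hasDerivAt x).differentiableAt)
    (fun x _ => abs_deriv_modulation_lt hc x) (mem_univ _) (mem_univ _)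
  rw [Real.norm_eq_abs, Real.norm_eq_abs] at h
  linarith [le_abs_self (modulation c t - modulation c s)]

lemma neg_quarter_le_deriv_genDisp_odd (hc : ‖c‖ < 1 / 1000) (t : ℝ) :
    -(1 / 4) ≤ deriv (genDisp .odd c) t := by
  rw [deriv_genDisp]
  have h1 := neg_le_deriv_oddBump t
  have h3 := modulation_bounds hc t
  have h5 : |oddBump t * deriv (modulation c) t| ≤ 1 / 8 * (1 / 125) := by
    rw [abs_mul]
    exact mul_le_mul (abs_oddBump_le t) (abs_deriv_modulation_lt hc t) (abs_nonneg _) (by norm_num)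
  have h6 := (abs_le.1 h5).1
  change -(1 / 4) ≤ deriv oddBump t * modulation c t + oddBump t * deriv (modulation c) t
  nlinarith

lemma le_deriv_genDisp_odd (hc : ‖c‖ < 1 / 1000) {t : ℝ} (ht : |t| ≤ 13 / 50) :
    1 / 32 ≤ deriv (genDisp .odd c) t := by
  rw [deriv_genDisp]
  have h3 := modulation_bounds hc t
  have h5 : |oddBump t * deriv (modulation c) t| ≤ 1 / 8 * (1 / 125) := by
    rw [abs_mul]
    exact mul_le_mul (abs_oddBump_le t) (abs_deriv_modulation_lt hc t) (abs_nonneg _) (by norm_num)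
  have h6 := (abs_le.1 h5).1
  change 1 / 32 ≤ deriv oddBump t * modulation c t + oddBump t * deriv (modulation c) t
  have h7 : t ^ 2 ≤ (13 / 50) ^ 2 := sq_le_sq' (by linarith [(abs_le.1 ht).1]) (abs_le.1 ht).2
  have h8 : 1 - t ^ 2 ≤ Real.exp (-t ^ 2) := by linarith [Real.add_one_le_exp (-t ^ 2)]
  have h9 : 1 / 16 ≤ deriv oddBump t := by
    rw [(hasDerivAt_oddBump t).deriv]
    nlinarith
  nlinarith

end Small

lemma tinyBump_le_of_sq_le {s t : ℝ} (h : s ^ 2 ≤ t ^ 2) : tinyBump t ≤ tinyBump s := by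
  unfold tinyBump
  have := Real.exp_le_exp.2 h
  exact Real.exp_le_exp.2 (by linarith)

lemma genDisp_odd_mul_exp {c : ℕ →ᵇ ℝ} (s : ℝ) :
    s * genDisp .odd c s * Real.exp (s ^ 2) = 1 / 8 * s ^ 2 * modulation c s := by
  have h1 : Real.exp (-s ^ 2) * Real.exp (s ^ 2) = 1 := by rw [← Real.exp_add]; simp
  change s * (1 / 8 * (s * Real.exp (-s ^ 2)) * modulation c s) * Real.exp (s ^ 2) = _
  linear_combination (1 / 8 * s ^ 2 * modulation c s) * h1

/-- This is the purpose of the double exponential. With `r` the odd displacement, `exp(s²) · 2sr`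
equals `s²/4` times the modulation, so for `|s| ≥ 1/4` the step increases `exp(s²)` by at least
`1/100`, uniformly in `s`. The factor 200 turns this into a drop of the exponent by 2, and `e⁻² ≤
1/2`. For a single Gaussian the ratio would tend to 1 at infinity, since `r` decays. -/
lemma tinyBump_add_genDisp_odd_le {c : ℕ →ᵇ ℝ} (hc : ‖c‖ < 1 / 1000) {s : ℝ} (hs : 1 / 4 ≤ |s|) :
    tinyBump (s + genDisp .odd c s) ≤ 1 / 2 * tinyBump s := by
  have h1 := genDisp_odd_mul_exp (c := c) s
  set r := genDisp .odd c s
  have h2 := modulation_bounds hc s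
  have h3 : (1 / 4) ^ 2 ≤ s ^ 2 := by rw [← sq_abs s]; gcongr
  have h4 : Real.exp (s ^ 2) + 1 / 100 ≤ Real.exp ((s + r) ^ 2) := by
    have h5 : Real.exp (s ^ 2) * (1 + 2 * (s * r)) ≤ Real.exp ((s + r) ^ 2) := by
      have h6 : (s + r) ^ 2 = s ^ 2 + (2 * (s * r) + r ^ 2) := by ring
      rw [h6, Real.exp_add]
      refine mul_le_mul_of_nonneg_left ?_ (Real.exp_pos _).le
      linarith [Real.add_one_le_exp (2 * (s * r) + r ^ 2), sq_nonneg r]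
    nlinarith
  have h7 : Real.exp (-2) ≤ 1 / 2 := by
    have := exp_neg_le 1 (x := 2) (by norm_num)
    norm_num at this ⊢
    exact this
  calc tinyBump (s + r) ≤ Real.exp (-2 + -200 * Real.exp (s ^ 2)) :=
        Real.exp_le_exp.2 (by linarith)
    _ = Real.exp (-2) * tinyBump s := by rw [Real.exp_add, tinyBump]
    _ ≤ _ := mul_le_mul_of_nonneg_right h7 (tinyBump_pos s).le

/-- Expanding after a tiny positive translation moves further than the other way around. -/
lemma genIso_tiny_odd_lt {c c' : ℕ →ᵇ ℝ} (hc : ‖c‖ < 1 / 1000) (hc' : ‖c'‖ < 1 / 1000) (s : ℝ) :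
    genIso .tiny c hc (genIso .odd c' hc' s) < genIso .odd c' hc' (genIso .tiny c hc s) := by
  simp only [genIso_apply]
  have hq : genDisp .tiny c s = tinyBump s * modulation c s := rfl
  have hm := modulation_bounds hc s
  have hT := tinyBump_pos s
  have hT' := tinyBump_le s
  have hq0 : 0 < genDisp .tiny c s := by rw [hq]; exact mul_pos hT (by linarith)
  have hq1 : genDisp .tiny c s ≤ 1 / 100 := by rw [hq]; nlinarith
  have hD : genDisp .tiny c (s + genDisp .odd c' s) =
    tinyBump (s + genDisp .odd c' s) * modulation c (s + genDisp .odd c' s) := rfl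
  have hm2 := modulation_bounds hc (s + genDisp .odd c' s)
  have hr : s * genDisp .odd c' s * Real.exp (s ^ 2) = 1 / 8 * s ^ 2 * modulation c' s :=
    genDisp_odd_mul_exp s
  have hm' := modulation_bounds hc' s
  rcases le_or_gt (1 / 4) |s| with hs | hs
  -- Away from 0 the expanding step roughly halves the tiny displacement, to at most `1/2 · 126/125`
  -- of the bump. The other order keeps at least `3/4` of it, because the odd displacement has slope
  -- at least `-1/4`.
  · have h1 := mul_sub_le_genDisp_sub .odd c' (s := s) (le_add_of_nonneg_right hq0.le)
      (fun x _ => neg_quarter_le_deriv_genDisp_odd hc' x)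
    have h2 := tinyBump_add_genDisp_odd_le hc' hs
    have h3 : genDisp .tiny c (s + genDisp .odd c' s) ≤ 1 / 2 * tinyBump s * (126 / 125) := by
      rw [hD]
      exact mul_le_mul h2 hm2.2 (by linarith) (by positivity)
    nlinarith
  -- Near 0 the odd map stretches the tiny displacement by at least `1 + 1/32`; the points involved
  -- stay within `13/50 = 1/4 + 1/100`. In the other order the bump does not increase, as `|s|` does
  -- not decrease, and the modulation changes by less than `1/500`.
  · obtain ⟨hs1, hs2⟩ := abs_lt.1 hs
    have h1 := mul_sub_le_genDisp_sub .odd c' (s := s) (le_add_of_nonneg_right hq0.le)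
      (fun x hx => le_deriv_genDisp_odd hc' (t := x)
        (abs_le.2 ⟨by linarith [hx.1], by linarith [hx.2]⟩))
    have hsr : 0 ≤ s * genDisp .odd c' s := by
      have h0 : 0 ≤ 1 / 8 * s ^ 2 * modulation c' s := mul_nonneg (by positivity) (by linarith)
      rw [← hr] at h0
      exact nonneg_of_mul_nonneg_left h0 (Real.exp_pos _)
    have h2 : tinyBump (s + genDisp .odd c' s) ≤ tinyBump s :=
      tinyBump_le_of_sq_le (by nlinarith [sq_nonneg (genDisp .odd c' s)])
    have h3 : |genDisp .odd c' s| ≤ 1 / 8 * (126 / 125) := by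
      change |oddBump s * modulation c' s| ≤ _
      rw [abs_mul, abs_of_pos (by linarith : 0 < modulation c' s)]
      exact mul_le_mul (abs_oddBump_le s) hm'.2 (by linarith) (by norm_num)
    have h4 := modulation_le_add hc s (s + genDisp .odd c' s)
    rw [add_sub_cancel_left] at h4
    have h5 : genDisp .tiny c (s + genDisp .odd c' s) ≤ tinyBump s * (modulation c s + 1 / 500) := by
      rw [hD]
      exact mul_le_mul h2 (by linarith) (by linarith) hT.le
    nlinarith

end


open Set Filter Topology

noncomputable section

open scoped BoundedContinuousFunction

/-! ### Continuous dependence of the generators on the parameters -/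

lemma continuous_expGen_arctan :
    Continuous (fun p : (ℕ →ᵇ ℝ) × ℝ => expGen p.1 (Real.arctan p.2)) := by
  refine continuous_iff_continuousAt.2 fun ⟨c, t⟩ => ?_
  have h1 : Tendsto (fun p : (ℕ →ᵇ ℝ) × ℝ => expGen (p.1 - c) (Real.arctan p.2)) (𝓝 (c, t))
      (𝓝 0) := by
    refine squeeze_zero_norm (a := fun p => ‖p.1 - c‖ * 8) (fun p => ?_) ?_
    · exact (abs_expGen_le _ _).trans
        (mul_le_mul_of_nonneg_left (exp_abs_arctan_le _) (norm_nonneg _))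
    · have : Continuous (fun p : (ℕ →ᵇ ℝ) × ℝ => ‖p.1 - c‖ * 8) := by fun_prop
      simpa using this.tendsto (c, t)
  have h2 : Tendsto (fun p : (ℕ →ᵇ ℝ) × ℝ => expGen c (Real.arctan p.2)) (𝓝 (c, t))
      (𝓝 (expGen c (Real.arctan t))) :=
    ((contDiff_expGen c).continuous.comp (Real.continuous_arctan.comp continuous_snd)).tendsto (c, t)
  have h3 := h1.add h2
  simp only [expGen_sub, sub_add_cancel, zero_add] at h3
  exact h3

lemma continuous_genDisp (κ : GenKind) :
    Continuous (fun p : (ℕ →ᵇ ℝ) × ℝ => genDisp κ p.1 p.2) :=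
  (κ.contDiff_base.continuous.comp continuous_snd).mul (continuous_const.add continuous_expGen_arctan)

section Family

variable {ι : Type*} [Fintype ι]

lemma GenParam.norm_lt (c : GenParam ι) (i : ι) : ‖c.1 i‖ < 1 / 1000 :=
  (norm_le_pi_norm c.1 i).trans_lt (by simpa using c.2)

/-- The generator with index `i` in the family with parameter `c`. -/
def paramGen (κ : ι → GenKind) (c : GenParam ι) (i : ι) : ℝ ≃o ℝ :=
  genIso (κ i) (c.1 i) (c.norm_lt i)

/-- The representation of the free group with parameter `c`. -/
def paramRep (κ : ι → GenKind) (c : GenParam ι) : FreeGroup ι →* (ℝ ≃o ℝ) :=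
  FreeGroup.lift (paramGen κ c)

variable {κ : ι → GenKind}

lemma paramRep_of (c : GenParam ι) (i : ι) : paramRep κ c (.of i) = paramGen κ c i :=
  FreeGroup.lift_apply_of

/-- A word acts from its last letter on, so the trajectory of `t` consists of its images under the
suffixes. For an inverse letter the relation is stated implicitly, so that only values of the
generators themselves occur. -/
lemma paramRep_mk_true (c : GenParam ι) (i : ι) (L : List (ι × Bool)) (t : ℝ) :
    paramRep κ c (.mk ((i, true) :: L)) t = paramGen κ c i (paramRep κ c (.mk L) t) := by
  rw [← List.singleton_append, ← FreeGroup.mul_mk, map_mul]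
  rw [← paramRep_of]; rfl

lemma paramGen_paramRep_mk_false (c : GenParam ι) (i : ι) (L : List (ι × Bool)) (t : ℝ) :
    paramGen κ c i (paramRep κ c (.mk ((i, false) :: L)) t) = paramRep κ c (.mk L) t := by
  have h : FreeGroup.of i * FreeGroup.mk ((i, false) :: L) = FreeGroup.mk L := by
    rw [← List.singleton_append, ← FreeGroup.mul_mk, ← mul_assoc,
      show FreeGroup.mk [(i, false)] = (FreeGroup.of i)⁻¹ from rfl, mul_inv_cancel, one_mul]
  rw [← h, map_mul, paramRep_of]; rfl

lemma paramRep_nil (c : GenParam ι) (t : ℝ) : paramRep κ c (.mk []) t = t := by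
  rw [← FreeGroup.one_eq_mk, map_one]; rfl

lemma isTame_paramRep (c : GenParam ι) (w : FreeGroup ι) : IsTame (paramRep κ c w) := by
  have h : (paramRep κ c).range ≤ tameGroup := by
    refine FreeGroup.range_lift_le ?_
    rintro _ ⟨i, rfl⟩
    exact isTame_genIso _ _ _
  exact h ⟨w, rfl⟩

lemma continuous_paramGen_comp (i : ι) {φ : GenParam ι → ℝ} (hφ : Continuous φ) :
    Continuous fun c => paramGen κ c i (φ c) := by
  have h : Continuous fun c : GenParam ι => ((c.1 i, φ c) : (ℕ →ᵇ ℝ) × ℝ) :=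
    ((continuous_apply i).comp continuous_subtype_val).prodMk hφ
  exact hφ.add ((continuous_genDisp (κ i)).comp h)

/-- This is the step for inverse letters: the uniform Lipschitz bound for inverses replaces a
formula for them. -/
lemma continuous_of_continuous_paramGen_comp (i : ι) {φ : GenParam ι → ℝ}
    (hφ : Continuous fun c => paramGen κ c i (φ c)) : Continuous φ := by
  refine continuous_iff_continuousAt.2 fun c₀ => ?_
  have h : Tendsto (fun c => 2 * |paramGen κ c i (φ c) - paramGen κ c i (φ c₀)|) (𝓝 c₀) (𝓝 0) := by
    have := ((hφ.sub (continuous_paramGen_comp i continuous_const)).abs.const_mul 2).tendsto c₀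
      (f := fun c => 2 * |paramGen κ c i (φ c) - paramGen κ c i (φ c₀)|)
    simpa using this
  rw [ContinuousAt, tendsto_iff_dist_tendsto_zero]
  exact squeeze_zero (fun _ => dist_nonneg)
    (fun c => abs_sub_le_genIso (κ i) (c.1 i) (c.norm_lt i) (φ c) (φ c₀)) h

lemma continuous_paramRep (L : List (ι × Bool)) (t : ℝ) :
    Continuous fun c => paramRep κ c (.mk L) t := by
  induction L with
  | nil => simpa only [paramRep_nil] using continuous_const
  | cons x L ih =>
    obtain ⟨i, b⟩ := x
    cases b
    · refine continuous_of_continuous_paramGen_comp i (κ := κ) ?_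
      simpa only [paramGen_paramRep_mk_false] using ih
    · simpa only [paramRep_mk_true] using continuous_paramGen_comp i ih

lemma isOpen_paramRep_ne_one (L : List (ι × Bool)) :
    IsOpen {c | paramRep κ c (.mk L) ≠ 1} := by
  have : {c | paramRep κ c (.mk L) ≠ 1} = ⋃ t : ℝ, {c | paramRep κ c (.mk L) t ≠ t} := by
    ext c
    rw [mem_ofPred_eq, mem_iUnion, ← not_iff_not]
    push Not
    simp only [mem_ofPred_eq, not_not]
    exact ⟨fun h t => by rw [h]; rfl, fun h => by ext t; exact h t⟩
  rw [this]
  exact isOpen_iUnion fun t => isOpen_ne_fun (continuous_paramRep L t) continuous_const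

/-! ### Generic parameters give faithful representations -/

/-- Modifying the parameter of a generator by an arbitrarily small amount so that its values at the
points of a finite set stay the same, but its value at another point changes. -/
lemma exists_perturbation [DecidableEq ι] {U : Set (GenParam ι)} (hU : IsOpen U) {c₀ : GenParam ι}
    (hc₀ : c₀ ∈ U) (i : ι) (Z : Finset ℝ) {y : ℝ} (hyZ : y ∉ Z) (hy : y ≠ 0) :
    ∃ c ∈ U, (∀ j ≠ i, paramGen κ c j = paramGen κ c₀ j) ∧
      (∀ z ∈ Z, paramGen κ c i z = paramGen κ c₀ i z) ∧
      paramGen κ c i y ≠ paramGen κ c₀ i y := by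
  obtain ⟨V, hV, rfl⟩ := isOpen_induced_iff.1 hU
  obtain ⟨v, hv⟩ := exists_expGen_vanishing (Z.image Real.arctan)
  -- The perturbation in direction `v` multiplies the base displacement by `ε` times a function
  -- vanishing exactly on `Z`. At `y` it is nonzero since `y ∉ Z`, `arctan` is injective, and the
  -- base displacement can vanish only at 0.
  let φ : ℝ → ι → (ℕ →ᵇ ℝ) := fun ε => Function.update c₀.1 i (c₀.1 i + ε • v)
  have hφ : Continuous φ := by
    refine continuous_const.update i ?_
    fun_prop
  have hφ0 : φ 0 = c₀.1 := by simp [φ]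
  have h1 : ∀ᶠ ε in 𝓝[≠] (0 : ℝ), φ ε ∈ V ∩ Metric.ball 0 (1 / 1000) := by
    refine nhdsWithin_le_nhds (hφ.continuousAt.eventually_mem ?_)
    rw [hφ0]
    exact (hV.inter Metric.isOpen_ball).mem_nhds ⟨hc₀, c₀.2⟩
  obtain ⟨ε, ⟨h2, h3⟩, h4⟩ := (h1.and self_mem_nhdsWithin).exists
  have h5 : ∀ t, paramGen κ ⟨φ ε, h3⟩ i t =
      paramGen κ c₀ i t + (κ i).base t * (ε * expGen v (Real.arctan t)) := by
    intro t
    simp only [paramGen, genIso_apply, genDisp, modulation, φ, Function.update_self, expGen_add,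
      expGen_smul]
    ring
  refine ⟨⟨φ ε, h3⟩, h2, fun j hj => ?_, fun z hz => ?_, ?_⟩
  · ext t
    simp [paramGen, genIso_apply, φ, hj]
  · rw [h5, (hv _).2 (Finset.mem_image_of_mem _ hz)]
    simp
  · rw [h5]
    simp only [ne_eq, add_eq_left, mul_eq_zero, not_or]
    refine ⟨(κ i).base_ne_zero hy, h4, fun h => hyZ ?_⟩
    obtain ⟨z, hz, hzy⟩ := Finset.mem_image.1 ((hv _).1 h)
    rwa [← Real.arctan_injective hzy]

/-- A coincidence of the two images at `x` means that `x` is fixed by the conjugate `S⁻¹ W S`, a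
nontrivial tame map with isolated fixed points. -/
lemma eventually_paramRep_ne {c : GenParam ι} {W S : List (ι × Bool)}
    (hW : paramRep κ c (.mk W) ≠ 1) (t : ℝ) :
    ∀ᶠ x in 𝓝[≠] t, paramRep κ c (.mk (W ++ S)) x ≠ paramRep κ c (.mk S) x := by
  have h := (isTame_paramRep (κ := κ) c ((FreeGroup.mk S)⁻¹ * .mk W * .mk S)).eventually_ne
    (fun h => hW ?_) t
  · filter_upwards [h] with x hx hx'
    refine hx ?_
    rw [← FreeGroup.mul_mk] at hx'
    rw [mul_assoc, map_mul]
    change paramRep κ c (FreeGroup.mk S)⁻¹ (paramRep κ c _ x) = x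
    rw [hx', ← RelIso.mul_apply, ← map_mul, inv_mul_cancel, map_one]
    rfl
  · rw [map_mul, map_mul, map_inv, mul_assoc, inv_mul_eq_one] at h
    exact (mul_eq_right.1 h.symm)

end Family

end


/-! ### Density of the parameters at which a given reduced word acts nontrivially -/

open Set Filter Topology

noncomputable section

open scoped BoundedContinuousFunction

section Family

variable {ι : Type*} [Fintype ι] {κ : ι → GenKind}

/-- Two distinct suffixes differ by a nonempty subword `W` of `L`. There are finitely many pairs, so
nearly every point has a trajectory without repetitions. -/
lemma eventually_injOn_suffixes [DecidableEq ι] {c : GenParam ι} {L : List (ι × Bool)}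
    (h : ∀ W, W ≠ [] → W <:+: L → paramRep κ c (.mk W) ≠ 1) (t : ℝ) :
    ∀ᶠ x in 𝓝[≠] t, ∀ S, S <:+ L → ∀ T, T <:+ L →
      paramRep κ c (.mk S) x = paramRep κ c (.mk T) x → S = T := by
  have h1 : ∀ᶠ x in 𝓝[≠] t, ∀ S ∈ L.tails.toFinset, ∀ T ∈ L.tails.toFinset,
      S <:+ T → S ≠ T → paramRep κ c (.mk T) x ≠ paramRep κ c (.mk S) x := by
    refine (eventually_all_finset _).2 fun S _ => (eventually_all_finset _).2 fun T hT => ?_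
    refine eventually_imp_distrib_left.2 fun ⟨W, hW⟩ => eventually_imp_distrib_left.2 fun hST => ?_
    subst hW
    refine eventually_paramRep_ne (h W ?_ ?_) t
    · rintro rfl
      exact hST rfl
    · simp only [List.mem_toFinset, List.mem_tails] at hT
      exact (List.prefix_append W S).isInfix.trans hT.isInfix
  filter_upwards [h1] with x hx S hS T hT hST
  by_contra hne
  have hS' : S ∈ L.tails.toFinset := by simpa using hS
  have hT' : T ∈ L.tails.toFinset := by simpa using hT
  rcases List.suffix_or_suffix_of_suffix hS hT with h2 | h2
  · exact hx S hS' T hT' h2 hne hST.symm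
  · exact hx T hT' S hS' h2 (Ne.symm hne) hST

lemma eventually_paramRep_ne_zero (c : GenParam ι) (w : FreeGroup ι) (t : ℝ) :
    ∀ᶠ x in 𝓝[≠] t, paramRep κ c w x ≠ 0 := by
  have h : ∀ x, paramRep κ c w x = 0 ↔ x = (paramRep κ c w).symm 0 := fun x => by
    rw [OrderIso.eq_symm_apply]
  simp only [ne_eq, h]
  rcases eq_or_ne t ((paramRep κ c w).symm 0) with h1 | h1
  · rw [← h1]; exact self_mem_nhdsWithin
  · exact eventually_ne_nhdsWithin h1

/-- If only the values of generator `i` away from finitely many base points are changed, then the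
trajectory of a point under a word is unchanged. -/
lemma paramRep_eq_of_trajectory {c c₀ : GenParam ι} {i : ι} {L : List (ι × Bool)} {t : ℝ}
    (hj : ∀ j ≠ i, paramGen κ c j = paramGen κ c₀ j)
    (h : ∀ b S, (i, b) :: S <:+ L →
      paramGen κ c i (paramRep κ c₀ (.mk (if b then S else (i, b) :: S)) t) =
      paramGen κ c₀ i (paramRep κ c₀ (.mk (if b then S else (i, b) :: S)) t)) :
    ∀ S, S <:+ L → paramRep κ c (.mk S) t = paramRep κ c₀ (.mk S) t := by
  intro S
  induction S with
  | nil => intro _; rw [paramRep_nil, paramRep_nil]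
  | cons x S ih =>
    intro hS
    have hi := ih ((List.suffix_cons x S).trans hS)
    obtain ⟨j, b⟩ := x
    have hkey : paramGen κ c j (paramRep κ c₀ (.mk (if b then S else (j, b) :: S)) t) =
        paramGen κ c₀ j (paramRep κ c₀ (.mk (if b then S else (j, b) :: S)) t) := by
      rcases eq_or_ne j i with rfl | hji
      · exact h b S hS
      · rw [hj j hji]
    cases b
    · refine (paramGen κ c j).injective ?_
      simp only [Bool.false_eq_true, if_false] at hkey
      rw [hkey, paramGen_paramRep_mk_false, paramGen_paramRep_mk_false, hi]
    · simp only [if_true] at hkey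
      rw [paramRep_mk_true, paramRep_mk_true, hi, hkey]

instance : BaireSpace (GenParam ι) := Metric.isOpen_ball.baireSpace

lemma FreeGroup.IsReduced.of_isInfix {α : Type*} {L W : List (α × Bool)}
    (h : FreeGroup.IsReduced L) (hW : W <:+: L) : FreeGroup.IsReduced W := by
  obtain ⟨s, t, rfl⟩ := hW
  exact (List.IsChain.left_of_append h).right_of_append

/-- Induction on the length. Baire gives a parameter `c₀` in the given open set at which all shorter
reduced words act nontrivially. If `L` acts trivially there, take a point `t` whose trajectory under
the tail `L'` has no repetitions and avoids 0. Changing the generator of the first letter only at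
the base point of the last edge leaves the trajectory under `L'` intact but moves its end, so `t` is
no longer fixed. -/
lemma dense_paramRep_ne_one [DecidableEq ι] (κ : ι → GenKind) (n : ℕ) :
    ∀ L : List (ι × Bool), L.length = n → FreeGroup.IsReduced L → L ≠ [] →
      Dense {c | paramRep κ c (.mk L) ≠ 1} := by
  induction n using Nat.strong_induction_on with
  | _ n ih =>
  rintro L rfl hL hne
  rw [dense_iff_inter_open]
  intro U hU hUne
  have hB : Dense (⋂ W : {W : List (ι × Bool) // W.length < L.length ∧ FreeGroup.IsReduced W ∧
      W ≠ []}, {c | paramRep κ c (.mk W.1) ≠ 1}) :=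
    dense_iInter_of_isOpen (fun W => isOpen_paramRep_ne_one W.1)
      fun W => ih _ W.2.1 W.1 rfl W.2.2.1 W.2.2.2
  obtain ⟨c₀, hc₀U, hc₀⟩ := hB.inter_open_nonempty U hU hUne
  replace hc₀ : ∀ W : List (ι × Bool), W.length < L.length → FreeGroup.IsReduced W → W ≠ [] →
      paramRep κ c₀ (.mk W) ≠ 1 := fun W h1 h2 h3 => mem_iInter.1 hc₀ ⟨W, h1, h2, h3⟩
  by_cases hid : paramRep κ c₀ (.mk L) ≠ 1
  · exact ⟨c₀, hc₀U, hid⟩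
  push Not at hid
  obtain _ | ⟨⟨i, b⟩, L'⟩ := L
  · exact absurd rfl hne
  have hL' : FreeGroup.IsReduced L' := hL.of_isInfix (List.suffix_cons _ _).isInfix
  obtain ⟨t, hinj, h0⟩ := ((eventually_injOn_suffixes (L := L') (fun W hW hWL =>
      hc₀ W (by have := hWL.length_le; simp; omega) (hL'.of_isInfix hWL) hW) 0).and
    ((eventually_all_finset L'.tails.toFinset).2 fun S _ =>
      eventually_paramRep_ne_zero (κ := κ) c₀ (.mk S) 0)).exists
  simp only [List.mem_toFinset, List.mem_tails] at h0
  have hfix : paramRep κ c₀ (.mk ((i, b) :: L')) t = t := by rw [hid]; rfl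
  -- the base point of the last edge of the trajectory
  let B : List (ι × Bool) := if b then L' else []
  have hB : B <:+ L' := by
    simp only [B]; split_ifs
    exacts [List.suffix_rfl, List.nil_suffix]
  -- An edge of an inverse letter is based at its end point. For the last edge this end is `t`
  -- itself, because `L` acts trivially at `c₀`; hence the empty suffix in that case.
  let y := paramRep κ c₀ (.mk B) t
  have hlast : ∀ c, (∀ S, S <:+ L' → paramRep κ c (.mk S) t = paramRep κ c₀ (.mk S) t) →
      paramGen κ c i y ≠ paramGen κ c₀ i y → paramRep κ c (.mk ((i, b) :: L')) ≠ 1 := by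
    intro c hc hy h1
    have h2 : paramRep κ c (.mk ((i, b) :: L')) t = t := by rw [h1]; rfl
    apply hy
    cases b
    · have h3 : y = t := by simp [y, B, paramRep_nil]
      have h4 := paramGen_paramRep_mk_false (κ := κ) c i L' t
      have h5 := paramGen_paramRep_mk_false (κ := κ) c₀ i L' t
      rw [h2] at h4
      rw [hfix] at h5
      rw [h3, h4, h5, hc _ List.suffix_rfl]
    · rw [paramRep_mk_true] at h2 hfix
      rw [hc _ List.suffix_rfl] at h2
      simp only [y, B, if_true]
      rw [h2, hfix]
  obtain ⟨c, hcU, hcj, hcZ, hcy⟩ := exists_perturbation hU hc₀U i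
    (((L'.tails.map fun S => paramRep κ c₀ (.mk S) t).toFinset).erase y)
    (Finset.notMem_erase _ _) (h0 B hB) (κ := κ)
  refine ⟨c, hcU, hlast c (paramRep_eq_of_trajectory hcj fun b' S hS => hcZ _ ?_) hcy⟩
  have hS' : S <:+ L' := (List.suffix_cons _ _).trans hS
  have hbase : (if b' then S else (i, b') :: S) <:+ L' := by split_ifs <;> assumption
  -- No earlier edge of generator `i` is based at `y`. As the trajectory has no repetitions,
  -- equality of base points is equality of suffixes, which cancellation in `L`, a length count, or
  -- a cyclic cancellation excludes.
  refine Finset.mem_erase.2 ⟨fun heq => ?_, ?_⟩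
  · have hEq := hinj _ hbase _ hB heq
    cases b
    · simp only [B, Bool.false_eq_true, if_false] at hEq
      cases b'
      · simp at hEq
      · simp only [if_true] at hEq
        subst hEq
        -- Here `L` is a reduced word of the form `i⁻¹ W i`. It acts trivially only if the shorter
        -- word `W` does, against the choice of `c₀`; an empty `W` would contradict reducedness.
        obtain ⟨W, rfl⟩ := hS
        have hW : W ≠ [] := by
          rintro rfl
          have := (FreeGroup.isReduced_cons_cons.1 hL).1 rfl
          simp at this
        refine hc₀ W (by simp) (hL'.of_isInfix (List.prefix_append _ _).isInfix) hW ?_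
        have h1 : FreeGroup.mk ((i, false) :: (W ++ [(i, true)])) =
            (FreeGroup.of i)⁻¹ * .mk W * .of i := by
          rw [show (FreeGroup.of i)⁻¹ = FreeGroup.mk [(i, false)] from rfl, FreeGroup.of,
            FreeGroup.mul_mk, FreeGroup.mul_mk]
          rfl
        rw [h1, map_mul, map_mul, map_inv, mul_assoc, inv_mul_eq_one] at hid
        exact mul_eq_right.1 hid.symm
    · simp only [B, if_true] at hEq
      cases b'
      · simp only [Bool.false_eq_true, if_false] at hEq
        subst hEq
        have := (FreeGroup.isReduced_cons_cons.1 hL).1 rfl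
        simp at this
      · simp only [if_true] at hEq
        subst hEq
        have := hS.length_le
        simp at this
  · rw [List.mem_toFinset]
    exact List.mem_map.2 ⟨_, by simpa using hbase, rfl⟩

/-- A faithful representation of a free group by tame automorphisms of the line, whose generators
have prescribed types. -/
theorem exists_faithful_tame_rep (κ : ι → GenKind) :
    ∃ r : FreeGroup ι →* (ℝ ≃o ℝ), (∀ w, IsTame (r w)) ∧ (∀ w, w ≠ 1 → r w ≠ 1) ∧
      (∀ i, κ i = .tiny → ∀ t, t < r (.of i) t) ∧
      (∀ i j, κ i = .tiny → κ j = .odd → ∀ t, r (.of i) (r (.of j) t) < r (.of j) (r (.of i) t)) := by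
  classical
  have hB : Dense (⋂ W : {W : List (ι × Bool) // FreeGroup.IsReduced W ∧ W ≠ []},
      {c | paramRep κ c (.mk W.1) ≠ 1}) :=
    dense_iInter_of_isOpen (fun W => isOpen_paramRep_ne_one W.1)
      fun W => dense_paramRep_ne_one κ _ W.1 rfl W.2.1 W.2.2
  have : Nonempty (GenParam ι) := ⟨⟨0, by simp⟩⟩
  obtain ⟨c, hc⟩ := hB.nonempty
  refine ⟨paramRep κ c, isTame_paramRep c, fun w hw => ?_, fun i hi t => ?_, fun i j hi hj t => ?_⟩
  · have h : paramRep κ c (.mk w.toWord) ≠ 1 := mem_iInter.1 hc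
      ⟨w.toWord, FreeGroup.isReduced_toWord, mt FreeGroup.toWord_eq_nil_iff.1 hw⟩
    rwa [FreeGroup.mk_toWord] at h
  · rw [paramRep_of, paramGen]
    simp only [hi]
    exact lt_genIso_tiny _ t
  · simp only [paramRep_of, paramGen]
    simp only [hi, hj]
    exact genIso_tiny_odd_lt _ _ t

end Family

end


open Set Filter Topology

noncomputable section

/-! ### Cocycles and development along maps -/

/-- A locally constant cocycle with values in the discrete group `G`, presented as the coboundary
of (discontinuous) functions `g i` on the sets of an open cover. -/
structure Cocycle (X J G : Type*) [TopologicalSpace X] [Group G] where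
  carrier : J → Set X
  isOpen_carrier : ∀ i, IsOpen (carrier i)
  exists_mem : ∀ x, ∃ i, x ∈ carrier i
  g : J → X → G
  eventually_eq : ∀ i j x, x ∈ carrier i → x ∈ carrier j →
    ∀ᶠ y in 𝓝 x, g j y * (g i y)⁻¹ = g j x * (g i x)⁻¹

namespace Cocycle

variable {X J G : Type*} [TopologicalSpace X] [Group G] (C : Cocycle X J G)

/-- `v` is a horizontal lift of the map `y`: in every chart it is locally constant. -/
def IsDev {Z T : Type*} [TopologicalSpace Z] [MulAction G T] (y : Z → X) (v : Z → T) : Prop :=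
  ∀ z₀ i, y z₀ ∈ C.carrier i → ∀ᶠ z in 𝓝 z₀, C.g i (y z) • v z = C.g i (y z₀) • v z₀

variable {C}

lemma IsDev.comp {Z W T : Type*} [TopologicalSpace Z] [TopologicalSpace W] [MulAction G T]
    {y : Z → X} {v : Z → T} (h : C.IsDev y v) {φ : W → Z} (hφ : Continuous φ) :
    C.IsDev (y ∘ φ) (v ∘ φ) :=
  fun w i hi => hφ.continuousAt.eventually (h (φ w) i hi)

lemma IsDev.mul_const {Z : Type*} [TopologicalSpace Z] {y : Z → X} {v : Z → G} (h : C.IsDev y v)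
    (c : G) : C.IsDev y (fun z => v z * c) := fun z i hi => by
  filter_upwards [h z i hi] with w hw
  simp only [smul_eq_mul, ← mul_assoc] at hw ⊢
  rw [hw]

lemma IsDev.smul_const {Z T : Type*} [TopologicalSpace Z] [MulAction G T] {y : Z → X} {v : Z → G}
    (h : C.IsDev y v) (c : T) : C.IsDev y (fun z => v z • c) := fun z i hi => by
  filter_upwards [h z i hi] with w hw
  rw [← mul_smul, ← mul_smul, ← smul_eq_mul, hw, smul_eq_mul]

lemma IsDev.isLocallyConstant_inv_mul {Z : Type*} [TopologicalSpace Z] {y : Z → X} {v w : Z → G}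
    (hv : C.IsDev y v) (hw : C.IsDev y w) : IsLocallyConstant (fun z => (v z)⁻¹ * w z) := by
  refine (IsLocallyConstant.iff_eventually_eq _).2 fun z => ?_
  obtain ⟨i, hi⟩ := C.exists_mem (y z)
  filter_upwards [hv z i hi, hw z i hi] with x h1 h2
  simp only [smul_eq_mul] at h1 h2
  calc (v x)⁻¹ * w x = (C.g i (y x) * v x)⁻¹ * (C.g i (y x) * w x) := by group
    _ = (v z)⁻¹ * w z := by rw [h1, h2]; group

lemma IsDev.inv_mul_eq {Z : Type*} [TopologicalSpace Z] [PreconnectedSpace Z] {y : Z → X}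
    {v w : Z → G} (hv : C.IsDev y v) (hw : C.IsDev y w) (a b : Z) :
    (v a)⁻¹ * w a = (v b)⁻¹ * w b :=
  (hv.isLocallyConstant_inv_mul hw).apply_eq_of_preconnectedSpace a b

lemma IsDev.eq_of_const {Z : Type*} [TopologicalSpace Z] [PreconnectedSpace Z] {y : Z → X}
    {v : Z → G} (hv : C.IsDev y v) (hy : ∀ a b, y a = y b) (a b : Z) : v a = v b := by
  have h1 : C.IsDev y (fun _ => (1 : G)) := fun z i _ => .of_forall fun x => by rw [hy x z]
  simpa using hv.inv_mul_eq h1 a b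

section Bundle

variable (C) [TopologicalSpace G] [DiscreteTopology G]

/-- The covering space defined by a cocycle. -/
def bundleCore : FiberBundleCore J X G where
  baseSet := C.carrier
  isOpen_baseSet := C.isOpen_carrier
  indexAt x := (C.exists_mem x).choose
  mem_baseSet_at x := (C.exists_mem x).choose_spec
  coordChange i j x v := C.g j x * (C.g i x)⁻¹ * v
  coordChange_self i x _ v := by simp
  continuousOn_coordChange i j := by
    rintro ⟨x, v⟩ ⟨⟨hi, hj⟩, -⟩
    refine ContinuousAt.continuousWithinAt ?_
    have h1 : ∀ᶠ p : X × G in 𝓝 (x, v), C.g j x * (C.g i x)⁻¹ * p.2 =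
        C.g j p.1 * (C.g i p.1)⁻¹ * p.2 := by
      filter_upwards [continuous_fst.continuousAt.eventually (C.eventually_eq i j x hi hj)] with p hp
      rw [hp]
    refine ContinuousAt.congr ?_ h1
    exact ((continuous_of_discreteTopology (f := fun u : G => C.g j x * (C.g i x)⁻¹ * u)).comp
      continuous_snd).continuousAt
  coordChange_comp i j k x _ v := by group

/-- The fibre component of `f z` refers to the preferred chart at its base point, which may jump
with `z`. The factor `g⁻¹` removes this dependence. -/
lemma isDev_of_continuous {Z : Type*} [TopologicalSpace Z] (f : Z → C.bundleCore.TotalSpace)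
    (hf : Continuous f) :
    C.IsDev (fun z => (f z).1)
      (fun z => (C.g (C.bundleCore.indexAt (f z).1) (f z).1)⁻¹ * (show G from (f z).2)) := by
  intro z₀ i hi
  have h1 : ContinuousAt (fun z => (C.bundleCore.localTriv i (f z)).2) z₀ := by
    refine continuous_snd.continuousAt.comp
      (((C.bundleCore.localTriv i).continuousOn.continuousAt ?_).comp hf.continuousAt)
    exact (C.bundleCore.localTriv i).open_source.mem_nhds hi
  have h2 := (ContinuousAt.eventually_mem h1
    ((isOpen_discrete {(C.bundleCore.localTriv i (f z₀)).2}).mem_nhds rfl))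
  filter_upwards [h2] with z hz
  have h3 : C.g i (f z).1 * (C.g (C.bundleCore.indexAt (f z).1) (f z).1)⁻¹ * (show G from (f z).2) =
    C.g i (f z₀).1 * (C.g (C.bundleCore.indexAt (f z₀).1) (f z₀).1)⁻¹ * (show G from (f z₀).2) := hz
  exact (mul_assoc _ _ (show G from (f z).2)).symm.trans
    (h3.trans (mul_assoc _ _ (show G from (f z₀).2)))

end Bundle

variable (C)

/-- The bundle has discrete fibre, so it is a covering, and a map from a simply connected, locally
path-connected space lifts. Right multiplication by a constant normalises the lift at `z₀`. -/
lemma exists_isDev {Z : Type*} [TopologicalSpace Z] [SimplyConnectedSpace Z]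
    [LocallyPathConnectedSpace Z] {y : Z → X} (hy : Continuous y) (z₀ : Z) :
    ∃ v : Z → G, C.IsDev y v ∧ v z₀ = 1 := by
  let : TopologicalSpace G := ⊥
  have : DiscreteTopology G := ⟨rfl⟩
  have hcov : IsCoveringMap (Bundle.TotalSpace.proj : C.bundleCore.TotalSpace → X) :=
    FiberBundle.isCoveringMap
  let e₀ : C.bundleCore.TotalSpace := ⟨y z₀, (1 : G)⟩
  obtain ⟨f, ⟨hf0, hf⟩, -⟩ := hcov.existsUnique_continuousMap_lifts ⟨y, hy⟩ z₀ e₀ rfl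
  have h1 := C.isDev_of_continuous f f.continuous
  have h2 : (fun z => (f z).1) = y := hf
  rw [h2] at h1
  have h3 := h1.mul_const ((C.g (C.bundleCore.indexAt (f z₀).1) (f z₀).1)⁻¹ *
    (show G from (f z₀).2))⁻¹
  exact ⟨_, h3, mul_inv_cancel _⟩

/-! ### Holonomy -/

lemma exists_isDev_path {x y : X} (γ : Path x y) : ∃ v : unitInterval → G, C.IsDev γ v ∧ v 0 = 1 := by
  obtain ⟨v, hv, hv0⟩ := C.exists_isDev γ.continuous_extend 0
  refine ⟨v ∘ Subtype.val, ?_, hv0⟩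
  have := hv.comp (φ := (Subtype.val : unitInterval → ℝ)) continuous_subtype_val
  rwa [show γ.extend ∘ Subtype.val = γ from funext fun t => γ.extend_apply t.2] at this

/-- The holonomy of a cocycle along a path. -/
def pathHol {x y : X} (γ : Path x y) : G := (C.exists_isDev_path γ).choose 1

variable {C}

lemma IsDev.eq_pathHol_mul {x y : X} {γ : Path x y} {v : unitInterval → G} (h : C.IsDev γ v) :
    v 1 = C.pathHol γ * v 0 := by
  obtain ⟨hw, hw0⟩ := (C.exists_isDev_path γ).choose_spec
  have h1 := hw.inv_mul_eq h 0 1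
  rw [hw0, inv_one, one_mul] at h1
  rw [h1, pathHol]; group

/-- The whole homotopy is developed at once, extended to the plane by clamping both variables. On
the sides where the homotopy stands still the development is constant, which compares the values at
the ends of the two paths. -/
lemma pathHol_eq_of_homotopic {x y : X} {γ γ' : Path x y} (h : γ.Homotopic γ') :
    C.pathHol γ = C.pathHol γ' := by
  obtain ⟨F⟩ := h
  let pr : ℝ → unitInterval := projIcc 0 1 zero_le_one
  have hpr : Continuous pr := continuous_projIcc
  have hpr' : ∀ t : unitInterval, pr t = t := fun t => projIcc_val _ t
  obtain ⟨v, hv, -⟩ := C.exists_isDev (y := fun p : ℝ × ℝ => F (pr p.1, pr p.2))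
    (by fun_prop) (0, 0)
  have h0 : C.IsDev γ (fun t : unitInterval => v (0, t)) := by
    have := hv.comp (φ := fun t : unitInterval => ((0 : ℝ), (t : ℝ))) (by fun_prop)
    convert! this using 1
    ext t
    simp only [Function.comp]
    rw [hpr', show pr 0 = 0 from hpr' 0, F.apply_zero]; rfl
  have h1 : C.IsDev γ' (fun t : unitInterval => v (1, t)) := by
    have := hv.comp (φ := fun t : unitInterval => ((1 : ℝ), (t : ℝ))) (by fun_prop)
    convert! this using 1
    ext t
    simp only [Function.comp]
    rw [hpr', show pr 1 = 1 from hpr' 1, F.apply_one]; rfl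
  have h2 : v (0, 0) = v (1, 0) :=
    (hv.comp (φ := fun s : ℝ => (s, (0 : ℝ))) (by fun_prop)).eq_of_const (fun a b => by
      simp only [Function.comp, show pr 0 = 0 from hpr' 0, F.source]) 0 1
  have h3 : v (0, 1) = v (1, 1) :=
    (hv.comp (φ := fun s : ℝ => (s, (1 : ℝ))) (by fun_prop)).eq_of_const (fun a b => by
      simp only [Function.comp, show pr 1 = 1 from hpr' 1, F.target]) 0 1
  have h4 := h0.eq_pathHol_mul
  have h5 := h1.eq_pathHol_mul
  simp only [Icc.coe_one, Icc.coe_zero] at h4 h5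
  rw [← h2, ← h3, h4] at h5
  exact mul_right_cancel h5

lemma pathHol_trans {x y z : X} (γ : Path x y) (δ : Path y z) :
    C.pathHol (γ.trans δ) = C.pathHol δ * C.pathHol γ := by
  obtain ⟨v, hv, hv0⟩ := C.exists_isDev_path (γ.trans δ)
  let φ : unitInterval → unitInterval := fun t => ⟨t / 2, by
    constructor <;> linarith [t.2.1, t.2.2]⟩
  let ψ : unitInterval → unitInterval := fun t => ⟨(1 + t) / 2, by
    constructor <;> linarith [t.2.1, t.2.2]⟩
  have h1 : C.IsDev γ (v ∘ φ) := by
    have := hv.comp (φ := φ) (by fun_prop)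
    convert! this using 1
    ext t
    simp only [Function.comp, Path.trans_apply, φ]
    rw [dif_pos (by linarith [t.2.2])]
    congr 1; ext; simp; ring
  have h2 : C.IsDev δ (v ∘ ψ) := by
    have := hv.comp (φ := ψ) (by fun_prop)
    convert! this using 1
    ext t
    simp only [Function.comp, Path.trans_apply, ψ]
    split_ifs with h
    · have ht : t = 0 := Subtype.ext (by simpa using le_antisymm (by linarith) t.2.1)
      subst ht
      simp
    · congr 1; ext; simp; ring
  have e1 := h1.eq_pathHol_mul
  have e2 := h2.eq_pathHol_mul
  have e3 := hv.eq_pathHol_mul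
  have a1 : φ 0 = 0 := by ext; simp [φ]
  have a2 : φ 1 = ψ 0 := by ext; simp [φ, ψ]
  have a3 : ψ 1 = 1 := by ext; simp [ψ]
  simp only [Function.comp] at e1 e2
  rw [a3, ← a2, e1, a1, hv0, e3, hv0, mul_one, mul_one] at e2
  exact e2

lemma pathHol_refl (x : X) : C.pathHol (Path.refl x) = 1 := by
  obtain ⟨v, hv, hv0⟩ := C.exists_isDev_path (Path.refl x)
  have h1 := hv.eq_pathHol_mul
  rw [hv0, mul_one] at h1
  rw [← h1, ← hv0]
  exact hv.eq_of_const (fun _ _ => rfl) 1 0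

lemma pathHol_symm {x y : X} (γ : Path x y) : C.pathHol γ.symm = (C.pathHol γ)⁻¹ := by
  rw [eq_inv_iff_mul_eq_one, ← pathHol_trans, ← pathHol_refl x]
  exact pathHol_eq_of_homotopic (Path.Homotopic.trans_symm γ)

variable (C)

/-- The holonomy representation of a cocycle. -/
def hol (x₀ : X) : FundamentalGroup X x₀ →* G :=
  MonoidHom.mk' (fun p => Quotient.lift (s := Path.Homotopic.setoid x₀ x₀) C.pathHol
    (fun _ _ h => pathHol_eq_of_homotopic h) (FundamentalGroup.toPath p)) (by
      -- As endomorphisms in the fundamental groupoid compose, a product runs through its second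
      -- factor first. This matches the order reversal in `pathHol_trans`.
      rintro ⟨p⟩ ⟨q⟩
      exact pathHol_trans q p)

end Cocycle

end


open Set Filter Topology

noncomputable section

open CategoryTheory

/-! ### Homotopy classes of paths inside a simply connected set -/

section PathClass

variable {X : Type*} [TopologicalSpace X] {S S' T : Set X} {x y z : X}

/-- The class of the paths from `x` to `y` in the simply connected set `S`. -/
def pathClass (hS : IsSimplyConnected S) (hx : x ∈ S) (hy : y ∈ S) :
    FundamentalGroupoid.mk x ⟶ FundamentalGroupoid.mk y :=
  Path.Homotopic.Quotient.mk (hS.isPathConnected.joinedIn x hx y hy).somePath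

lemma IsSimplyConnected.homotopic (hS : IsSimplyConnected S) (p q : Path x y) (hp : ∀ t, p t ∈ S)
    (hq : ∀ t, q t ∈ S) : p.Homotopic q := by
  have : SimplyConnectedSpace S := hS
  have hx : x ∈ S := by simpa using hp 0
  have hy : y ∈ S := by simpa using hp 1
  let p' : Path (⟨x, hx⟩ : S) ⟨y, hy⟩ :=
    { toFun := fun t => ⟨p t, hp t⟩
      source' := Subtype.ext p.source
      target' := Subtype.ext p.target }
  let q' : Path (⟨x, hx⟩ : S) ⟨y, hy⟩ :=
    { toFun := fun t => ⟨q t, hq t⟩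
      source' := Subtype.ext q.source
      target' := Subtype.ext q.target }
  exact (SimplyConnectedSpace.paths_homotopic p' q').map ⟨Subtype.val, continuous_subtype_val⟩

lemma mk_eq_pathClass (hS : IsSimplyConnected S) (hx : x ∈ S) (hy : y ∈ S) (p : Path x y)
    (hp : ∀ t, p t ∈ S) : Path.Homotopic.Quotient.mk p = pathClass hS hx hy :=
  Path.Homotopic.Quotient.eq.2 (hS.homotopic p _ hp (JoinedIn.somePath_mem _))

lemma pathClass_comp (hS : IsSimplyConnected S) (hx : x ∈ S) (hy : y ∈ S) (hz : z ∈ S) :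
    pathClass hS hx hy ≫ pathClass hS hy hz = pathClass hS hx hz := by
  have h1 := JoinedIn.somePath_mem (hS.isPathConnected.joinedIn x hx y hy)
  have h2 := JoinedIn.somePath_mem (hS.isPathConnected.joinedIn y hy z hz)
  refine mk_eq_pathClass hS hx hz (((hS.isPathConnected.joinedIn x hx y hy).somePath).trans
    ((hS.isPathConnected.joinedIn y hy z hz).somePath)) fun t => ?_
  rw [Path.trans_apply]
  split_ifs
  exacts [h1 _, h2 _]

/-- A path inside `T` represents both classes, so `T` only has to be path-connected. -/
lemma pathClass_eq_pathClass (hT : IsPathConnected T) (hS : IsSimplyConnected S)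
    (hS' : IsSimplyConnected S') (hTS : T ⊆ S) (hTS' : T ⊆ S') (hx : x ∈ T) (hy : y ∈ T) :
    pathClass hS (hTS hx) (hTS hy) = pathClass hS' (hTS' hx) (hTS' hy) := by
  have h := JoinedIn.somePath_mem (hT.joinedIn x hx y hy)
  rw [← mk_eq_pathClass hS (hTS hx) (hTS hy) (hT.joinedIn x hx y hy).somePath fun t => hTS (h t),
    ← mk_eq_pathClass hS' (hTS' hx) (hTS' hy) (hT.joinedIn x hx y hy).somePath fun t => hTS' (h t)]

end PathClass

/-! ### Spaces obtained from a simply connected open set by attaching handles -/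

/-- An open cover of `X` by a simply connected set `P` and disjoint simply connected sets `N k`
(the handles), each of which meets `P` in two disjoint path-connected sets `A k` and `B k`. -/
structure HandleCover (X ι : Type*) [TopologicalSpace X] where
  P : Set X
  N : ι → Set X
  A : ι → Set X
  B : ι → Set X
  isOpen_P : IsOpen P
  isOpen_N : ∀ k, IsOpen (N k)
  isOpen_A : ∀ k, IsOpen (A k)
  isOpen_B : ∀ k, IsOpen (B k)
  simplyConnected_P : IsSimplyConnected P
  simplyConnected_N : ∀ k, IsSimplyConnected (N k)
  pathConnected_A : ∀ k, IsPathConnected (A k)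
  pathConnected_B : ∀ k, IsPathConnected (B k)
  disjoint_A_B : ∀ k, Disjoint (A k) (B k)
  N_inter_P : ∀ k, N k ∩ P = A k ∪ B k
  disjoint_N : ∀ k l, k ≠ l → Disjoint (N k) (N l)
  cover : ∀ x, x ∈ P ∨ ∃ k, x ∈ N k

namespace HandleCover

variable {X ι : Type*} [TopologicalSpace X] (H : HandleCover X ι)

open Classical in
/-- The transition function of the handle `k`. -/
def trans (k : ι) (x : X) : FreeGroup ι := if x ∈ H.B k then .of k else 1

variable {H}

lemma A_subset (k : ι) : H.A k ⊆ H.N k ∩ H.P := H.N_inter_P k ▸ subset_union_left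

lemma B_subset (k : ι) : H.B k ⊆ H.N k ∩ H.P := H.N_inter_P k ▸ subset_union_right

lemma trans_of_mem_A {k : ι} {x : X} (hx : x ∈ H.A k) : H.trans k x = 1 :=
  if_neg fun h => (H.disjoint_A_B k).le_bot ⟨hx, h⟩

lemma trans_of_mem_B {k : ι} {x : X} (hx : x ∈ H.B k) : H.trans k x = .of k := if_pos hx

lemma trans_of_notMem {k : ι} {x : X} (hx : x ∉ H.P) : H.trans k x = 1 :=
  if_neg fun h => hx (H.B_subset k h).2

lemma eventually_trans_eq {k : ι} {x : X} (hN : x ∈ H.N k) (hP : x ∈ H.P) :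
    ∀ᶠ y in 𝓝 x, H.trans k y = H.trans k x := by
  have h : x ∈ H.A k ∪ H.B k := H.N_inter_P k ▸ ⟨hN, hP⟩
  rcases h with h | h
  · filter_upwards [(H.isOpen_A k).mem_nhds h] with y hy
    rw [trans_of_mem_A hy, trans_of_mem_A h]
  · filter_upwards [(H.isOpen_B k).mem_nhds h] with y hy
    rw [trans_of_mem_B hy, trans_of_mem_B h]

variable (H)

/-- The tautological cocycle of a handle cover with values in the free group on the handles. -/
def cocycle : Cocycle X (Option ι) (FreeGroup ι) where
  carrier i := i.elim H.P H.N
  isOpen_carrier i := by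
    cases i
    exacts [H.isOpen_P, H.isOpen_N _]
  exists_mem x := by
    rcases H.cover x with h | ⟨k, h⟩
    exacts [⟨none, h⟩, ⟨some k, h⟩]
  g i := i.elim 1 H.trans
  eventually_eq i j x hi hj := by
    rcases i with _ | k <;> rcases j with _ | l
    · exact .of_forall fun y => rfl
    · filter_upwards [eventually_trans_eq hj hi] with y hy
      simp [hy]
    · filter_upwards [eventually_trans_eq hi hj] with y hy
      simp [hy]
    · obtain rfl : k = l := by
        by_contra h
        exact (H.disjoint_N k l h).le_bot ⟨hi, hj⟩
      simp

variable {o : X} (ho : o ∈ H.P)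

/-- A point of `A k`. -/
def ptA (k : ι) : X := (H.pathConnected_A k).nonempty.some

/-- A point of `B k`. -/
def ptB (k : ι) : X := (H.pathConnected_B k).nonempty.some

lemma ptA_mem (k : ι) : H.ptA k ∈ H.A k := (H.pathConnected_A k).nonempty.some_mem

lemma ptB_mem (k : ι) : H.ptB k ∈ H.B k := (H.pathConnected_B k).nonempty.some_mem

/-- The class of the paths that lead from a point of the handle `k` to `o` through `A k`. -/
def viaA (k : ι) {y : X} (hy : y ∈ H.N k) : FundamentalGroupoid.mk y ⟶ FundamentalGroupoid.mk o :=
  pathClass (H.simplyConnected_N k) hy (H.A_subset k (H.ptA_mem k)).1 ≫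
    pathClass H.simplyConnected_P (H.A_subset k (H.ptA_mem k)).2 ho

/-- The loop at `o` that runs through the handle `k` from `B k` to `A k`. -/
def handleLoop (k : ι) : FundamentalGroup X o :=
  pathClass H.simplyConnected_P ho (H.B_subset k (H.ptB_mem k)).2 ≫
    H.viaA ho k (H.B_subset k (H.ptB_mem k)).1

/-- The homomorphism from the free group on the handles to the fundamental group. -/
def handleHom : FreeGroup ι →* FundamentalGroup X o := FreeGroup.lift (H.handleLoop ho)

open Classical in
/-- A chosen class of paths from any point to `o`. -/
def toBase (y : X) : FundamentalGroupoid.mk y ⟶ FundamentalGroupoid.mk o :=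
  if hP : y ∈ H.P then pathClass H.simplyConnected_P hP ho
  else H.viaA ho _ ((H.cover y).resolve_left hP).choose_spec

variable {H ho}

lemma toBase_of_mem {y : X} (hP : y ∈ H.P) :
    H.toBase ho y = pathClass H.simplyConnected_P hP ho := dif_pos hP

/-- Leaving the handle through `A k` agrees with the chosen way to the base point except on `B k`,
where the two differ by the handle loop. The transition function records exactly this. -/
lemma viaA_eq (k : ι) {y : X} (hy : y ∈ H.N k) :
    H.viaA ho k hy = H.toBase ho y ≫ H.handleHom ho (H.trans k y) := by
  by_cases hP : y ∈ H.P
  · rw [toBase_of_mem hP]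
    have h : y ∈ H.A k ∪ H.B k := H.N_inter_P k ▸ ⟨hy, hP⟩
    rcases h with h | h
    · rw [trans_of_mem_A h, map_one, End.one_def, Category.comp_id, viaA,
        pathClass_eq_pathClass (H.pathConnected_A k) (H.simplyConnected_N k) H.simplyConnected_P
          (fun _ h => (A_subset k h).1) (fun _ h => (A_subset k h).2) h (H.ptA_mem k),
        pathClass_comp]
    · rw [trans_of_mem_B h, handleHom, FreeGroup.lift_apply_of, handleLoop, ← Category.assoc,
        pathClass_comp,
        ← pathClass_eq_pathClass (H.pathConnected_B k) (H.simplyConnected_N k) H.simplyConnected_P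
          (fun _ h => (B_subset k h).1) (fun _ h => (B_subset k h).2) h (H.ptB_mem k), viaA, viaA,
        ← Category.assoc, pathClass_comp]
  · rw [trans_of_notMem hP, map_one, End.one_def, Category.comp_id, toBase, dif_neg hP]
    have key : ∀ l (hl : y ∈ H.N l), H.viaA ho k hy = H.viaA ho l hl := fun l hl => by
      obtain rfl : l = k := by
        by_contra h
        exact (H.disjoint_N l k h).le_bot ⟨hl, hy⟩
      rfl
    exact key _ _

lemma viaA_eq_comp (k : ι) {y y' : X} (hy : y ∈ H.N k) (hy' : y' ∈ H.N k) :
    H.viaA ho k hy = pathClass (H.simplyConnected_N k) hy hy' ≫ H.viaA ho k hy' := by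
  rw [viaA, viaA, ← Category.assoc, pathClass_comp]

/-- In every chart, parallel transport to the base point is given by the cocycle. -/
lemma mk_comp_toBase_of_chart {i : Option ι} {x y : X} (p : Path x y)
    (hp : ∀ t, p t ∈ H.cocycle.carrier i) :
    H.toBase ho x ≫ H.handleHom ho (H.cocycle.g i x) =
      Path.Homotopic.Quotient.mk p ≫ H.toBase ho y ≫ H.handleHom ho (H.cocycle.g i y) := by
  have hx : x ∈ H.cocycle.carrier i := by simpa using hp 0
  have hy : y ∈ H.cocycle.carrier i := by simpa using hp 1
  rcases i with _ | k
  · have hx : x ∈ H.P := hx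
    have hy : y ∈ H.P := hy
    change _ ≫ H.handleHom ho 1 = _ ≫ _ ≫ H.handleHom ho 1
    rw [map_one, End.one_def, Category.comp_id, Category.comp_id, toBase_of_mem hx,
      toBase_of_mem hy, mk_eq_pathClass H.simplyConnected_P hx hy p hp, pathClass_comp]
  · have hx : x ∈ H.N k := hx
    have hy : y ∈ H.N k := hy
    change _ ≫ H.handleHom ho (H.trans k x) = _ ≫ _ ≫ H.handleHom ho (H.trans k y)
    rw [← viaA_eq k hx, ← viaA_eq k hy, mk_eq_pathClass (H.simplyConnected_N k) hx hy p hp]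
    exact viaA_eq_comp k hx hy

lemma handleHom_mul (a b : FreeGroup ι) :
    H.handleHom ho (a * b) = H.handleHom ho b ≫ H.handleHom ho a := map_mul _ _ _

/-- Follow `γ` up to time `t`, go to the base point and undo the holonomy accumulated so far. Within
each chart the resulting class does not change with `t`, so by connectedness it agrees at both ends.
-/
lemma toBase_eq {x y : X} (γ : Path x y) :
    H.toBase ho x = Path.Homotopic.Quotient.mk γ ≫ H.toBase ho y ≫
      H.handleHom ho (H.cocycle.pathHol γ)⁻¹ := by
  -- With the end points equal to `f 0` and `f 1` by definition, the classes of the subpaths have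
  -- the right types.
  obtain ⟨f, rfl, rfl⟩ := γ
  set γ : Path (f 0) (f 1) := ⟨f, rfl, rfl⟩
  obtain ⟨v, hv, hv0⟩ := H.cocycle.exists_isDev_path γ
  let S : unitInterval → (FundamentalGroupoid.mk (f 0) ⟶ FundamentalGroupoid.mk o) := fun t =>
    Path.Homotopic.Quotient.mk (γ.subpath 0 t) ≫ H.toBase ho (γ t) ≫ H.handleHom ho (v t)⁻¹
  have hS : IsLocallyConstant S := by
    refine (IsLocallyConstant.iff_eventually_eq _).2 fun t₀ => ?_
    obtain ⟨i, hi⟩ := H.cocycle.exists_mem (γ t₀)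
    have h1 : ∀ᶠ t in 𝓝 t₀, uIcc t₀ t ⊆ γ ⁻¹' H.cocycle.carrier i := by
      have h2 : Tendsto (fun t => uIcc t₀ t) (𝓝 t₀) (𝓝 t₀).smallSets :=
        tendsto_const_nhds.uIcc tendsto_id
      exact (tendsto_smallSets_iff.1 h2) _
        (((H.cocycle.isOpen_carrier i).preimage γ.continuous).mem_nhds hi)
    filter_upwards [h1, hv t₀ i hi] with t ht hvt
    have h3 : ∀ s, v s = (H.cocycle.g i (γ s))⁻¹ * (H.cocycle.g i (γ s) • v s) := fun s => by
      rw [smul_eq_mul]; group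
    have h4 : ∀ s, (v s)⁻¹ = (H.cocycle.g i (γ s) • v s)⁻¹ * H.cocycle.g i (γ s) := fun s => by
      rw [smul_eq_mul]; group
    have h5 : Path.Homotopic.Quotient.mk (γ.subpath 0 t) =
        (Path.Homotopic.Quotient.mk (γ.subpath 0 t₀)).trans
          (Path.Homotopic.Quotient.mk (γ.subpath t₀ t)) :=
      (Path.Homotopic.Quotient.eq.2 ⟨Path.Homotopy.subpathTransSubpath γ 0 t₀ t⟩).symm
    have h6 := mk_comp_toBase_of_chart (ho := ho) (γ.subpath t₀ t) (i := i) (fun s =>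
      have h7 : γ.subpath t₀ t s ∈ γ '' uIcc t₀ t := by
        rw [← Path.range_subpath]; exact mem_range_self s
      image_subset_iff.2 ht h7)
    simp only [S]
    rw [h4 t, h4 t₀, hvt, handleHom_mul, handleHom_mul, h5]
    change (_ ≫ _) ≫ _ = _
    rw [Category.assoc]
    refine congrArg _ ?_
    rw [← Category.assoc (H.toBase ho (γ t₀)), h6]
    simp only [Category.assoc]
  have h0 : S 0 = H.toBase ho (f 0) := by
    have e : H.handleHom ho (v 0)⁻¹ = 𝟙 _ := by rw [hv0, inv_one, map_one, End.one_def]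
    simp only [S]
    rw [e, Category.comp_id, Path.subpath_self]
    exact Category.id_comp _
  have h1 : S 1 = Path.Homotopic.Quotient.mk γ ≫ H.toBase ho (f 1) ≫
      H.handleHom ho (H.cocycle.pathHol γ)⁻¹ := by
    simp only [S]
    rw [hv.eq_pathHol_mul, hv0, mul_one, Path.subpath_zero_one]
    rfl
  exact h0.symm.trans ((hS.apply_eq_of_preconnectedSpace 0 1).trans h1)

/-- For a loop with trivial holonomy `toBase_eq` expresses `toBase` as the loop followed by
`toBase`, and cancellation shows the loop trivial. Neither surjectivity nor van Kampen's theorem is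
needed. -/
lemma hol_injective (x₀ : X) : Function.Injective (H.cocycle.hol x₀) := by
  rw [injective_iff_map_eq_one]
  rintro ⟨γ⟩ hγ
  have hγ' : H.cocycle.pathHol γ = 1 := hγ
  have h := toBase_eq (ho := (H.simplyConnected_P.isPathConnected.nonempty.some_mem)) γ
  rw [hγ', inv_one, map_one, End.one_def, Category.comp_id] at h
  refine (cancel_mono (H.toBase _ x₀)).1 (h.symm.trans (Category.id_comp _).symm)

end HandleCover

end


open Set Filter Topology

noncomputable section

/-! ### Development around a puncture -/

/-- The left half-plane. -/
abbrev LeftHalfPlane : Type := {w : ℂ // w.re < 0}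

/-- The exponential map as a universal covering of the punctured disc. -/
def expDisc (w : LeftHalfPlane) : PuncturedDisc :=
  ⟨Complex.exp w, by
    rw [Complex.norm_exp]
    exact ⟨Real.exp_pos _, Real.exp_lt_one_iff.2 w.2⟩⟩

lemma continuous_expDisc : Continuous expDisc :=
  (Complex.continuous_exp.comp continuous_subtype_val).subtype_mk _

/-- The principal logarithm on the punctured disc. -/
def logDisc (z : PuncturedDisc) : LeftHalfPlane :=
  ⟨Complex.log z, by
    rw [Complex.log_re]
    exact Real.log_neg z.2.1 z.2.2⟩

lemma expDisc_logDisc (z : PuncturedDisc) : expDisc (logDisc z) = z :=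
  Subtype.ext (Complex.exp_log (norm_pos_iff.1 z.2.1))

lemma eventually_nhds_of_expDisc {P : PuncturedDisc → Prop} {w : LeftHalfPlane}
    (h : ∀ᶠ x in 𝓝 w, P (expDisc x)) : ∀ᶠ z in 𝓝 (expDisc w), P z := by
  have hopen : IsOpen {w : ℂ | w.re < 0} := isOpen_lt Complex.continuous_re continuous_const
  have h1 := Complex.isOpenMap_exp.image_mem_nhds
    (hopen.isOpenEmbedding_subtypeVal.isOpenMap.image_mem_nhds h)
  have h2 : ContinuousAt (Subtype.val : PuncturedDisc → ℂ) (expDisc w) :=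
    continuous_subtype_val.continuousAt
  filter_upwards [h2.preimage_mem_nhds h1] with z hz
  obtain ⟨_, ⟨x, hx, rfl⟩, hxz⟩ := hz
  have : expDisc x = z := Subtype.ext hxz
  exact this ▸ hx

instance : SimplyConnectedSpace LeftHalfPlane := by
  have hc : Convex ℝ {w : ℂ | w.re < 0} := convex_halfSpace_re_lt 0
  have := hc.contractibleSpace ⟨-1, by simp⟩
  exact SimplyConnectedSpace.ofContractible {w : ℂ | w.re < 0}

instance : LocallyPathConnectedSpace LeftHalfPlane :=
  (isOpen_lt Complex.continuous_re continuous_const :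
    IsOpen {w : ℂ | w.re < 0}).locallyPathConnectedSpace

/-- The deck transformations of `expDisc`. -/
def deckShift (n : ℤ) (w : LeftHalfPlane) : LeftHalfPlane :=
  ⟨w + n * (2 * Real.pi * Complex.I), by simpa using w.2⟩

lemma continuous_deckShift (n : ℤ) : Continuous (deckShift n) := by
  unfold deckShift; fun_prop

lemma expDisc_deckShift (n : ℤ) (w : LeftHalfPlane) : expDisc (deckShift n w) = expDisc w :=
  Subtype.ext (Complex.exp_periodic.int_mul n w)

lemma exists_deckShift {w w' : LeftHalfPlane} (h : expDisc w = expDisc w') :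
    ∃ n, w = deckShift n w' := by
  obtain ⟨n, hn⟩ := Complex.exp_eq_exp_iff_exists_int.1 (congrArg Subtype.val h)
  exact ⟨n, Subtype.ext hn⟩

lemma deckShift_add_one (n : ℤ) (w : LeftHalfPlane) :
    deckShift (n + 1) w = deckShift 1 (deckShift n w) := by
  ext; simp [deckShift]; ring

namespace Cocycle

variable {X J G T : Type*} [TopologicalSpace X] [Group G] [MulAction G T] (C : Cocycle X J G)

/-- If the holonomy around a puncture has a fixed point, then there is a horizontal section over a
punctured neighbourhood. -/
lemma exists_isDev_of_fixed {e : PuncturedDisc → X} (he : Continuous e) {x₀ y : X} (δ : Path x₀ y)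
    (c : Path y y) (hc : ∀ t : unitInterval, c t = e (circlePoint t)) {p : T}
    (hp : C.pathHol ((δ.trans c).trans δ.symm) • p = p) :
    ∃ s : PuncturedDisc → T, C.IsDev e s := by
  have hr : ∀ t : ℝ, (Complex.log (1 / 2 : ℝ) + t * (2 * Real.pi * Complex.I)).re < 0 := fun t => by
    have : Real.log (1 / 2) < 0 := Real.log_neg (by norm_num) (by norm_num)
    simp only [Complex.add_re, Complex.log_ofReal_re, Complex.mul_re, Complex.mul_im,
      Complex.ofReal_re, Complex.ofReal_im, Complex.I_re, Complex.I_im]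
    norm_num at this ⊢
    exact this
  let ℓ : ℝ → LeftHalfPlane := fun t => ⟨_, hr t⟩
  have hℓ : Continuous ℓ := by
    refine Continuous.subtype_mk ?_ _
    fun_prop
  have hℓc : ∀ t : ℝ, expDisc (ℓ t) = circlePoint t := fun t => Subtype.ext <| by
    simp only [expDisc, ℓ, circlePoint]
    rw [Complex.exp_add, Complex.exp_log (by norm_num)]
    congr 2
    push_cast
    ring
  have hℓ1 : ℓ 1 = deckShift 1 (ℓ 0) := by
    ext; simp [ℓ, deckShift]
  obtain ⟨v, hv, hv0⟩ := C.exists_isDev (he.comp continuous_expDisc) (ℓ 0)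
  have hshift : C.IsDev (e ∘ expDisc) (v ∘ deckShift 1) := by
    have := hv.comp (continuous_deckShift 1)
    rwa [show (e ∘ expDisc) ∘ deckShift 1 = e ∘ expDisc from
      funext fun w => congrArg e (expDisc_deckShift 1 w)] at this
  -- Precomposition with the deck transformation gives another development of the same map. The two
  -- differ by a constant right factor, found by evaluation at `ℓ 0`, where `v` is 1.
  have hh : ∀ w, v (deckShift 1 w) = v w * v (ℓ 1) := fun w => by
    have h1 := hv.inv_mul_eq hshift w (ℓ 0)
    rw [hv0, inv_one, one_mul, Function.comp, Function.comp, ← hℓ1, inv_mul_eq_iff_eq_mul] at h1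
    exact h1
  have hhol : v (ℓ 1) = C.pathHol c := by
    have h1 : C.IsDev c (fun t : unitInterval => v (ℓ t)) := by
      have h := hv.comp (hℓ.comp continuous_subtype_val :
        Continuous (ℓ ∘ (Subtype.val : unitInterval → ℝ)))
      rwa [show (e ∘ expDisc) ∘ ℓ ∘ Subtype.val = c from funext fun t => by
        simp only [Function.comp, hℓc, hc]] at h
    have h2 := h1.eq_pathHol_mul
    simpa [hv0] using h2
  set q := C.pathHol δ • p with hq
  have hfix : v (ℓ 1) • q = q := by
    rw [pathHol_trans, pathHol_trans, pathHol_symm, mul_smul, mul_smul, inv_smul_eq_iff] at hp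
    rw [hhol, hq, hp]
  have hinv1 : ∀ w, v (deckShift 1 w) • q = v w • q := fun w => by rw [hh, mul_smul, hfix]
  have hinv : ∀ (n : ℤ) w, v (deckShift n w) • q = v w • q := by
    intro n w
    induction n with
    | zero => congr 2; ext; simp [deckShift]
    | succ n ih => rw [deckShift_add_one, hinv1, ih]
    | pred n ih =>
      rw [← ih, ← hinv1 (deckShift (-n - 1) w), ← deckShift_add_one]
      congr 3; ring
  -- The principal logarithm jumps, but the jump is a deck transformation, under which `v w • q` is
  -- invariant. The section is therefore locally the one on the half-plane.
  have hsec : ∀ w, v (logDisc (expDisc w)) • q = v w • q := fun w => by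
    obtain ⟨n, hn⟩ := exists_deckShift (expDisc_logDisc (expDisc w))
    rw [hn, hinv]
  refine ⟨fun z => v (logDisc z) • q, fun z i hi => ?_⟩
  obtain ⟨w, rfl⟩ : ∃ w, expDisc w = z := ⟨_, expDisc_logDisc z⟩
  refine eventually_nhds_of_expDisc ?_
  filter_upwards [(hv.smul_const q) w i hi] with x hx
  rw [hsec, hsec]
  exact hx

end Cocycle

end


open Set Filter Topology

noncomputable section

/-! ### The punctured surface as a quotient of the disc -/

lemma partnerSide_lt {g n k : ℕ} (hk : k < sideCount g n) : partnerSide g k < sideCount g n := by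
  unfold partnerSide sideCount at *
  split_ifs <;> omega

lemma partnerSide_partnerSide (g k : ℕ) :
    partnerSide g (partnerSide g k) = k := by
  unfold partnerSide
  split_ifs <;> omega

lemma partnerSide_ne (g k : ℕ) : partnerSide g k ≠ k := by
  unfold partnerSide
  split_ifs <;> omega

lemma norm_sidePoint (m k : ℕ) (s : ℝ) : ‖sidePoint m k s‖ = 1 := by
  rw [sidePoint, show 2 * Real.pi * Complex.I * ((k + s) / m) =
    ((2 * Real.pi * ((k + s) / m) : ℝ) : ℂ) * Complex.I by push_cast; ring]
  exact Complex.norm_exp_ofReal_mul_I _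

/-- The `m`-th power forgets the side and sends exactly the vertices to 1. It serves throughout to
separate vertices from other points and to measure nearness to them. -/
lemma sidePoint_pow {m : ℕ} (hm : 0 < m) (k : ℕ) (s : ℝ) :
    sidePoint m k s ^ m = Complex.exp (2 * Real.pi * Complex.I * s) := by
  have hm' : (m : ℂ) ≠ 0 := by exact_mod_cast hm.ne'
  rw [sidePoint, ← Complex.exp_nat_mul, show (m : ℂ) * (2 * Real.pi * Complex.I * ((k + s) / m)) =
    2 * Real.pi * Complex.I * s + k * (2 * Real.pi * Complex.I) by field_simp; ring]
  exact Complex.exp_periodic.nat_mul k _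

lemma sidePoint_pow_ne_one {m : ℕ} (hm : 0 < m) (k : ℕ) {s : ℝ} (hs : s ∈ Ioo (0 : ℝ) 1) :
    sidePoint m k s ^ m ≠ 1 := by
  rw [sidePoint_pow hm, Ne, Complex.exp_eq_one_iff]
  rintro ⟨N, hN⟩
  have h1 : (s : ℂ) = N := by
    have := Complex.two_pi_I_ne_zero
    rw [mul_comm] at hN
    exact mul_right_cancel₀ this hN
  have h2 : s = N := by exact_mod_cast h1
  obtain ⟨h3, h4⟩ := hs
  rw [h2] at h3 h4
  have h5 : 0 < N := by exact_mod_cast h3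
  have h6 : N < 1 := by exact_mod_cast h4
  omega

lemma sidePoint_inj {m k l : ℕ} (hk : k < m) (hl : l < m) {s t : ℝ} (hs : s ∈ Ioo (0 : ℝ) 1)
    (ht : t ∈ Ioo (0 : ℝ) 1) (h : sidePoint m k s = sidePoint m l t) : k = l ∧ s = t := by
  have hm : (m : ℝ) ≠ 0 := by
    have : 0 < m := by omega
    exact_mod_cast this.ne'
  obtain ⟨N, hN⟩ := Complex.exp_eq_exp_iff_exists_int.1 h
  have h1 : (((k + s) / m : ℝ) : ℂ) = ((l + t) / m + N : ℝ) := by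
    have h0 := Complex.two_pi_I_ne_zero
    refine mul_left_cancel₀ h0 ?_
    push_cast
    rw [hN]; ring
  have h2 : (k + s) / m = (l + t) / m + N := by exact_mod_cast h1
  field_simp at h2
  obtain ⟨hs1, hs2⟩ := hs
  obtain ⟨ht1, ht2⟩ := ht
  have hkm : (k : ℝ) + 1 ≤ m := by exact_mod_cast hk
  have hlm : (l : ℝ) + 1 ≤ m := by exact_mod_cast hl
  have hk0 : (0 : ℝ) ≤ k := k.cast_nonneg
  have hl0 : (0 : ℝ) ≤ l := l.cast_nonneg
  have h3 : (k : ℝ) - l - m * N < 1 := by linarith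
  have h4 : -1 < (k : ℝ) - l - m * N := by linarith
  have h5 : (k : ℤ) - l - m * N < 1 := by exact_mod_cast h3
  have h6 : -1 < (k : ℤ) - l - m * N := by exact_mod_cast h4
  have h7 : (k : ℤ) - l = m * N := by omega
  have hN : N = 0 := by
    by_contra hN
    rcases lt_or_gt_of_ne hN with h8 | h8 <;> nlinarith
  subst hN
  have hkl : k = l := by simp at h7; omega
  subst hkl
  refine ⟨rfl, ?_⟩
  simp at h2
  exact h2

lemma exists_sidePoint {m : ℕ} (hm : 0 < m) {z : ℂ} (hz : ‖z‖ = 1) (hzm : z ^ m ≠ 1) :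
    ∃ k < m, ∃ s ∈ Ioo (0 : ℝ) 1, z = sidePoint m k s := by
  have hm' : (0 : ℝ) < m := by exact_mod_cast hm
  have hπ := Real.two_pi_pos
  obtain ⟨φ, hφ0, hφ1, hφ⟩ : ∃ φ : ℝ, 0 ≤ φ ∧ φ < 2 * Real.pi ∧ z = Complex.exp (φ * Complex.I) := by
    refine ⟨toIcoMod hπ 0 z.arg, ?_, ?_, ?_⟩
    · exact (toIcoMod_mem_Ico hπ 0 z.arg).1
    · simpa using (toIcoMod_mem_Ico hπ 0 z.arg).2
    · have h1 := Complex.norm_mul_exp_arg_mul_I z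
      rw [hz, Complex.ofReal_one, one_mul] at h1
      rw [← h1, toIcoMod, Complex.exp_eq_exp_iff_exists_int]
      refine ⟨toIcoDiv hπ 0 z.arg, ?_⟩
      rw [h1]
      push_cast [zsmul_eq_mul]
      ring
  have h0 : 0 ≤ m * φ / (2 * Real.pi) := by positivity
  have h1 : m * φ / (2 * Real.pi) < m := by rw [div_lt_iff₀ hπ]; nlinarith
  have hz' : z = sidePoint m ⌊m * φ / (2 * Real.pi)⌋₊
      (m * φ / (2 * Real.pi) - ⌊m * φ / (2 * Real.pi)⌋₊) := by
    rw [hφ, sidePoint]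
    congr 1
    push_cast
    have : (m : ℂ) ≠ 0 := by exact_mod_cast hm.ne'
    have : (Real.pi : ℂ) ≠ 0 := by exact_mod_cast Real.pi_ne_zero
    field_simp
    ring
  refine ⟨⌊m * φ / (2 * Real.pi)⌋₊, (Nat.floor_lt h0).2 h1, _, ⟨?_, ?_⟩, hz'⟩
  · refine lt_of_le_of_ne (sub_nonneg.2 (Nat.floor_le h0)) fun h => hzm ?_
    rw [hz', sidePoint_pow hm, ← h]
    simp
  · linarith [Nat.lt_floor_add_one (m * φ / (2 * Real.pi))]

/-- The closed disc without the vertices of the `m`-gon. -/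
def polyDisc (m : ℕ) : Set ℂ := {z | ‖z‖ ≤ 1 ∧ z ^ m ≠ 1}

/-- `z` and `w` are interior points of sides that are identified by the gluing. -/
def SideGlued (g n : ℕ) (z w : ℂ) : Prop :=
  ∃ k < sideCount g n, ∃ s ∈ Ioo (0 : ℝ) 1,
    z = sidePoint (sideCount g n) k s ∧ w = sidePoint (sideCount g n) (partnerSide g k) (1 - s)

/-- `π` presents `X` as the polygon without its vertices, with sides glued. -/
structure IsPolygonChart {X : Type*} [TopologicalSpace X] (g n : ℕ) (π : ℂ → X) : Prop where
  surj : ∀ x, ∃ z ∈ polyDisc (sideCount g n), π z = x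
  eq_iff : ∀ z ∈ polyDisc (sideCount g n), ∀ w ∈ polyDisc (sideCount g n),
    (π z = π w ↔ z = w ∨ SideGlued g n z w)
  isOpen_iff : ∀ U : Set X, IsOpen U ↔
    ∃ O : Set ℂ, IsOpen O ∧ ∀ z ∈ polyDisc (sideCount g n), (π z ∈ U ↔ z ∈ O)

section Quotient

variable {g n : ℕ}

lemma one_sub_mem_Ioo {s : ℝ} (hs : s ∈ Ioo (0 : ℝ) 1) : 1 - s ∈ Ioo (0 : ℝ) 1 :=
  ⟨by linarith [hs.2], by linarith [hs.1]⟩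

lemma SideGlued.symm {z w : ℂ} (h : SideGlued g n z w) : SideGlued g n w z := by
  obtain ⟨k, hk, s, hs, rfl, rfl⟩ := h
  refine ⟨partnerSide g k, partnerSide_lt hk, 1 - s, one_sub_mem_Ioo hs, rfl, ?_⟩
  rw [partnerSide_partnerSide, sub_sub_cancel]

lemma SideGlued.trans {z w v : ℂ} (h : SideGlued g n z w) (h' : SideGlued g n w v) : z = v := by
  obtain ⟨k, hk, s, hs, rfl, rfl⟩ := h
  obtain ⟨l, hl, t, ht, h1, rfl⟩ := h'
  obtain ⟨rfl, rfl⟩ := sidePoint_inj (partnerSide_lt hk) hl (one_sub_mem_Ioo hs) ht h1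
  rw [partnerSide_partnerSide, sub_sub_cancel]

lemma SideGlued.pow_ne_one {z w : ℂ} (h : SideGlued g n z w) : z ^ sideCount g n ≠ 1 := by
  obtain ⟨k, hk, s, hs, rfl, -⟩ := h
  exact sidePoint_pow_ne_one (by omega) k hs

lemma SideGlued.norm_eq_one {z w : ℂ} (h : SideGlued g n z w) : ‖z‖ = 1 := by
  obtain ⟨k, hk, s, hs, rfl, -⟩ := h
  exact norm_sidePoint _ _ _

/-- On interior points of sides the gluing is an involution, so iterating it produces nothing new;
end points of sides are glued only to vertices. Which vertices are identified with each other is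
irrelevant, as all of them are removed. -/
lemma closedSurface_mk_eq {z w : Metric.closedBall (0 : ℂ) 1}
    (h : (Quot.mk _ z : ClosedSurface g n) = Quot.mk _ w) :
    z = w ∨ ((z : ℂ) ^ sideCount g n = 1 ∧ (w : ℂ) ^ sideCount g n = 1) ∨ SideGlued g n z w := by
  replace h := Quot.eqvGen_exact h
  induction h with
  | rel z w h =>
    obtain ⟨k, hk, s, hs, hz, hw⟩ := h
    have hm : 0 < sideCount g n := by omega
    rcases eq_or_lt_of_le hs.1 with h0 | h0
    · subst h0
      right; left
      rw [hz, hw, sidePoint_pow hm, sidePoint_pow hm]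
      simp
    rcases eq_or_lt_of_le hs.2 with h1 | h1
    · subst h1
      right; left
      rw [hz, hw, sidePoint_pow hm, sidePoint_pow hm]
      simp
    · exact .inr (.inr ⟨k, hk, s, ⟨h0, h1⟩, hz, hw⟩)
  | refl z => exact .inl rfl
  | symm z w _ ih =>
    rcases ih with h | h | h
    exacts [.inl h.symm, .inr (.inl h.symm), .inr (.inr h.symm)]
  | trans z w v _ _ ih ih' =>
    rcases ih with rfl | h | h
    · exact ih'
    · rcases ih' with rfl | h' | h'
      exacts [.inr (.inl h), .inr (.inl ⟨h.1, h'.2⟩), absurd h.2 h'.pow_ne_one]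
    · rcases ih' with rfl | h' | h'
      exacts [.inr (.inr h), absurd h'.1 h.symm.pow_ne_one, .inl (Subtype.ext (h.trans h'))]

lemma mk_mem_marking_iff (z : Metric.closedBall (0 : ℂ) 1) :
    (Quot.mk _ z : ClosedSurface g n) ∈ marking g n ↔ (z : ℂ) ^ sideCount g n = 1 := by
  refine ⟨?_, fun h => ⟨z, h, rfl⟩⟩
  rintro ⟨w, hw, h⟩
  rcases closedSurface_mk_eq h with rfl | h | h
  exacts [hw, h.2, absurd hw h.pow_ne_one]

lemma exists_isPolygonChart {X : Type*} [TopologicalSpace X] (hX : IsPuncturedSurface g n X)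
    (hm : 0 < sideCount g n) : ∃ π : ℂ → X, IsPolygonChart g n π := by
  obtain ⟨-, ⟨h⟩⟩ := hX
  let q : Metric.closedBall (0 : ℂ) 1 → ClosedSurface g n := Quot.mk _
  have hq : IsQuotientMap q := isQuotientMap_quot_mk
  have hD : ∀ z ∈ polyDisc (sideCount g n), ∃ hz : z ∈ Metric.closedBall (0 : ℂ) 1,
      q ⟨z, hz⟩ ∈ (marking g n)ᶜ := fun z hz => ⟨by simpa using hz.1, by
    rw [mem_compl_iff, mk_mem_marking_iff]; exact hz.2⟩
  have h0 : (0 : ℂ) ∈ polyDisc (sideCount g n) := ⟨by simp, by simp [hm.ne']⟩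
  classical
  -- Outside the polygon without vertices the value is arbitrary; the image of the centre serves as
  -- default.
  let π : ℂ → X := fun z => if hz : z ∈ polyDisc (sideCount g n) then h.symm ⟨_, (hD z hz).2⟩
    else h.symm ⟨_, (hD 0 h0).2⟩
  have hπ : ∀ z (hz : z ∈ polyDisc (sideCount g n)), h (π z) = ⟨_, (hD z hz).2⟩ := fun z hz => by
    simp [π, hz]
  have hπ' : ∀ z (hz : z ∈ polyDisc (sideCount g n)), (h (π z) : ClosedSurface g n) =
    q ⟨z, (hD z hz).1⟩ := fun z hz => congrArg _ (hπ z hz)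
  have hopen : IsOpen (marking g n)ᶜ := by
    rw [← hq.isOpen_preimage]
    have : q ⁻¹' (marking g n)ᶜ =
        {z : Metric.closedBall (0 : ℂ) 1 | (z : ℂ) ^ sideCount g n ≠ 1} := by
      ext z; exact not_congr (mk_mem_marking_iff z)
    rw [this]
    exact isOpen_ne_fun (by fun_prop) continuous_const
  refine ⟨π, fun x => ?_, fun z hz w hw => ?_, fun U => ?_⟩
  · obtain ⟨z, hz⟩ := Quot.exists_rep (h x : ClosedSurface g n)
    have hzm : (z : ℂ) ^ sideCount g n ≠ 1 := by
      rw [Ne, ← mk_mem_marking_iff, hz]; exact (h x).2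
    have hzD : (z : ℂ) ∈ polyDisc (sideCount g n) := ⟨mem_closedBall_zero_iff.1 z.2, hzm⟩
    exact ⟨z, hzD, h.injective (Subtype.ext ((hπ' z hzD).trans hz))⟩
  · constructor
    · intro heq
      have h1 : q ⟨z, (hD z hz).1⟩ = q ⟨w, (hD w hw).1⟩ := by
        rw [← hπ' z hz, ← hπ' w hw, heq]
      rcases closedSurface_mk_eq h1 with h2 | h2 | h2
      exacts [.inl (congrArg Subtype.val h2), absurd h2.1 hz.2, .inr h2]
    · rintro (rfl | ⟨k, hk, s, hs, hz', hw'⟩)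
      · rfl
      · refine h.injective (Subtype.ext ?_)
        rw [hπ' z hz, hπ' w hw]
        exact Quot.sound ⟨k, hk, s, ⟨hs.1.le, hs.2.le⟩, hz', hw'⟩
  · rw [← h.isOpen_image, hopen.isOpenEmbedding_subtypeVal.isOpen_iff_image_isOpen,
      ← hq.isOpen_preimage]
    have hmem : ∀ z : Metric.closedBall (0 : ℂ) 1, z ∈ q ⁻¹' (Subtype.val '' (h '' U)) ↔
        (z : ℂ) ^ sideCount g n ≠ 1 ∧ π z ∈ U := fun z => by
      constructor
      · rintro ⟨_, ⟨x, hx, rfl⟩, hxz⟩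
        have hzm : (z : ℂ) ^ sideCount g n ≠ 1 := by
          rw [Ne, ← mk_mem_marking_iff, ← show _ = Quot.mk _ z from hxz]; exact (h x).2
        refine ⟨hzm, ?_⟩
        have hzD : (z : ℂ) ∈ polyDisc (sideCount g n) := ⟨mem_closedBall_zero_iff.1 z.2, hzm⟩
        have : π z = x := h.injective (Subtype.ext ((hπ' z hzD).trans hxz.symm))
        rwa [this]
      · rintro ⟨hzm, hzU⟩
        have hzD : (z : ℂ) ∈ polyDisc (sideCount g n) := ⟨mem_closedBall_zero_iff.1 z.2, hzm⟩
        exact ⟨_, ⟨_, hzU, rfl⟩, hπ' z hzD⟩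
    rw [isOpen_induced_iff]
    constructor
    · rintro ⟨O, hO, hOe⟩
      refine ⟨O, hO, fun z hz => ?_⟩
      have h1 := hmem ⟨z, (hD z hz).1⟩
      rw [← hOe] at h1
      exact ⟨fun h2 => h1.2 ⟨hz.2, h2⟩, fun h2 => (h1.1 h2).2⟩
    · rintro ⟨O, hO, hOe⟩
      refine ⟨O ∩ {z | z ^ sideCount g n ≠ 1},
        hO.inter (isOpen_ne_fun (by fun_prop) continuous_const), ?_⟩
      ext z
      rw [hmem, mem_preimage, mem_inter_iff, mem_ofPred_eq]
      constructor
      · rintro ⟨h1, h2⟩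
        exact ⟨h2, (hOe z ⟨mem_closedBall_zero_iff.1 z.2, h2⟩).2 h1⟩
      · rintro ⟨h1, h2⟩
        exact ⟨(hOe z ⟨mem_closedBall_zero_iff.1 z.2, h1⟩).1 h2, h1⟩

end Quotient

end


open Set Filter Topology

noncomputable section

/-! ### Angular coordinates on the disc -/

/-- The map `w ↦ e^{iw}` from the upper half-plane to the disc. -/
def expI (w : ℂ) : ℂ := Complex.exp (Complex.I * w)

/-- The angle of the point with parameter `t` on the boundary of the `m`-gon. -/
def sideAngle (m : ℕ) (t : ℝ) : ℝ := 2 * Real.pi * t / m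

/-- The vertical strip above side `k` of the `m`-gon. -/
def sideStrip (m k : ℕ) : Set ℂ := {w | sideAngle m k < w.re ∧ w.re < sideAngle m (k + 1)}

lemma continuous_expI : Continuous expI := by
  unfold expI; fun_prop

lemma isOpenMap_expI : IsOpenMap expI := by
  have h : expI = Complex.exp ∘ (Homeomorph.mulLeft₀ Complex.I Complex.I_ne_zero) := rfl
  rw [h]
  exact Complex.isOpenMap_exp.comp (Homeomorph.isOpenMap _)

lemma norm_expI (w : ℂ) : ‖expI w‖ = Real.exp (-w.im) := by
  rw [expI, Complex.norm_exp]; simp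

lemma norm_expI_le_one {w : ℂ} : ‖expI w‖ ≤ 1 ↔ 0 ≤ w.im := by
  rw [norm_expI, Real.exp_le_one_iff]; simp

lemma norm_expI_lt_one {w : ℂ} : ‖expI w‖ < 1 ↔ 0 < w.im := by
  rw [norm_expI, Real.exp_lt_one_iff]; simp

lemma expI_pow (m : ℕ) (w : ℂ) : expI w ^ m = Complex.exp (Complex.I * (m * w)) := by
  rw [expI, ← Complex.exp_nat_mul]; congr 1; ring

lemma expI_eq_iff {w w' : ℂ} : expI w = expI w' ↔ ∃ N : ℤ, w = w' + 2 * Real.pi * N := by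
  rw [expI, expI, Complex.exp_eq_exp_iff_exists_int]
  refine exists_congr fun N => ?_
  rw [show Complex.I * w' + N * (2 * Real.pi * Complex.I) =
    Complex.I * (w' + 2 * Real.pi * N) by ring, mul_right_inj' Complex.I_ne_zero]

lemma exists_expI {z : ℂ} (hz : z ≠ 0) : ∃ w, expI w = z :=
  ⟨-Complex.I * Complex.log z, by
    rw [expI, ← mul_assoc, mul_neg, Complex.I_mul_I, neg_neg, one_mul, Complex.exp_log hz]⟩

section Angle

variable {m : ℕ}

lemma sideAngle_lt_iff (hm : 0 < m) {s t : ℝ} : sideAngle m s < sideAngle m t ↔ s < t := by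
  have hm' : (0 : ℝ) < m := by exact_mod_cast hm
  rw [sideAngle, sideAngle, div_lt_div_iff_of_pos_right hm', mul_lt_mul_iff_right₀ Real.two_pi_pos]

lemma sideAngle_add (s t : ℝ) : sideAngle m (s + t) = sideAngle m s + sideAngle m t := by
  simp only [sideAngle]; ring

lemma sideAngle_sub (s t : ℝ) : sideAngle m (s - t) = sideAngle m s - sideAngle m t := by
  simp only [sideAngle]; ring

lemma sideAngle_zero : sideAngle m 0 = 0 := by simp [sideAngle]

lemma sideAngle_self (hm : 0 < m) : sideAngle m m = 2 * Real.pi := by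
  have hm' : (m : ℝ) ≠ 0 := by exact_mod_cast hm.ne'
  rw [sideAngle]; field_simp

lemma expI_sideAngle (k : ℕ) (s : ℝ) : expI (sideAngle m (k + s)) = sidePoint m k s := by
  rw [expI, sidePoint, sideAngle]
  congr 1
  push_cast
  ring

lemma exists_sideAngle (hm : 0 < m) (x : ℝ) : ∃ t, sideAngle m t = x := by
  have hm' : (m : ℝ) ≠ 0 := by exact_mod_cast hm.ne'
  refine ⟨m * x / (2 * Real.pi), ?_⟩
  have := Real.pi_ne_zero
  rw [sideAngle]; field_simp

lemma sideAngle_natCast_le (hm : 0 < m) {k l : ℕ} (h : k ≤ l) :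
    sideAngle m k ≤ sideAngle m l := by
  rw [← not_lt, sideAngle_lt_iff hm, not_lt]
  exact_mod_cast h

lemma sideStrip_re_bounds (hm : 0 < m) {k : ℕ} (hk : k < m) {w : ℂ} (hw : w ∈ sideStrip m k) :
    0 < w.re ∧ w.re < 2 * Real.pi := by
  constructor
  · refine lt_of_le_of_lt ?_ hw.1
    have := sideAngle_natCast_le hm (Nat.zero_le k)
    rwa [Nat.cast_zero, sideAngle_zero] at this
  · refine hw.2.trans_le ?_
    rw [← sideAngle_self hm]
    have := sideAngle_natCast_le hm (show k + 1 ≤ m from hk)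
    push_cast at this
    exact this

lemma isOpen_sideStrip (m k : ℕ) : IsOpen (sideStrip m k) :=
  (isOpen_lt continuous_const Complex.continuous_re).inter
    (isOpen_lt Complex.continuous_re continuous_const)

lemma convex_sideStrip (m k : ℕ) : Convex ℝ (sideStrip m k) :=
  (convex_halfSpace_re_gt _).inter (convex_halfSpace_re_lt _)

lemma eq_of_mem_sideStrip (hm : 0 < m) {k l : ℕ} {w : ℂ} (hk : w ∈ sideStrip m k)
    (hl : w ∈ sideStrip m l) : k = l := by
  have h1 := hk.1.trans hl.2
  have h2 := hl.1.trans hk.2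
  rw [sideAngle_lt_iff hm] at h1 h2
  have h3 : k < l + 1 := by exact_mod_cast h1
  have h4 : l < k + 1 := by exact_mod_cast h2
  omega

lemma expI_inj (hm : 0 < m) {k l : ℕ} (hk : k < m) (hl : l < m) {w w' : ℂ}
    (hw : w ∈ sideStrip m k) (hw' : w' ∈ sideStrip m l) (h : expI w = expI w') :
    w = w' ∧ k = l := by
  obtain ⟨N, hN⟩ := expI_eq_iff.1 h
  have h1 := sideStrip_re_bounds hm hk hw
  have h2 := sideStrip_re_bounds hm hl hw'
  have h3 : w.re = w'.re + 2 * Real.pi * N := by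
    rw [hN]; simp
  have hπ := Real.two_pi_pos
  have h4 : (N : ℝ) < 1 := by nlinarith
  have h5 : (-1 : ℝ) < N := by nlinarith
  have h6 : N < 1 := by exact_mod_cast h4
  have h7 : -1 < N := by exact_mod_cast h5
  obtain rfl : N = 0 := by omega
  have h8 : w = w' := by simpa using hN
  subst h8
  exact ⟨rfl, eq_of_mem_sideStrip hm hw hw'⟩

lemma exists_sidePoint_of_mem_sideStrip (hm : 0 < m) {k : ℕ} {w : ℂ} (hw : w ∈ sideStrip m k)
    (h0 : w.im = 0) : ∃ s ∈ Ioo (0 : ℝ) 1, w = sideAngle m (k + s) ∧ expI w = sidePoint m k s := by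
  obtain ⟨t, ht⟩ := exists_sideAngle hm w.re
  have hwt : w = sideAngle m (k + (t - k)) := by
    rw [add_sub_cancel, ht]
    exact Complex.ext rfl (by simpa using h0)
  obtain ⟨h1, h2⟩ := hw
  rw [← ht, sideAngle_lt_iff hm] at h1 h2
  exact ⟨t - k, ⟨by linarith, by linarith⟩, hwt, by rw [hwt, expI_sideAngle]⟩

lemma expI_mem_polyDisc (hm : 0 < m) {k : ℕ} {w : ℂ} (hw : w ∈ sideStrip m k) (h0 : 0 ≤ w.im) :
    expI w ∈ polyDisc m := by
  refine ⟨norm_expI_le_one.2 h0, ?_⟩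
  rcases eq_or_lt_of_le h0 with h | h
  · obtain ⟨s, hs, -, hws⟩ := exists_sidePoint_of_mem_sideStrip hm hw h.symm
    rw [hws]
    exact sidePoint_pow_ne_one hm k hs
  · intro h1
    have h2 := congrArg norm h1
    rw [norm_pow, norm_one] at h2
    have h3 := pow_lt_one₀ (norm_nonneg (expI w)) (norm_expI_lt_one.2 h) hm.ne'
    linarith

lemma ball_subset_polyDisc (hm : 0 < m) : Metric.ball 0 1 ⊆ polyDisc m := fun z hz => by
  rw [mem_ball_zero_iff] at hz
  refine ⟨hz.le, fun h1 => ?_⟩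
  have h2 := congrArg norm h1
  rw [norm_pow, norm_one] at h2
  have h3 := pow_lt_one₀ (norm_nonneg z) hz hm.ne'
  linarith

end Angle

section Reflect

variable {g n : ℕ}

/-- The reflection of the strip above side `k` to the strip above its partner. -/
def stripReflect (g n k : ℕ) (w : ℂ) : ℂ :=
  (sideAngle (sideCount g n) (k + partnerSide g k + 1) : ℝ) - w

lemma stripReflect_im (k : ℕ) (w : ℂ) : (stripReflect g n k w).im = -w.im := by
  simp [stripReflect]

lemma stripReflect_mem {k : ℕ} {w : ℂ} (hw : w ∈ sideStrip (sideCount g n) k) :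
    stripReflect g n k w ∈ sideStrip (sideCount g n) (partnerSide g k) := by
  obtain ⟨h1, h2⟩ := hw
  constructor
  · have : (stripReflect g n k w).re =
        sideAngle (sideCount g n) (partnerSide g k + (k + 1)) - w.re := by
      rw [show (partnerSide g k + (k + 1) : ℝ) = k + partnerSide g k + 1 by ring]
      simp [stripReflect]
    rw [this, sideAngle_add]; linarith
  · have : (stripReflect g n k w).re =
        sideAngle (sideCount g n) ((partnerSide g k + 1) + k) - w.re := by
      rw [show (partnerSide g k + 1 + k : ℝ) = k + partnerSide g k + 1 by ring]
      simp [stripReflect]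
    rw [this, sideAngle_add]; linarith

lemma stripReflect_stripReflect (k : ℕ) (w : ℂ) :
    stripReflect g n (partnerSide g k) (stripReflect g n k w) = w := by
  simp only [stripReflect, partnerSide_partnerSide]
  rw [show (partnerSide g k + k + 1 : ℝ) = k + partnerSide g k + 1 by ring]
  ring

lemma continuous_stripReflect (k : ℕ) : Continuous (stripReflect g n k) := by
  unfold stripReflect; fun_prop

lemma isOpenMap_stripReflect (k : ℕ) : IsOpenMap (stripReflect g n k) :=
  (Homeomorph.subLeft _).isOpenMap

lemma expI_stripReflect (k : ℕ) (s : ℝ) :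
    expI (stripReflect g n k (sideAngle (sideCount g n) (k + s))) =
      sidePoint (sideCount g n) (partnerSide g k) (1 - s) := by
  rw [← expI_sideAngle, stripReflect, ← Complex.ofReal_sub, ← sideAngle_sub]
  congr 3
  ring

lemma sideGlued_expI_iff {k : ℕ} (hk : k < sideCount g n) {w z : ℂ}
    (hw : w ∈ sideStrip (sideCount g n) k) (h0 : w.im = 0) :
    SideGlued g n (expI w) z ↔ z = expI (stripReflect g n k w) := by
  have hm : 0 < sideCount g n := by omega
  obtain ⟨s, hs, hws, hwp⟩ := exists_sidePoint_of_mem_sideStrip hm hw h0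
  constructor
  · rintro ⟨l, hl, t, ht, h1, rfl⟩
    rw [hwp] at h1
    obtain ⟨rfl, rfl⟩ := sidePoint_inj hk hl hs ht h1
    rw [hws, expI_stripReflect]
  · rintro rfl
    refine ⟨k, hk, s, hs, hwp, ?_⟩
    rw [hws, expI_stripReflect]

end Reflect

end


open Set Filter Topology

noncomputable section

/-! ### The handle cover of a punctured surface -/

lemma isSimplyConnected_image_of_convex {X : Type*} [TopologicalSpace X] {f : ℂ → X} {S : Set ℂ}
    (hS : Convex ℝ S) (hne : S.Nonempty) (ho : IsOpen S) (hc : ContinuousOn f S)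
    (hi : InjOn f S) (hopen : ∀ V ⊆ S, IsOpen V → IsOpen (f '' V)) : IsSimplyConnected (f '' S) := by
  have hemb : IsOpenEmbedding (S.domRestrict f) := by
    refine .of_continuous_injective_isOpenMap hc.domRestrict hi.injective fun V hV => ?_
    have h1 : S.domRestrict f '' V = f '' (Subtype.val '' V) := by rw [image_image]; rfl
    rw [h1]
    exact hopen _ (Subtype.coe_image_subset S V) (ho.isOpenMap_subtype_val V hV)
  have h1 : ContractibleSpace S := hS.contractibleSpace hne
  have h2 : SimplyConnectedSpace (range (S.domRestrict f)) :=
    hemb.isEmbedding.toHomeomorph.symm.toHomotopyEquiv.simplyConnectedSpace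
  rw [range_domRestrict] at h2
  exact h2

/-- The coordinate around side `k`. -/
def sideChart {X : Type*} (g n : ℕ) (π : ℂ → X) (k : ℕ) (w : ℂ) : X :=
  if 0 ≤ w.im then π (expI w) else π (expI (stripReflect g n k w))

lemma exists_eq_sideChart {X : Type*} {g n : ℕ} {π : ℂ → X} {k : ℕ} (hm : 0 < sideCount g n) {w : ℂ}
    (hw : w ∈ sideStrip (sideCount g n) k) :
    ∃ z ∈ polyDisc (sideCount g n), π z = sideChart g n π k w := by
  rw [sideChart]
  split_ifs with h
  · exact ⟨_, expI_mem_polyDisc hm hw h, rfl⟩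
  · exact ⟨_, expI_mem_polyDisc hm (stripReflect_mem hw) (by rw [stripReflect_im]; linarith), rfl⟩

namespace IsPolygonChart

variable {X : Type*} [TopologicalSpace X] {g n : ℕ} {π : ℂ → X}

lemma eq_iff_of_norm_lt (hπ : IsPolygonChart g n π) {z w : ℂ} (hz : z ∈ polyDisc (sideCount g n))
    (hw : w ∈ polyDisc (sideCount g n)) (h : ‖w‖ < 1) : π z = π w ↔ z = w := by
  rw [hπ.eq_iff z hz w hw, or_iff_left]
  intro h1
  linarith [h1.symm.norm_eq_one]

/-- On the real axis both alternatives occur: they are the two points of the glued sides. Off the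
axis the image is an interior point of the disc and only one alternative remains. -/
lemma eq_sideChart_iff (hπ : IsPolygonChart g n π) {k : ℕ} (hk : k < sideCount g n) {w z : ℂ}
    (hw : w ∈ sideStrip (sideCount g n) k) (hz : z ∈ polyDisc (sideCount g n)) :
    π z = sideChart g n π k w ↔
      (0 ≤ w.im ∧ z = expI w) ∨ (w.im ≤ 0 ∧ z = expI (stripReflect g n k w)) := by
  have hm : 0 < sideCount g n := by omega
  rw [sideChart]
  rcases lt_trichotomy w.im 0 with h | h | h
  · have h1 : 0 < (stripReflect g n k w).im := by rw [stripReflect_im]; linarith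
    rw [if_neg (by linarith), hπ.eq_iff_of_norm_lt hz
      (expI_mem_polyDisc hm (stripReflect_mem hw) h1.le) (norm_expI_lt_one.2 h1)]
    simp [h.le, h]
  · rw [if_pos h.ge, hπ.eq_iff z hz _ (expI_mem_polyDisc hm hw h.ge)]
    have h1 : SideGlued g n z (expI w) ↔ z = expI (stripReflect g n k w) := by
      rw [← sideGlued_expI_iff hk hw h]
      exact ⟨SideGlued.symm, SideGlued.symm⟩
    simp [h, h1]
  · rw [if_pos h.le, hπ.eq_iff_of_norm_lt hz (expI_mem_polyDisc hm hw h.le)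
      (norm_expI_lt_one.2 h)]
    simp [h.le, h]

/-- Choosing from each glued pair the side that precedes its partner rules out the mixed cases, in
which the same strip would be reached from both members of a pair. -/
lemma eq_of_sideChart_eq (hπ : IsPolygonChart g n π) {k l : ℕ} (hk : k < sideCount g n) (hl : l < sideCount g n)
    (hk' : k < partnerSide g k) (hl' : l < partnerSide g l) {w w' : ℂ}
    (hw : w ∈ sideStrip (sideCount g n) k) (hw' : w' ∈ sideStrip (sideCount g n) l)
    (h : sideChart g n π k w = sideChart g n π l w') : k = l ∧ w = w' := by
  have hm : 0 < sideCount g n := by omega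
  obtain ⟨z, hz, hzw⟩ := exists_eq_sideChart (π := π) hm hw
  have h1 := (hπ.eq_sideChart_iff hk hw hz).1 hzw
  have h2 := (hπ.eq_sideChart_iff hl hw' hz).1 (hzw.trans h)
  have hkp := partnerSide_lt hk
  have hlp := partnerSide_lt hl
  rcases h1 with ⟨-, rfl⟩ | ⟨-, rfl⟩ <;> rcases h2 with ⟨-, h2⟩ | ⟨-, h2⟩
  · obtain ⟨h3, h4⟩ := expI_inj hm hk hl hw hw' h2
    exact ⟨h4, h3⟩
  · obtain ⟨-, rfl⟩ := expI_inj hm hk hlp hw (stripReflect_mem hw') h2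
    rw [partnerSide_partnerSide] at hk'
    omega
  · obtain ⟨-, rfl⟩ := expI_inj hm hkp hl (stripReflect_mem hw) hw' h2
    rw [partnerSide_partnerSide] at hl'
    omega
  · obtain ⟨h3, h4⟩ := expI_inj hm hkp hlp (stripReflect_mem hw) (stripReflect_mem hw') h2
    have h5 : k = l := by
      rw [← partnerSide_partnerSide g k, h4, partnerSide_partnerSide]
    subst h5
    exact ⟨rfl, by simpa [stripReflect] using h3⟩

lemma isOpen_image_sideChart (hπ : IsPolygonChart g n π) {k : ℕ} (hk : k < sideCount g n) {V : Set ℂ}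
    (hV : V ⊆ sideStrip (sideCount g n) k) (hVo : IsOpen V) : IsOpen (sideChart g n π k '' V) := by
  rw [hπ.isOpen_iff]
  refine ⟨expI '' V ∪ expI '' (stripReflect g n k '' V), (isOpenMap_expI _ hVo).union
    (isOpenMap_expI _ (isOpenMap_stripReflect k _ hVo)), fun z hz => ?_⟩
  constructor
  · rintro ⟨w, hw, hwz⟩
    rcases (hπ.eq_sideChart_iff hk (hV hw) hz).1 hwz.symm with ⟨-, rfl⟩ | ⟨-, rfl⟩
    · exact .inl ⟨w, hw, rfl⟩
    · exact .inr ⟨_, ⟨w, hw, rfl⟩, rfl⟩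
  · rintro (⟨w, hw, rfl⟩ | ⟨_, ⟨w, hw, rfl⟩, rfl⟩)
    · exact ⟨w, hw, ((hπ.eq_sideChart_iff hk (hV hw) hz).2
        (.inl ⟨norm_expI_le_one.1 hz.1, rfl⟩)).symm⟩
    · refine ⟨w, hw, ((hπ.eq_sideChart_iff hk (hV hw) hz).2 (.inr ⟨?_, rfl⟩)).symm⟩
      have := norm_expI_le_one.1 hz.1
      rw [stripReflect_im] at this
      linarith

lemma continuousOn_sideChart (hπ : IsPolygonChart g n π) {k : ℕ} (hk : k < sideCount g n) :
    ContinuousOn (sideChart g n π k) (sideStrip (sideCount g n) k) := by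
  have hm : 0 < sideCount g n := by omega
  intro w hw
  refine ContinuousAt.continuousWithinAt ?_
  rw [ContinuousAt, tendsto_nhds]
  intro U hU hwU
  obtain ⟨O, hO, hOU⟩ := (hπ.isOpen_iff U).1 hU
  -- Membership in `U` becomes two implications, one for each closed half-plane. Each persists near
  -- `w`: either its premise fails in a neighbourhood or its conclusion is an open condition.
  have key : ∀ w ∈ sideStrip (sideCount g n) k, sideChart g n π k w ∈ U ↔
      (0 ≤ w.im → expI w ∈ O) ∧ (w.im ≤ 0 → expI (stripReflect g n k w) ∈ O) := by
    intro w hw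
    have e1 : 0 ≤ w.im → (sideChart g n π k w ∈ U ↔ expI w ∈ O) := fun h => by
      have hz := expI_mem_polyDisc hm hw h
      rw [← (hπ.eq_sideChart_iff hk hw hz).2 (.inl ⟨h, rfl⟩), hOU _ hz]
    have e2 : w.im ≤ 0 → (sideChart g n π k w ∈ U ↔ expI (stripReflect g n k w) ∈ O) := fun h => by
      have hz := expI_mem_polyDisc hm (stripReflect_mem hw) (by rw [stripReflect_im]; linarith)
      rw [← (hπ.eq_sideChart_iff hk hw hz).2 (.inr ⟨h, rfl⟩), hOU _ hz]
    refine ⟨fun h => ⟨fun h0 => (e1 h0).1 h, fun h0 => (e2 h0).1 h⟩, fun ⟨h1, h2⟩ => ?_⟩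
    rcases le_total 0 w.im with h0 | h0
    exacts [(e1 h0).2 (h1 h0), (e2 h0).2 (h2 h0)]
  obtain ⟨h1, h2⟩ := (key w hw).1 hwU
  have h3 : ∀ᶠ x in 𝓝 w, 0 ≤ x.im → expI x ∈ O := by
    rcases le_or_gt 0 w.im with h | h
    · filter_upwards [continuous_expI.continuousAt.eventually_mem (hO.mem_nhds (h1 h))] with x hx _
      exact hx
    · filter_upwards [Complex.continuous_im.continuousAt.eventually_mem (Iio_mem_nhds h)] with x hx h4
      exact absurd h4 (not_le.2 hx)
  have h4 : ∀ᶠ x in 𝓝 w, x.im ≤ 0 → expI (stripReflect g n k x) ∈ O := by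
    rcases le_or_gt w.im 0 with h | h
    · filter_upwards [(continuous_expI.comp (continuous_stripReflect k)).continuousAt.eventually_mem
        (hO.mem_nhds (h2 h))] with x hx _
      exact hx
    · filter_upwards [Complex.continuous_im.continuousAt.eventually_mem (Ioi_mem_nhds h)] with x hx h4
      exact absurd h4 (not_le.2 hx)
  filter_upwards [h3, h4, (isOpen_sideStrip _ _).mem_nhds hw] with x h5 h6 h7
  exact (key x h7).2 ⟨h5, h6⟩

lemma isOpen_image_ball (hπ : IsPolygonChart g n π) (hm : 0 < sideCount g n) {V : Set ℂ} (hV : V ⊆ Metric.ball 0 1)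
    (hVo : IsOpen V) : IsOpen (π '' V) := by
  rw [hπ.isOpen_iff]
  refine ⟨V, hVo, fun z hz => ⟨?_, fun h => ⟨z, h, rfl⟩⟩⟩
  rintro ⟨w, hw, hwz⟩
  have := (hπ.eq_iff_of_norm_lt hz (ball_subset_polyDisc hm (hV hw))
    (mem_ball_zero_iff.1 (hV hw))).1 hwz.symm
  rwa [this]

lemma continuousOn (hπ : IsPolygonChart g n π) : ContinuousOn π (polyDisc (sideCount g n)) := by
  intro z hz
  rw [ContinuousWithinAt, tendsto_nhds]
  intro U hU hzU
  obtain ⟨O, hO, hOU⟩ := (hπ.isOpen_iff U).1 hU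
  filter_upwards [self_mem_nhdsWithin, mem_nhdsWithin_of_mem_nhds
    (hO.mem_nhds ((hOU z hz).1 hzU))] with x hx hxO
  exact (hOU x hx).2 hxO

lemma sideChart_mem_image_ball_iff (hπ : IsPolygonChart g n π) {k : ℕ} (hk : k < sideCount g n) {w : ℂ}
    (hw : w ∈ sideStrip (sideCount g n) k) :
    sideChart g n π k w ∈ π '' Metric.ball 0 1 ↔ w.im ≠ 0 := by
  have hm : 0 < sideCount g n := by omega
  constructor
  · rintro ⟨z, hz, hzw⟩ h0
    rw [hπ.eq_sideChart_iff hk hw (ball_subset_polyDisc hm hz)] at hzw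
    rw [mem_ball_zero_iff] at hz
    rcases hzw with ⟨-, rfl⟩ | ⟨-, rfl⟩
    · rw [norm_expI_lt_one] at hz; linarith
    · rw [norm_expI_lt_one, stripReflect_im] at hz; linarith
  · intro h0
    rcases lt_or_gt_of_ne h0 with h | h
    · refine ⟨expI (stripReflect g n k w), ?_, ?_⟩
      · rw [mem_ball_zero_iff, norm_expI_lt_one, stripReflect_im]; linarith
      · rw [sideChart, if_neg (by linarith)]
    · refine ⟨expI w, ?_, ?_⟩
      · rw [mem_ball_zero_iff, norm_expI_lt_one]; exact h
      · rw [sideChart, if_pos h.le]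

end IsPolygonChart

lemma nonempty_sideStrip_inter {m : ℕ} (hm : 0 < m) (k : ℕ) (y : ℝ) :
    ∃ w ∈ sideStrip m k, w.im = y := by
  refine ⟨⟨sideAngle m (k + 1 / 2), y⟩, ⟨?_, ?_⟩, rfl⟩
  · exact (sideAngle_lt_iff hm).2 (by linarith)
  · exact (sideAngle_lt_iff hm).2 (by linarith)

/-- The letters of the polygon: the sides that come before their partners. -/
abbrev Letter (g n : ℕ) : Type := {k : Fin (sideCount g n) // (k : ℕ) < partnerSide g k}

/-- The handle cover of a punctured surface. -/
def polygonCover {X : Type*} [TopologicalSpace X] {g n : ℕ} {π : ℂ → X} (hπ : IsPolygonChart g n π)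
    (hm : 0 < sideCount g n) : HandleCover X (Letter g n) where
  P := π '' Metric.ball 0 1
  N k := sideChart g n π k '' sideStrip (sideCount g n) k
  -- The upper half of the strip is the part of the disc along side `k`; the lower half is reflected
  -- to the part along its partner.
  A k := sideChart g n π k '' (sideStrip (sideCount g n) k ∩ {w | 0 < w.im})
  B k := sideChart g n π k '' (sideStrip (sideCount g n) k ∩ {w | w.im < 0})
  isOpen_P := hπ.isOpen_image_ball hm subset_rfl Metric.isOpen_ball
  isOpen_N k := hπ.isOpen_image_sideChart k.1.2 subset_rfl (isOpen_sideStrip _ _)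
  isOpen_A k := hπ.isOpen_image_sideChart k.1.2 inter_subset_left
    ((isOpen_sideStrip _ _).inter (isOpen_lt continuous_const Complex.continuous_im))
  isOpen_B k := hπ.isOpen_image_sideChart k.1.2 inter_subset_left
    ((isOpen_sideStrip _ _).inter (isOpen_lt Complex.continuous_im continuous_const))
  simplyConnected_P := by
    refine isSimplyConnected_image_of_convex (convex_ball 0 1) ⟨0, by simp⟩ Metric.isOpen_ball
      (hπ.continuousOn.mono (ball_subset_polyDisc hm)) (fun z hz w hw h => ?_)
      fun V hV hVo => hπ.isOpen_image_ball hm hV hVo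
    exact (hπ.eq_iff_of_norm_lt (ball_subset_polyDisc hm hz) (ball_subset_polyDisc hm hw)
      (mem_ball_zero_iff.1 hw)).1 h
  simplyConnected_N k := by
    obtain ⟨w, hw, -⟩ := nonempty_sideStrip_inter hm k 0
    exact isSimplyConnected_image_of_convex (convex_sideStrip _ _) ⟨w, hw⟩ (isOpen_sideStrip _ _)
      (hπ.continuousOn_sideChart k.1.2)
      (fun z hz w hw h => (hπ.eq_of_sideChart_eq k.1.2 k.1.2 k.2 k.2 hz hw h).2)
      fun V hV hVo => hπ.isOpen_image_sideChart k.1.2 hV hVo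
  pathConnected_A k := by
    obtain ⟨w, hw, hw'⟩ := nonempty_sideStrip_inter hm k 1
    exact (((convex_sideStrip _ _).inter (convex_halfSpace_im_gt 0)).isPathConnected
      ⟨w, hw, by simp [hw']⟩).image'
      ((hπ.continuousOn_sideChart k.1.2).mono inter_subset_left)
  pathConnected_B k := by
    obtain ⟨w, hw, hw'⟩ := nonempty_sideStrip_inter hm k (-1)
    exact (((convex_sideStrip _ _).inter (convex_halfSpace_im_lt 0)).isPathConnected
      ⟨w, hw, by simp [hw']⟩).image'
      ((hπ.continuousOn_sideChart k.1.2).mono inter_subset_left)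
  disjoint_A_B k := by
    rw [disjoint_left]
    rintro _ ⟨w, ⟨hw, h⟩, rfl⟩ ⟨w', ⟨hw', h'⟩, heq⟩
    have := (hπ.eq_of_sideChart_eq k.1.2 k.1.2 k.2 k.2 hw' hw heq).2
    subst this
    exact lt_asymm (show 0 < w'.im from h) h'
  N_inter_P k := by
    ext x
    constructor
    · rintro ⟨⟨w, hw, rfl⟩, hP⟩
      rw [hπ.sideChart_mem_image_ball_iff k.1.2 hw] at hP
      rcases lt_or_gt_of_ne hP with h | h
      exacts [.inr ⟨w, ⟨hw, h⟩, rfl⟩, .inl ⟨w, ⟨hw, h⟩, rfl⟩]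
    · rintro (⟨w, ⟨hw, h⟩, rfl⟩ | ⟨w, ⟨hw, h⟩, rfl⟩)
      · exact ⟨⟨w, hw, rfl⟩, (hπ.sideChart_mem_image_ball_iff k.1.2 hw).2 (ne_of_gt h)⟩
      · exact ⟨⟨w, hw, rfl⟩, (hπ.sideChart_mem_image_ball_iff k.1.2 hw).2 (ne_of_lt h)⟩
  disjoint_N k l hkl := by
    rw [disjoint_left]
    rintro _ ⟨w, hw, rfl⟩ ⟨w', hw', heq⟩
    exact hkl (Subtype.ext (Fin.ext
      (hπ.eq_of_sideChart_eq l.1.2 k.1.2 l.2 k.2 hw' hw heq).1.symm))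
  cover x := by
    obtain ⟨z, hz, rfl⟩ := hπ.surj x
    rcases lt_or_eq_of_le hz.1 with h | h
    · exact .inl ⟨z, mem_ball_zero_iff.2 h, rfl⟩
    obtain ⟨k, hk, s, hs, rfl⟩ := exists_sidePoint hm h hz.2
    have hstrip : ∀ k, ((sideAngle (sideCount g n) (k + s) : ℝ) : ℂ) ∈ sideStrip (sideCount g n) k :=
      fun k => ⟨(sideAngle_lt_iff hm).2 (by linarith [hs.1]),
        (sideAngle_lt_iff hm).2 (by linarith [hs.2])⟩
    refine .inr ?_
    rcases lt_or_gt_of_ne (partnerSide_ne g k) with h1 | h1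
    · refine ⟨⟨⟨partnerSide g k, partnerSide_lt hk⟩, ?_⟩, stripReflect g n k _,
        stripReflect_mem (hstrip k), ?_⟩
      · simpa [partnerSide_partnerSide] using h1
      · refine ((hπ.eq_sideChart_iff (partnerSide_lt hk) (stripReflect_mem (hstrip k)) hz).2
          (.inr ⟨?_, ?_⟩)).symm
        · simp [stripReflect_im]
        · rw [stripReflect_stripReflect, expI_sideAngle]
    · refine ⟨⟨⟨k, hk⟩, h1⟩, _, hstrip k, ?_⟩
      exact ((hπ.eq_sideChart_iff hk (hstrip k) hz).2 (.inl ⟨by simp, by rw [expI_sideAngle]⟩)).symm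

end


open Set Filter Topology

noncomputable section

/-! ### Corners of the polygon -/

lemma expI_sub_sideAngle_pow {m : ℕ} (hm : 0 < m) (j : ℕ) (w : ℂ) :
    expI w ^ m = Complex.exp (Complex.I * (m * (w - sideAngle m j))) := by
  have hm' : (m : ℂ) ≠ 0 := by exact_mod_cast hm.ne'
  rw [expI_pow, Complex.exp_eq_exp_iff_exists_int]
  refine ⟨j, ?_⟩
  rw [sideAngle]
  push_cast
  field_simp
  ring

lemma exists_delta_norm_expI_pow_sub_one_lt {m : ℕ} (hm : 0 < m) {ε : ℝ} (hε : 0 < ε) :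
    ∃ δ > 0, ∀ (j : ℕ) (w : ℂ), ‖w - sideAngle m j‖ < δ → ‖expI w ^ m - 1‖ < ε := by
  have hc : Continuous fun u : ℂ => Complex.exp (Complex.I * (m * u)) := by fun_prop
  obtain ⟨δ, hδ, h⟩ := Metric.continuous_iff.1 hc 0 ε hε
  refine ⟨δ, hδ, fun j w hw => ?_⟩
  have := h (w - sideAngle m j) (by simpa using hw)
  rw [expI_sub_sideAngle_pow hm j]
  simpa [dist_eq_norm] using this

/-- If `z^m` is near 1, its principal logarithm is small, and divided by `i m` it gives the
displacement in the angular coordinate from some vertex. Subtracting a multiple of `2π` brings the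
vertex number below `m`. -/
lemma exists_eps_near_corner {m : ℕ} (hm : 0 < m) {δ : ℝ} (hδ : 0 < δ) :
    ∃ ε > 0, ∀ z : ℂ, ‖z ^ m - 1‖ < ε → ∃ j < m, ∃ w, expI w = z ∧ ‖w - sideAngle m j‖ < δ := by
  have hm' : (m : ℂ) ≠ 0 := by exact_mod_cast hm.ne'
  have hc : ContinuousAt Complex.log 1 := continuousAt_clog (by simp)
  obtain ⟨ε, hε, h⟩ := Metric.continuousAt_iff.1 hc δ hδ
  refine ⟨min ε 1, by positivity, fun z hz => ?_⟩
  have hz0 : z ≠ 0 := by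
    rintro rfl
    rw [zero_pow hm.ne'] at hz
    simp at hz
  have hu := h (x := z ^ m) (by rw [dist_eq_norm]; exact hz.trans_le (min_le_left _ _))
  rw [Complex.log_one, dist_zero_right] at hu
  obtain ⟨w, rfl⟩ := exists_expI hz0
  set u := Complex.log (expI w ^ m) with hu_def
  have h1 : Complex.exp u = expI w ^ m := Complex.exp_log (pow_ne_zero _ hz0)
  rw [expI_pow, Complex.exp_eq_exp_iff_exists_int] at h1
  obtain ⟨N, hN⟩ := h1
  have hmZ : (m : ℤ) ≠ 0 := by exact_mod_cast hm.ne'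
  obtain ⟨j, hj⟩ := Int.eq_ofNat_of_zero_le (Int.emod_nonneg (-N) hmZ)
  have hjm : j < m := by
    have := Int.emod_lt_of_pos (-N) (show (0 : ℤ) < m by exact_mod_cast hm)
    rw [hj] at this
    exact_mod_cast this
  have hdiv := Int.emod_add_mul_ediv (-N) m
  rw [hj] at hdiv
  set q := -N / m
  refine ⟨j, hjm, w - 2 * Real.pi * q, ?_, ?_⟩
  · rw [expI_eq_iff]
    exact ⟨-q, by push_cast; ring⟩
  · have h2 : w - 2 * Real.pi * q - sideAngle m j = u / (Complex.I * m) := by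
      have h3 : (N : ℂ) = -(j + m * q) := by
        have : N = -(j + m * q) := by rw [hdiv]; ring
        rw [this]; push_cast; ring
      rw [eq_div_iff (mul_ne_zero Complex.I_ne_zero hm'), hN, h3, sideAngle]
      push_cast
      field_simp
      ring
    rw [h2, norm_div, norm_mul, Complex.norm_I, one_mul, Complex.norm_natCast]
    refine lt_of_le_of_lt (div_le_self (norm_nonneg u) ?_) hu
    exact_mod_cast hm

namespace IsPolygonChart

variable {X : Type*} [TopologicalSpace X] {g n : ℕ} {π : ℂ → X}

/-- Gluing replaces `s` by `1 - s`, hence `z^m` by its complex conjugate. So `|z^m - 1|` descends to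
the surface and measures the distance from the punctures. -/
lemma _root_.SideGlued.norm_pow_sub_one_eq {z w : ℂ} (h : SideGlued g n z w) :
    ‖z ^ sideCount g n - 1‖ = ‖w ^ sideCount g n - 1‖ := by
  obtain ⟨k, hk, s, hs, rfl, rfl⟩ := h
  have hm : 0 < sideCount g n := by omega
  rw [sidePoint_pow hm, sidePoint_pow hm]
  have h1 : Complex.exp (2 * Real.pi * Complex.I * ((1 - s : ℝ) : ℂ)) =
      (starRingEnd ℂ) (Complex.exp (2 * Real.pi * Complex.I * s)) := by
    rw [← Complex.exp_conj, Complex.exp_eq_exp_iff_exists_int]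
    refine ⟨1, ?_⟩
    simp only [map_mul, Complex.conj_ofReal, Complex.conj_I, map_ofNat]
    push_cast
    ring
  rw [h1, ← map_one (starRingEnd ℂ), ← map_sub, RCLike.norm_conj, map_one]

/-- Compact subsets of the punctured surface stay away from the vertices. -/
lemma exists_lt_norm_pow_sub_one (hπ : IsPolygonChart g n π) {S : Set X} (hS : IsCompact S) :
    ∃ ε > 0, ∀ z ∈ polyDisc (sideCount g n), π z ∈ S → ε < ‖z ^ sideCount g n - 1‖ := by
  let m := sideCount g n
  let W : ℕ → Set X := fun i => π '' (polyDisc m ∩ {z | 1 / ((i : ℝ) + 1) < ‖z ^ m - 1‖})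
  have hW : ∀ i, ∀ z ∈ polyDisc m, π z ∈ W i ↔ 1 / ((i : ℝ) + 1) < ‖z ^ m - 1‖ := by
    intro i z hz
    refine ⟨?_, fun h => ⟨z, ⟨hz, h⟩, rfl⟩⟩
    rintro ⟨w, ⟨hw, h⟩, hwz⟩
    rcases (hπ.eq_iff w hw z hz).1 hwz with rfl | h1
    · exact h
    · rw [← h1.norm_pow_sub_one_eq]; exact h
  have hWo : ∀ i, IsOpen (W i) := fun i => (hπ.isOpen_iff _).2
    ⟨{z | 1 / ((i : ℝ) + 1) < ‖z ^ m - 1‖}, isOpen_lt continuous_const (by fun_prop), hW i⟩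
  have hmono : Monotone W := by
    intro i j hij
    refine image_mono (inter_subset_inter_right _ fun z hz => ?_)
    refine lt_of_le_of_lt ?_ (show 1 / ((i : ℝ) + 1) < _ from hz)
    have : (i : ℝ) ≤ j := by exact_mod_cast hij
    exact one_div_le_one_div_of_le (by positivity) (by linarith)
  obtain ⟨i, hi⟩ := hS.elim_directed_cover W hWo (fun x _ => by
    obtain ⟨z, hz, rfl⟩ := hπ.surj x
    have h0 : 0 < ‖z ^ m - 1‖ := norm_pos_iff.2 (sub_ne_zero.2 hz.2)
    obtain ⟨i, hi⟩ := exists_nat_one_div_lt h0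
    exact mem_iUnion.2 ⟨i, (hW i z hz).2 hi⟩) hmono.directed_le
  exact ⟨1 / ((i : ℝ) + 1), by positivity, fun z hz hzS => (hW i z hz).1 (hi hzS)⟩

end IsPolygonChart

lemma eq_of_eventually_eq_of_convex {T : Type*} {f : ℂ → T} {V : Set ℂ} (hV : Convex ℝ V)
    (h : ∀ w ∈ V, ∀ᶠ x in 𝓝[V] w, f x = f w) {a b : ℂ} (ha : a ∈ V) (hb : b ∈ V) : f a = f b := by
  have : PreconnectedSpace V := Subtype.preconnectedSpace hV.isPreconnected
  have h1 : IsLocallyConstant (fun w : V => f w) := by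
    refine (IsLocallyConstant.iff_eventually_eq _).2 fun w => ?_
    have := h w w.2
    rw [nhdsWithin_eq_map_subtype_coe w.2] at this
    exact this
  exact h1.apply_eq_of_preconnectedSpace ⟨a, ha⟩ ⟨b, hb⟩

/-- The part of the disc near the vertex `j`, in the angular coordinate. -/
def corner (m : ℕ) (δ : ℝ) (j : ℕ) : Set ℂ := {w | ‖w - sideAngle m j‖ < δ ∧ 0 < w.im}

/-- A half disc at the end point of side `k`. -/
def endHalf (m : ℕ) (δ : ℝ) (k : ℕ) : Set ℂ :=
  {w | ‖w - sideAngle m (k + 1)‖ < δ ∧ w.re < sideAngle m (k + 1)}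

/-- A half disc at the initial point of side `k`. -/
def startHalf (m : ℕ) (δ : ℝ) (k : ℕ) : Set ℂ :=
  {w | ‖w - sideAngle m k‖ < δ ∧ sideAngle m k < w.re}

lemma convex_norm_sub_lt (c : ℂ) (δ : ℝ) : Convex ℝ {w : ℂ | ‖w - c‖ < δ} := by
  have := convex_ball c δ
  rwa [show Metric.ball c δ = {w : ℂ | ‖w - c‖ < δ} by ext; simp [dist_eq_norm]] at this

lemma convex_corner (m : ℕ) (δ : ℝ) (j : ℕ) : Convex ℝ (corner m δ j) :=
  (convex_norm_sub_lt _ _).inter (convex_halfSpace_im_gt 0)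

lemma convex_endHalf (m : ℕ) (δ : ℝ) (k : ℕ) : Convex ℝ (endHalf m δ k) :=
  (convex_norm_sub_lt _ _).inter (convex_halfSpace_re_lt _)

lemma convex_startHalf (m : ℕ) (δ : ℝ) (k : ℕ) : Convex ℝ (startHalf m δ k) :=
  (convex_norm_sub_lt _ _).inter (convex_halfSpace_re_gt _)

lemma endHalf_subset {m : ℕ} {δ : ℝ} (hδ : δ ≤ sideAngle m 1) (k : ℕ) :
    endHalf m δ k ⊆ sideStrip m k := by
  rintro w ⟨h1, h2⟩
  refine ⟨?_, h2⟩
  have h3 := (Complex.abs_re_le_norm _).trans_lt h1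
  rw [Complex.sub_re, Complex.ofReal_re, sideAngle_add] at h3
  linarith [(abs_lt.1 h3).1]

lemma startHalf_subset {m : ℕ} {δ : ℝ} (hδ : δ ≤ sideAngle m 1) (k : ℕ) :
    startHalf m δ k ⊆ sideStrip m k := by
  rintro w ⟨h1, h2⟩
  refine ⟨h2, ?_⟩
  have h3 := (Complex.abs_re_le_norm _).trans_lt h1
  rw [Complex.sub_re, Complex.ofReal_re] at h3
  rw [sideAngle_add]
  linarith [(abs_lt.1 h3).2]

section

variable {g n : ℕ} {δ : ℝ} {k : ℕ} {w : ℂ}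

lemma norm_stripReflect_sub_end :
    ‖stripReflect g n k w - sideAngle (sideCount g n) (partnerSide g k)‖ =
      ‖w - sideAngle (sideCount g n) (k + 1)‖ := by
  rw [← norm_neg, stripReflect, show (k + partnerSide g k + 1 : ℝ) = (k + 1) + partnerSide g k by ring,
    sideAngle_add]
  congr 1
  push_cast
  ring

lemma norm_stripReflect_sub_start :
    ‖stripReflect g n k w - sideAngle (sideCount g n) (partnerSide g k + 1)‖ =
      ‖w - sideAngle (sideCount g n) k‖ := by
  rw [← norm_neg, stripReflect, show (k + partnerSide g k + 1 : ℝ) = k + (partnerSide g k + 1) by ring,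
    sideAngle_add]
  congr 1
  push_cast
  ring

end

lemma exists_mem_endHalf {m : ℕ} {δ : ℝ} (hδ : 0 < δ) (k : ℕ) :
    ∃ w w' : ℂ, w ∈ endHalf m δ k ∧ w' ∈ endHalf m δ k ∧ 0 < w.im ∧ w'.im < 0 := by
  have h : ∀ y : ℝ, |y| ≤ δ / 4 →
      (⟨sideAngle m (k + 1) - δ / 4, y⟩ : ℂ) ∈ endHalf m δ k := fun y hy => by
    refine ⟨(Complex.norm_le_abs_re_add_abs_im _).trans_lt ?_, by simp; linarith⟩
    simp
    rw [abs_of_pos (by linarith : 0 < δ / 4)]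
    linarith
  refine ⟨_, _, h (δ / 4) ?_, h (-(δ / 4)) ?_, by simp; linarith, by simp; linarith⟩
  · rw [abs_of_pos (by linarith)]
  · rw [abs_neg, abs_of_pos (by linarith)]

lemma exists_mem_startHalf {m : ℕ} {δ : ℝ} (hδ : 0 < δ) (k : ℕ) :
    ∃ w w' : ℂ, w ∈ startHalf m δ k ∧ w' ∈ startHalf m δ k ∧ 0 < w.im ∧ w'.im < 0 := by
  have h : ∀ y : ℝ, |y| ≤ δ / 4 →
      (⟨sideAngle m k + δ / 4, y⟩ : ℂ) ∈ startHalf m δ k := fun y hy => by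
    refine ⟨(Complex.norm_le_abs_re_add_abs_im _).trans_lt ?_, by simp; linarith⟩
    simp
    rw [abs_of_pos (by linarith : 0 < δ / 4)]
    linarith
  refine ⟨_, _, h (δ / 4) ?_, h (-(δ / 4)) ?_, by simp; linarith, by simp; linarith⟩
  · rw [abs_of_pos (by linarith)]
  · rw [abs_neg, abs_of_pos (by linarith)]

/-! ### Coordinates around punctures -/

section Puncture

variable {X : Type*} [TopologicalSpace X] {e : PuncturedDisc → X}

/-- The open punctured disc of radius `1/2` about a puncture. -/
def innerDisc (e : PuncturedDisc → X) : Set X := e '' {z | ‖(z : ℂ)‖ < 1 / 2}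

/-- The complement of the closed punctured disc of radius `1/2` about a puncture. -/
def outerPart (e : PuncturedDisc → X) : Set X := (e '' {z | ‖(z : ℂ)‖ ≤ 1 / 2})ᶜ

/-- The circle of radius `1/2` about a puncture. -/
def middleCircle (e : PuncturedDisc → X) : Set X := e '' {z | ‖(z : ℂ)‖ = 1 / 2}

lemma isOpen_innerDisc (he : IsPunctureCoordinate e) : IsOpen (innerDisc e) :=
  he.isOpenEmbedding.isOpenMap _ (isOpen_lt (by fun_prop) continuous_const)

lemma isOpen_outerPart (he : IsPunctureCoordinate e) : IsOpen (outerPart e) :=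
  he.isClosed_image.isOpen_compl

lemma disjoint_innerDisc_outerPart {X : Type*} {e : PuncturedDisc → X} :
    Disjoint (innerDisc e) (outerPart e) := by
  rw [outerPart, disjoint_compl_right_iff_subset]
  exact image_mono fun z (hz : ‖(z : ℂ)‖ < 1 / 2) => hz.le

lemma isCompact_middleCircle (he : IsPunctureCoordinate e) : IsCompact (middleCircle e) := by
  refine IsCompact.image ?_ he.isOpenEmbedding.continuous
  rw [Topology.IsEmbedding.subtypeVal.isCompact_iff]
  convert! isCompact_sphere (0 : ℂ) (1 / 2) using 1
  ext z
  rw [mem_sphere_zero_iff_norm]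
  constructor
  · rintro ⟨z, hz, rfl⟩; exact hz
  · intro hz
    exact ⟨⟨z, by rw [hz]; norm_num⟩, hz, rfl⟩

/-- The points `1/(i+2)` converge to the missing centre. This later forces the punctured disc to
reach a vertex of the polygon. -/
lemma not_isCompact_image (he : IsPunctureCoordinate e) :
    ¬ IsCompact (e '' {z | ‖(z : ℂ)‖ ≤ 1 / 2}) := by
  rw [← he.isOpenEmbedding.isEmbedding.isCompact_iff,
    Topology.IsEmbedding.subtypeVal.isCompact_iff]
  intro h
  have h1 : Tendsto (fun i : ℕ => ((1 / ((i : ℝ) + 2) : ℝ) : ℂ)) atTop (𝓝 0) := by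
    have : Tendsto (fun i : ℕ => 1 / ((i : ℝ) + 2)) atTop (𝓝 0) :=
      tendsto_const_nhds.div_atTop (tendsto_atTop_add_const_right _ _ tendsto_natCast_atTop_atTop)
    have h := (Complex.continuous_ofReal.tendsto 0).comp this
    rw [Complex.ofReal_zero] at h
    exact h
  have h2 : ∀ i : ℕ, ((1 / ((i : ℝ) + 2) : ℝ) : ℂ) ∈
      Subtype.val '' {z : PuncturedDisc | ‖(z : ℂ)‖ ≤ 1 / 2} := fun i => by
    have h3 : ‖((1 / ((i : ℝ) + 2) : ℝ) : ℂ)‖ = 1 / ((i : ℝ) + 2) := by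
      rw [Complex.norm_real, Real.norm_of_nonneg (by positivity)]
    have h4 : 1 / ((i : ℝ) + 2) ≤ 1 / 2 :=
      one_div_le_one_div_of_le (by norm_num) (by linarith [i.cast_nonneg (α := ℝ)])
    have h5 : 0 < ‖((1 / ((i : ℝ) + 2) : ℝ) : ℂ)‖ ∧ ‖((1 / ((i : ℝ) + 2) : ℝ) : ℂ)‖ < 1 := by
      rw [h3]; exact ⟨by positivity, by linarith⟩
    exact ⟨⟨_, h5⟩, h3.le.trans h4, rfl⟩
  obtain ⟨z, -, hz⟩ := h.isClosed.mem_of_tendsto h1 (.of_forall h2)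
  have := z.2.1
  rw [hz, norm_zero] at this
  exact lt_irrefl _ this

lemma subset_innerDisc_or_subset_outerPart (he : IsPunctureCoordinate e) {W : Set X}
    (hW : IsPreconnected W) (hS : Disjoint W (middleCircle e)) :
    W ⊆ innerDisc e ∨ W ⊆ outerPart e := by
  refine hW.subset_or_subset (isOpen_innerDisc he) (isOpen_outerPart he)
    disjoint_innerDisc_outerPart fun x hx => ?_
  by_contra h
  rw [mem_union, not_or, outerPart, notMem_compl_iff] at h
  obtain ⟨h1, z, hz, rfl⟩ := h
  have h2 : ‖(z : ℂ)‖ = 1 / 2 := le_antisymm hz (not_lt.1 fun h3 => h1 ⟨z, h3, rfl⟩)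
  exact disjoint_left.1 hS hx ⟨z, h2, rfl⟩

end Puncture

end


/-! ### Horizontal sections near a puncture and the corners of the polygon -/

open Set Filter Topology

noncomputable section

lemma sideChart_of_nonneg {X : Type*} {g n : ℕ} {π : ℂ → X} {k : ℕ} {w : ℂ} (h : 0 ≤ w.im) :
    sideChart g n π k w = π (expI w) := if_pos h

lemma sideChart_of_neg {X : Type*} {g n : ℕ} {π : ℂ → X} {k : ℕ} {w : ℂ} (h : w.im < 0) :
    sideChart g n π k w = π (expI (stripReflect g n k w)) := if_neg (not_le.2 h)

variable {X : Type*} [TopologicalSpace X] {g n : ℕ} {π : ℂ → X}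

lemma expI_mem_ball {w : ℂ} (h : 0 < w.im) : expI w ∈ Metric.ball (0 : ℂ) 1 :=
  mem_ball_zero_iff.2 (norm_expI_lt_one.2 h)

lemma IsPolygonChart.continuousAt_comp_expI (hπ : IsPolygonChart g n π) (hm : 0 < sideCount g n)
    {w : ℂ} (h : 0 < w.im) : ContinuousAt (fun w => π (expI w)) w :=
  ContinuousAt.comp (f := expI) (g := π)
    ((hπ.continuousOn.mono (ball_subset_polyDisc hm)).continuousAt
      (Metric.isOpen_ball.mem_nhds (expI_mem_ball h))) continuous_expI.continuousAt

/-- The section is regarded as a function on all of `X`, with an arbitrary value off the disc, so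
that it can be evaluated through the polygon chart. -/
lemma exists_horizontal_extension {J G T : Type*} [Group G] [MulAction G T] {C : Cocycle X J G}
    {e : PuncturedDisc → X} (he : IsPunctureCoordinate e) {s : PuncturedDisc → T}
    (hs : C.IsDev e s) : ∃ σ : X → T, ∀ x ∈ range e, ∀ i, x ∈ C.carrier i →
      ∀ᶠ y in 𝓝 x, C.g i y • σ y = C.g i x • σ x := by
  refine ⟨Function.extend e s fun _ => s (circlePoint 0), ?_⟩
  rintro _ ⟨z, rfl⟩ i hi
  rw [← he.isOpenEmbedding.map_nhds_eq z, eventually_map]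
  filter_upwards [hs z i hi] with x hx
  rw [he.isOpenEmbedding.injective.extend_apply, he.isOpenEmbedding.injective.extend_apply, hx]

/-- Each corner of the polygon lies inside or outside of a puncture, and the values of a horizontal
section in the corners inside are related by the letters of the sides. -/
theorem IsPolygonChart.exists_corner_values (hπ : IsPolygonChart g n π) (hm : 0 < sideCount g n)
    {T : Type*} [MulAction (FreeGroup (Letter g n)) T] {e : PuncturedDisc → X}
    (he : IsPunctureCoordinate e) {s : PuncturedDisc → T}
    (hs : (polygonCover hπ hm).cocycle.IsDev e s) :
    ∃ (inside : ℕ → Prop) (v : ℕ → T), (∃ j < sideCount g n, inside j) ∧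
      v (sideCount g n) = v 0 ∧
      ∀ k : Letter g n,
        ((inside (k + 1) ↔ inside (partnerSide g k)) ∧
          (inside (k + 1) → v (k + 1) = FreeGroup.of k • v (partnerSide g k))) ∧
        ((inside k ↔ inside (partnerSide g k + 1)) ∧
          (inside k → v k = FreeGroup.of k • v (partnerSide g k + 1))) := by
  obtain ⟨σ, hσ⟩ := exists_horizontal_extension he hs
  obtain ⟨ε, hε, hεS⟩ := hπ.exists_lt_norm_pow_sub_one (isCompact_middleCircle he)
  obtain ⟨δ₀, hδ₀, hδε⟩ := exists_delta_norm_expI_pow_sub_one_lt hm hε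
  have hang : 0 < sideAngle (sideCount g n) 1 := by
    rw [← sideAngle_zero (m := sideCount g n), sideAngle_lt_iff hm]; exact one_pos
  -- The first bound keeps the corners off the compact middle circle; the second keeps the half
  -- discs at the ends of a side inside its strip.
  obtain ⟨δ, hδ, hδle, hδang⟩ : ∃ δ > 0, δ ≤ δ₀ ∧ δ ≤ sideAngle (sideCount g n) 1 :=
    ⟨min δ₀ _, lt_min hδ₀ hang, min_le_left _ _, min_le_right _ _⟩
  have hcor : ∀ (j : ℕ) (w : ℂ), ‖w - sideAngle (sideCount g n) j‖ < δ →
      expI w ∈ polyDisc (sideCount g n) → π (expI w) ∉ middleCircle e := fun j w hw hz hzS =>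
    lt_asymm (hεS _ hz hzS) (hδε j w (hw.trans_le hδle))
  have hpd : ∀ {w : ℂ}, 0 < w.im → expI w ∈ polyDisc (sideCount g n) := fun h =>
    ball_subset_polyDisc hm (expI_mem_ball h)
  have hrange : innerDisc e ⊆ range e := image_subset_range _ _
  set inside : ℕ → Prop := fun j => ∀ w ∈ corner (sideCount g n) δ j, π (expI w) ∈ innerDisc e
    with hinside
  have hdich : ∀ j, ¬ inside j → ∀ w ∈ corner (sideCount g n) δ j, π (expI w) ∈ outerPart e := by
    intro j hj
    have hpre : IsPreconnected ((fun w => π (expI w)) '' corner (sideCount g n) δ j) :=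
      (convex_corner _ _ _).isPreconnected.image _ fun w hw =>
        (hπ.continuousAt_comp_expI hm hw.2).continuousWithinAt
    have hdisj : Disjoint ((fun w => π (expI w)) '' corner (sideCount g n) δ j)
        (middleCircle e) := by
      rw [disjoint_left]
      rintro _ ⟨w, hw, rfl⟩
      exact hcor j w hw.1 (hpd hw.2)
    rcases subset_innerDisc_or_subset_outerPart he hpre hdisj with h | h
    · exact absurd (fun w hw => h ⟨w, hw, rfl⟩) hj
    · exact fun w hw => h ⟨w, hw, rfl⟩
  let ctr : ℕ → ℂ := fun j => sideAngle (sideCount g n) j + (δ / 2 : ℝ) * Complex.I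
  have hctr : ∀ j, ctr j ∈ corner (sideCount g n) δ j := fun j => by
    refine ⟨?_, by simp [ctr, hδ]⟩
    simp only [ctr, add_sub_cancel_left, norm_mul, Complex.norm_real, Complex.norm_I, mul_one]
    rw [Real.norm_of_nonneg (by linarith)]
    linarith
  have hconst : ∀ j, inside j → ∀ w ∈ corner (sideCount g n) δ j,
      σ (π (expI w)) = σ (π (expI (ctr j))) := by
    intro j hj w hw
    refine eq_of_eventually_eq_of_convex (f := fun w => σ (π (expI w))) (convex_corner _ _ _)
      (fun w hw => nhdsWithin_le_nhds ?_) hw (hctr j)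
    have h1 := hσ _ (hrange (hj w hw)) none ⟨_, expI_mem_ball hw.2, rfl⟩
    filter_upwards [(hπ.continuousAt_comp_expI hm hw.2).eventually h1] with x hx
    exact (one_smul _ _).symm.trans (hx.trans (one_smul _ _))
  -- `V` is a half disc straddling side `k`: its upper part lies in corner `j`, and its lower part
  -- is reflected into corner `j'`. Its image is connected and misses the middle circle, so both
  -- corners are on the same side of that circle. In the handle chart the section is constant over
  -- `V`, with transition 1 above and the letter below.
  have hcross : ∀ (k : Letter g n) (V : Set ℂ) (j j' : ℕ), Convex ℝ V →
      V ⊆ sideStrip (sideCount g n) k →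
      (∀ w ∈ V, ‖w - sideAngle (sideCount g n) j‖ < δ ∧
        ‖stripReflect g n k w - sideAngle (sideCount g n) j'‖ < δ) →
      (∃ w w', w ∈ V ∧ w' ∈ V ∧ 0 < w.im ∧ w'.im < 0) →
      (inside j ↔ inside j') ∧ (inside j → σ (π (expI (ctr j))) =
        FreeGroup.of k • σ (π (expI (ctr j')))) := by
    rintro k V j j' hV hVk hVδ ⟨w, w', hw, hw', hpos, hneg⟩
    have hwc : w ∈ corner (sideCount g n) δ j := ⟨(hVδ w hw).1, hpos⟩
    have hwc' : stripReflect g n k w' ∈ corner (sideCount g n) δ j' :=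
      ⟨(hVδ w' hw').2, by rw [stripReflect_im]; linarith⟩
    have hcont := (hπ.continuousOn_sideChart k.1.2).mono hVk
    have hdisj : Disjoint (sideChart g n π k '' V) (middleCircle e) := by
      rw [disjoint_left]
      rintro _ ⟨x, hx, rfl⟩
      rcases le_or_gt 0 x.im with h | h
      · rw [sideChart_of_nonneg h]
        exact hcor j x (hVδ x hx).1 (expI_mem_polyDisc hm (hVk hx) h)
      · rw [sideChart_of_neg h]
        exact hcor j' _ (hVδ x hx).2
          (expI_mem_polyDisc hm (stripReflect_mem (hVk hx)) (by rw [stripReflect_im]; linarith))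
    have e1 := sideChart_of_nonneg (g := g) (n := n) (π := π) (k := k) hpos.le
    have e2 := sideChart_of_neg (g := g) (n := n) (π := π) (k := k) hneg
    have hne : ∀ {x}, x ∈ innerDisc e → x ∉ outerPart e := fun h h' =>
      disjoint_left.1 disjoint_innerDisc_outerPart h h'
    rcases subset_innerDisc_or_subset_outerPart he (hV.isPreconnected.image _ hcont) hdisj
      with h | h
    · have i1 : inside j := by
        by_contra h1
        refine hne (h ⟨w, hw, rfl⟩) ?_
        rw [e1]; exact hdich j h1 w hwc
      have i2 : inside j' := by
        by_contra h1
        refine hne (h ⟨w', hw', rfl⟩) ?_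
        rw [e2]; exact hdich j' h1 _ hwc'
      refine ⟨⟨fun _ => i2, fun _ => i1⟩, fun _ => ?_⟩
      have hF := eq_of_eventually_eq_of_convex (f := fun x =>
        (polygonCover hπ hm).trans k (sideChart g n π k x) • σ (sideChart g n π k x)) hV
        (fun x hx => (hcont x hx).eventually (hσ _ (hrange (h ⟨x, hx, rfl⟩)) (some k)
          ⟨x, hVk hx, rfl⟩)) hw hw'
      have hA : (polygonCover hπ hm).trans k (sideChart g n π k w) = 1 :=
        HandleCover.trans_of_mem_A ⟨w, ⟨hVk hw, hpos⟩, rfl⟩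
      have hB : (polygonCover hπ hm).trans k (sideChart g n π k w') = .of k :=
        HandleCover.trans_of_mem_B ⟨w', ⟨hVk hw', hneg⟩, rfl⟩
      simp only [hA, hB, one_smul] at hF
      rw [e1, e2, hconst j i1 w hwc, hconst j' i2 _ hwc'] at hF
      exact hF
    · have i1 : ¬ inside j := fun h1 => by
        refine hne (h1 w hwc) ?_
        rw [← e1]; exact h ⟨w, hw, rfl⟩
      have i2 : ¬ inside j' := fun h1 => by
        refine hne (h1 _ hwc') ?_
        rw [← e2]; exact h ⟨w', hw', rfl⟩
      exact ⟨⟨fun h1 => absurd h1 i1, fun h1 => absurd h1 i2⟩, fun h1 => absurd h1 i1⟩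
  have hper : ∀ w : ℂ, expI (w + 2 * Real.pi) = expI w := fun w =>
    expI_eq_iff.2 ⟨1, by simp⟩
  have h2π : ((sideAngle (sideCount g n) (sideCount g n : ℕ) : ℝ) : ℂ) = 2 * Real.pi := by
    rw [sideAngle_self hm]; push_cast; rfl
  have h00 : ((sideAngle (sideCount g n) (0 : ℕ) : ℝ) : ℂ) = 0 := by
    rw [Nat.cast_zero, sideAngle_zero, Complex.ofReal_zero]
  refine ⟨inside, fun j => σ (π (expI (ctr j))), ?_, ?_, fun k => ⟨?_, ?_⟩⟩
  -- If no corner were inside, the closed punctured disc would be a closed subset of the image of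
  -- the polygon with neighbourhoods of the vertices removed. That image is compact, which
  -- contradicts `not_isCompact_image`.
  · by_contra hnone
    push Not at hnone
    obtain ⟨ε', hε', hnear⟩ := exists_eps_near_corner hm hδ
    have hQ : IsCompact (π '' (Metric.closedBall 0 1 ∩ {z | ε' ≤ ‖z ^ sideCount g n - 1‖})) := by
      refine IsCompact.image_of_continuousOn ((isCompact_closedBall _ _).inter_right
        (isClosed_le continuous_const (by fun_prop))) (hπ.continuousOn.mono ?_)
      rintro z ⟨hz, hz'⟩
      refine ⟨mem_closedBall_zero_iff.1 hz, fun h1 => ?_⟩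
      rw [mem_ofPred_eq, h1, sub_self, norm_zero] at hz'
      linarith
    refine not_isCompact_image he (hQ.of_isClosed_subset he.isClosed_image fun x hx => ?_)
    obtain ⟨z, hz, rfl⟩ := hπ.surj x
    refine ⟨z, ⟨mem_closedBall_zero_iff.2 hz.1, ?_⟩, rfl⟩
    by_contra hlt
    obtain ⟨j, hj, w, rfl, hw⟩ := hnear z (not_le.1 hlt)
    have hin : π (expI w) ∈ innerDisc e := by
      obtain ⟨y, hy, hyw⟩ := hx
      refine ⟨y, lt_of_le_of_ne hy fun h => hcor j w hw hz ⟨y, h, hyw⟩, hyw⟩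
    have him : 0 ≤ w.im := norm_expI_le_one.1 hz.1
    -- The point may lie on a side, whereas corners are open half discs; moving it slightly upwards
    -- brings it into the corner without leaving the inner disc.
    have hc : Continuous fun t : ℝ => w + t * Complex.I := by fun_prop
    have hc0 : Tendsto (fun t : ℝ => w + t * Complex.I) (𝓝[>] 0) (𝓝 w) := by
      have := hc.tendsto 0
      rw [Complex.ofReal_zero, zero_mul, add_zero] at this
      exact this.mono_left nhdsWithin_le_nhds
    have himt : ∀ t : ℝ, 0 < t → 0 < (w + t * Complex.I).im := fun t ht => by
      simp; linarith
    have ht1 : Tendsto (fun t : ℝ => expI (w + t * Complex.I)) (𝓝[>] 0)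
        (𝓝[polyDisc (sideCount g n)] expI w) := by
      refine tendsto_nhdsWithin_iff.2 ⟨(continuous_expI.tendsto w).comp hc0, ?_⟩
      filter_upwards [self_mem_nhdsWithin] with t ht
      exact hpd (himt t ht)
    have ev1 := ((hπ.continuousOn _ hz).tendsto.comp ht1).eventually_mem
      ((isOpen_innerDisc he).mem_nhds hin)
    have ev2 := hc0.eventually_mem ((isOpen_lt (f := fun w : ℂ =>
      ‖w - sideAngle (sideCount g n) j‖) (by fun_prop) continuous_const).mem_nhds hw)
    obtain ⟨t, ⟨ht1, ht2⟩, ht⟩ := ((ev1.and ev2).and self_mem_nhdsWithin).exists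
    exact disjoint_left.1 disjoint_innerDisc_outerPart ht1
      (hdich j (hnone j hj) _ ⟨ht2, himt t ht⟩)
  -- Corner `m` is corner 0 again, reached after the full angle `2π`.
  · have : ctr (sideCount g n) = ctr 0 + 2 * Real.pi := by
      simp only [ctr]
      rw [h2π, h00]; ring
    simp only [this, hper]
  · refine hcross k (endHalf _ δ k) _ _ (convex_endHalf _ _ _) (endHalf_subset hδang _)
      (fun w hw => ⟨by push_cast; exact hw.1, ?_⟩) (exists_mem_endHalf hδ _)
    rw [norm_stripReflect_sub_end]; exact hw.1
  · refine hcross k (startHalf _ δ k) _ _ (convex_startHalf _ _ _) (startHalf_subset hδang _)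
      (fun w hw => ⟨hw.1, ?_⟩) (exists_mem_startHalf hδ _)
    push_cast
    rw [norm_stripReflect_sub_start]; exact hw.1

end


/-! ### Monotonicity of the corner values around the polygon -/

open Set Filter Topology

noncomputable section

/-- The kind of the generator of a letter: the second side of each handle is odd. -/
def letterKind (g n : ℕ) (k : Letter g n) : GenKind :=
  if (k : ℕ) < 4 * g ∧ (k : ℕ) % 4 = 1 then .odd else .tiny

section corners

variable {g n : ℕ} {r : FreeGroup (Letter g n) →* (ℝ ≃o ℝ)} {inside : ℕ → Prop} {v : ℕ → ℝ}

lemma partnerSide_handle_one {g i : ℕ} (hi : i < g) : partnerSide g (4 * i) = 4 * i + 2 := by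
  simp only [partnerSide]; split_ifs <;> omega

lemma partnerSide_handle_two {g i : ℕ} (hi : i < g) : partnerSide g (4 * i + 1) = 4 * i + 3 := by
  simp only [partnerSide]; split_ifs <;> omega

lemma partnerSide_fold {g i : ℕ} : partnerSide g (4 * g + 2 * i) = 4 * g + 2 * i + 1 := by
  simp only [partnerSide]; split_ifs <;> omega

/-- Around a handle the corner values decrease. -/
lemma corner_handle
    (hodd : ∀ i j, letterKind g n i = .tiny → letterKind g n j = .odd →
      ∀ t, r (.of i) (r (.of j) t) < r (.of j) (r (.of i) t))
    (hk : ∀ k : Letter g n,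
      ((inside (k + 1) ↔ inside (partnerSide g k)) ∧
        (inside (k + 1) → v (k + 1) = r (.of k) (v (partnerSide g k)))) ∧
      ((inside k ↔ inside (partnerSide g k + 1)) ∧
        (inside k → v k = r (.of k) (v (partnerSide g k + 1)))))
    {i : ℕ} (hi : i < g) :
    (inside (4 * i) ↔ inside (4 * i + 1)) ∧ (inside (4 * i) ↔ inside (4 * i + 2)) ∧
      (inside (4 * i) ↔ inside (4 * i + 3)) ∧ (inside (4 * i) ↔ inside (4 * i + 4)) ∧
      (inside (4 * i) → v (4 * i + 4) < v (4 * i)) := by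
  have hpA := partnerSide_handle_one hi
  have hpB := partnerSide_handle_two hi
  let A : Letter g n := ⟨⟨4 * i, by simp only [sideCount]; omega⟩, by simp only [hpA]; omega⟩
  let B : Letter g n := ⟨⟨4 * i + 1, by simp only [sideCount]; omega⟩, by simp only [hpB]; omega⟩
  have hA : letterKind g n A = .tiny := if_neg (by simp only [A]; omega)
  have hB : letterKind g n B = .odd := if_pos (by simp only [B]; omega)
  obtain ⟨⟨a1, a2⟩, a3, a4⟩ := hk A
  obtain ⟨⟨b1, b2⟩, b3, b4⟩ := hk B
  have hpA' : partnerSide g A = 4 * i + 2 := hpA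
  have hpB' : partnerSide g B = 4 * i + 3 := hpB
  rw [hpA'] at a1 a2 a3 a4
  rw [hpB'] at b1 b2 b3 b4
  -- With `u` the value at corner `4i+3`, the side relations give `B v(4i+4) = v(4i+1) = A B u` and
  -- `v(4i) = A u`. Thus `A B u < B A u` says `B v(4i+4) < B v(4i)`.
  have hAB := hodd A B hA hB (v (4 * i + 3))
  have i2 := a3.trans b1.symm
  have i1 := i2.trans a1.symm
  refine ⟨i1, i2, a3, i1.trans b3, fun h0 => ?_⟩
  have h1 := a2 (i1.1 h0)
  have h2 := a4 h0
  have h3 := b2 (i2.1 h0)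
  have h4 := b4 (i1.1 h0)
  exact (r (.of B)).lt_iff_lt.1 ((((h4.symm.trans h1).trans (congrArg _ h3)).trans_lt hAB).trans_eq
    (congrArg _ h2.symm))

/-- Around a folded pair of sides the corner values decrease, and the middle corner is outside. -/
lemma corner_fold
    (htiny : ∀ i, letterKind g n i = .tiny → ∀ t, t < r (.of i) t)
    (hk : ∀ k : Letter g n,
      ((inside (k + 1) ↔ inside (partnerSide g k)) ∧
        (inside (k + 1) → v (k + 1) = r (.of k) (v (partnerSide g k)))) ∧
      ((inside k ↔ inside (partnerSide g k + 1)) ∧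
        (inside k → v k = r (.of k) (v (partnerSide g k + 1)))))
    {i : ℕ} (hi : i < n - 1) :
    ¬ inside (4 * g + 2 * i + 1) ∧ (inside (4 * g + 2 * i) ↔ inside (4 * g + 2 * i + 2)) ∧
      (inside (4 * g + 2 * i) → v (4 * g + 2 * i + 2) < v (4 * g + 2 * i)) := by
  have hp := partnerSide_fold (g := g) (i := i)
  let D : Letter g n :=
    ⟨⟨4 * g + 2 * i, by simp only [sideCount]; omega⟩, by simp only [hp]; omega⟩
  have hD : letterKind g n D = .tiny := if_neg (by simp only [D]; omega)
  obtain ⟨⟨_, d2⟩, d3, d4⟩ := hk D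
  simp only [D, hp] at d2 d3 d4
  -- The free end of a folded side is glued to itself by the letter, so a value there would be a
  -- fixed point of a tiny generator.
  refine ⟨fun h => ?_, d3, fun h => ?_⟩
  · exact (htiny D hD _).ne (d2 h)
  · exact (htiny D hD _).trans_eq (d4 h).symm

/-- There is no consistent choice of values in the corners around a puncture. -/
theorem false_of_corner_values (hm : 0 < sideCount g n)
    (htiny : ∀ i, letterKind g n i = .tiny → ∀ t, t < r (.of i) t)
    (hodd : ∀ i j, letterKind g n i = .tiny → letterKind g n j = .odd →
      ∀ t, r (.of i) (r (.of j) t) < r (.of j) (r (.of i) t))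
    (hex : ∃ j < sideCount g n, inside j) (hv : v (sideCount g n) = v 0)
    (hk : ∀ k : Letter g n,
      ((inside (k + 1) ↔ inside (partnerSide g k)) ∧
        (inside (k + 1) → v (k + 1) = r (.of k) (v (partnerSide g k)))) ∧
      ((inside k ↔ inside (partnerSide g k + 1)) ∧
        (inside k → v k = r (.of k) (v (partnerSide g k + 1))))) : False := by
  have h1 : ∀ i ≤ g, (inside (4 * i) ↔ inside 0) ∧
      (inside 0 → v (4 * i) ≤ v 0 ∧ (0 < i → v (4 * i) < v 0)) := by
    intro i
    induction i with
    | zero => simp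
    | succ i ih =>
      intro hi
      obtain ⟨ih1, ih2⟩ := ih (by omega)
      obtain ⟨-, -, -, h4, hlt⟩ := corner_handle hodd hk (i := i) (by omega)
      rw [show 4 * (i + 1) = 4 * i + 4 by ring]
      refine ⟨h4.symm.trans ih1, fun h0 => ?_⟩
      have := (hlt (ih1.2 h0)).trans_le (ih2 h0).1
      exact ⟨this.le, fun _ => this⟩
  obtain ⟨hg1, hg2⟩ := h1 g le_rfl
  have h2 : ∀ i ≤ n - 1, (inside (4 * g + 2 * i) ↔ inside 0) ∧
      (inside 0 → v (4 * g + 2 * i) ≤ v 0 ∧ (0 < 4 * g + 2 * i → v (4 * g + 2 * i) < v 0)) := by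
    intro i
    induction i with
    | zero => exact fun _ => ⟨hg1, fun h0 => ⟨(hg2 h0).1, fun h => (hg2 h0).2 (by omega)⟩⟩
    | succ i ih =>
      intro hi
      obtain ⟨ih1, ih2⟩ := ih (by omega)
      obtain ⟨-, h4, hlt⟩ := corner_fold htiny hk (i := i) (by omega)
      rw [show 4 * g + 2 * (i + 1) = 4 * g + 2 * i + 2 by ring]
      refine ⟨h4.symm.trans ih1, fun h0 => ?_⟩
      have := (hlt (ih1.2 h0)).trans_le (ih2 h0).1
      exact ⟨this.le, fun _ => this⟩
  -- Were corner 0 inside, the values would decrease strictly all the way round and yet return to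
  -- the initial one. Every other corner is inside together with corner 0 or is the free end of a
  -- fold, so no corner can be inside.
  have h0 : ¬ inside 0 := fun h0 => (((h2 (n - 1) le_rfl).2 h0).2 hm).ne hv
  obtain ⟨j, hj, hin⟩ := hex
  simp only [sideCount] at hj
  rcases lt_or_ge j (4 * g) with hjg | hjg
  · obtain ⟨a, b, c, -⟩ := corner_handle hodd hk (i := j / 4) (by omega)
    have hz : ¬ inside (4 * (j / 4)) := fun h => h0 ((h1 (j / 4) (by omega)).1.1 h)
    have : j = 4 * (j / 4) ∨ j = 4 * (j / 4) + 1 ∨ j = 4 * (j / 4) + 2 ∨ j = 4 * (j / 4) + 3 := by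
      omega
    rcases this with h | h | h | h <;> rw [h] at hin <;> tauto
  · obtain ⟨a, -⟩ := corner_fold htiny hk (i := (j - 4 * g) / 2) (by omega)
    have hz := fun h => h0 ((h2 ((j - 4 * g) / 2) (by omega)).1.1 h)
    have : j = 4 * g + 2 * ((j - 4 * g) / 2) ∨ j = 4 * g + 2 * ((j - 4 * g) / 2) + 1 := by
      omega
    rcases this with h | h <;> rw [h] at hin <;> tauto

end corners

end


/-! ### Assembly of the representation -/

open Set Filter Topology

theorem corollary5p5 {X : Type*} [TopologicalSpace X] (g n : ℕ)
    (hX : IsPuncturedSurface g n X) (hyperbolic : 2 < 2 * g + n) (x₀ : X)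
    (η : ℝ → ℝ) (hη : ContinuousOn η (Set.Ioo 0 1)) (hη_pos : ∀ x ∈ Set.Ioo (0 : ℝ) 1, 0 < η x) :
    ∃ ρ : FundamentalGroup X x₀ →* (unitInterval ≃ₜ unitInterval),
      IsWellTapered ρ ∧
      ∀ γ : FundamentalGroup X x₀, IsLoopAroundPuncture γ →
        (∀ p : unitInterval, 0 < p → p < 1 → ρ γ p ≠ p) ∧ TapersWithin η (ρ γ) := by
  have hn := hX.1
  have hm : 0 < sideCount g n := by simp only [sideCount]; omega
  obtain ⟨π, hπ⟩ := exists_isPolygonChart hX hm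
  obtain ⟨r, htame, hfaithful, htiny, hodd⟩ := exists_faithful_tame_rep (letterKind g n)
  obtain ⟨H, hH, h0, h1⟩ := exists_isSlowChart hη hη_pos
  let C := (polygonCover hπ hm).cocycle
  refine ⟨hH.conjHom.comp (r.comp (C.hol x₀)), ⟨fun α hα p hp0 hp1 _ => ?_, fun α => ?_⟩,
    fun γ hγ => ⟨fun p hp0 hp1 hp => ?_, ?_⟩⟩
  · refine hH.eventually_conjHom_ne (htame _) (hfaithful _ fun h => hα ?_) hp0 hp1
    exact HandleCover.hol_injective x₀ (h.trans (map_one _).symm)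
  · exact hH.isTaperedDiffeo_conjHom (htame _)
  · obtain ⟨e, y, δ, c, he, hc, rfl⟩ := hγ
    obtain ⟨t, ht⟩ := hH.exists_eq (x := p) ⟨hp0, hp1⟩
    -- The free group acts on the line through `r`. A fixed point of the peripheral element in the
    -- interval is, in the chart `H`, a point of the line fixed by the holonomy.
    let _ : MulAction (FreeGroup (Letter g n)) ℝ :=
      { smul := fun w t => r w t
        one_smul := fun t => by change r 1 t = t; rw [map_one]; rfl
        mul_smul := fun w w' t => by change r (w * w') t = r w (r w' t); rw [map_mul]; rfl }
    have hfix : C.pathHol ((δ.trans c).trans δ.symm) • t = t :=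
      (hH.conjHom_eq_iff _ ht.symm).1 hp
    obtain ⟨s, hs⟩ := C.exists_isDev_of_fixed he.isOpenEmbedding.continuous δ c hc hfix
    obtain ⟨inside, v, hex, hv, hk⟩ := hπ.exists_corner_values hm he hs
    exact false_of_corner_values hm htiny hodd hex hv hk
  · exact hH.tapersWithin_conjHom h0 h1 (htame _)
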